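/- Let $\ell \ge 5$ be a prime number. (1) (Embedding Theorem) Let $K$ be a finite unramified extension of $\mathbf{Q}_\ell$ with ring of integers $\mathcal{O}_K$ (the integral closure of $\mathbf{Z}_\ell$ in $K$). Let $G$ be a finite group that is a semi-direct product $G = HL$ of a normal subgroup $H$ of order prime to $\ell$ and a cyclic $\ell$-subgroup $L$ (so $H \cap L = 1$). Assume that the group algebra $K[H]$ is decomposable, i.e., is isomorphic as a $K$-algebra to a finite direct sum of matrix algebras over (commutative) fields. Let $d$ be a positive integer. If there is an injective homomorphism $G \hookrightarrow \mathrm{Sp}_{2d}(K)$, then there is an injective homomorphism $G \hookrightarrow \mathrm{Sp}_{2d}(\mathcal{O}_K)$. Here $\mathrm{Sp}_{2d}(R)$ denotes the group of $2d \times 2d$ symplectic matrices over a commutative ring $R$. (2) In particular, let $p \neq \ell$ be a prime number and $g$ a positive integer. Call a finite group an inertia group with respect to $p$ if it is a semi-direct product of a normal $p$-subgroup and a cyclic subgroup of order prime to $p$. Then every finite subgroup of $\mathrm{Sp}_{2g}(\mathbf{Q}_\ell)$ that is an inertia group with respect to $p$ is isomorphic to a subgroup of $\mathrm{Sp}_{2g}(\mathbf{Z}_\ell)$.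 -/

import Mathlib

universe u v

/-- The group algebra `K[H]` is decomposable: it splits into a finite direct sum of matrix
algebras over fields (these are necessarily finite extensions of `K`). -/
def GroupAlgebraDecomposable (K : Type u) [Field K] (H : Type v) [Group H] : Prop :=
  ∃ (n : ℕ) (E : Fin n → Type u) (_ : ∀ i, Field (E i)) (_ : ∀ i, Algebra K (E i))
    (m : Fin n → ℕ), (∀ i, 0 < m i) ∧
      Nonempty (MonoidAlgebra K H ≃ₐ[K] ((i : Fin n) → Matrix (Fin (m i)) (Fin (m i)) (E i)))

/-- `G` is a finite group that is the (internal) semi-direct product of a normal `p`-subgroup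
and a cyclic subgroup of order prime to `p`. -/
def IsInertiaGroup (p : ℕ) (G : Type u) [Group G] : Prop :=
  Finite G ∧ ∃ P C : Subgroup G, P.Normal ∧ P.IsComplement' C ∧
    IsPGroup p P ∧ IsCyclic C ∧ (Nat.card C).Coprime p

/-! Write O for the ring of integers, F for its residue field, t for a generator of L. It is enough
to produce, from a faithful symplectic G-space V over K, a faithful symplectic O-lattice of rank at
most dim V. Trivial hyperbolic summands fill up the rank, and a symplectic basis turns the lattice
into matrices (`HasSymplecticLattice.exists_symplecticGroup_hom`).

Among the stable lattices on which the form is integral take a maximal one, T. Its dual T* satisfies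
ℓT* ⊆ T, so T/ℓT* and T*/T carry symplectic F[G]-structures whose dimensions add up to dim V. A
symplectic F[G]-space is taken apart along simple submodules S: an isotropic S is paired with its
dual and leaves S^⊥/S, any other S is nondegenerate and splits off. The pieces are lifted to O
(`exists_lift_of_isSimple`, `exists_symplectic_lift_of_isSimple`). The H-action lifts because ℓ does
not divide |H|. A lift of t has the right order only modulo ℓ and is corrected by a unit of the
commutant R of H. Irreducibility modulo ℓ makes R commutative with reduced reduction, on which the
trace of conjugation by t is onto; hence norms reach all invariant principal units, and a
determinant and trace argument extracts the root of t^(ℓ^k) that is still missing. Square roots of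
principal units make the correction symplectic.

Passing to graded pieces only loses operators that are unipotent modulo ℓ, so H stays faithful
(`hasSymplecticLattice_of_isSymplecticRep`). A nontrivial kernel meets H trivially, hence is central
and contains the element c of order ℓ of L. So if c is not central the construction is already
faithful, and if c is central it remains to keep c acting nontrivially. Choose a simple S inside (c
- 1)V. If S is isotropic, a stable lattice in S plus its dual will do; if S is nondegenerate with a
self-dual maximal lattice, that lattice will do. Otherwise some stable lattice T' in S has a simple
quotient of even dimension. All simple quotients of sublattices of T' have the same dimension, so e
= dim T'/(c - 1)T' is even. With t of order ℓ^(k+1) one has e = ℓ^k f and rank T' = (ℓ - 1)e. As f ≥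
2 and ℓ ≥ 5, there is room for a lattice of rank 2e that keeps H faithful and the cyclotomic lattice
of rank ℓ^k(ℓ - 1), on which c acts nontrivially (`hasSymplecticLattice_of_even_quotient`).

Part (2) follows because an inertia group for p ≠ ℓ is again an extension of a cyclic ℓ-group by a
group of order prime to ℓ. -/

/-- `O` is complete, with finite residue field of characteristic `ℓ ≥ 5` and uniformizer `ℓ`. -/
class AbsolutelyUnramified (ℓ : outParam ℕ) (O : Type*) [CommRing O] [IsDomain O]
    [IsDiscreteValuationRing O] : Prop where
  prime : ℓ.Prime
  five_le : 5 ≤ ℓ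
  maximalIdeal_eq : IsLocalRing.maximalIdeal O = Ideal.span {(ℓ : O)}
  complete : IsAdicComplete (IsLocalRing.maximalIdeal O) O
  finite : Finite (IsLocalRing.ResidueField O)
  charZero : CharZero O

namespace AbsolutelyUnramified

attribute [instance] finite charZero complete

/-! ### Completeness for the ℓ-adic topology. -/

section Complete

variable {ℓ : ℕ} (O : Type*) [CommRing O] [IsDomain O] [IsDiscreteValuationRing O]
  [hO : AbsolutelyUnramified ℓ O]

theorem isUnit_iff_not_dvd (n : ℕ) : IsUnit (n : O) ↔ ¬ ℓ ∣ n := by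
  have hp := hO.prime
  have hm : (ℓ : O) ∈ IsLocalRing.maximalIdeal O := by
    rw [hO.maximalIdeal_eq]; exact Ideal.mem_span_singleton_self _
  constructor
  · rintro h ⟨m, rfl⟩
    exact (IsLocalRing.mem_maximalIdeal _).1 hm
      (by rw [Nat.cast_mul] at h; exact isUnit_of_mul_isUnit_left h)
  · intro h
    have hc : IsCoprime (ℓ : ℤ) (n : ℤ) :=
      Nat.isCoprime_iff_coprime.2 ((Nat.Prime.coprime_iff_not_dvd hp).2 h)
    obtain ⟨a, b, hab⟩ := hc
    by_contra hn
    have hn' : (n : O) ∈ IsLocalRing.maximalIdeal O := (IsLocalRing.mem_maximalIdeal _).2 hn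
    have h1 : (1 : O) ∈ IsLocalRing.maximalIdeal O := by
      have := congrArg (Int.cast : ℤ → O) hab
      push_cast at this
      rw [← this]
      exact Ideal.add_mem _ (Ideal.mul_mem_left _ _ hm) (Ideal.mul_mem_left _ _ hn')
    exact (Ideal.ne_top_iff_one _).1 (IsLocalRing.maximalIdeal.isMaximal O).ne_top h1

variable {O}
variable {M : Type*} [AddCommGroup M] [Module O M]

theorem mem_maximalIdeal_pow_smul_iff (n : ℕ) (x : M) :
    x ∈ (IsLocalRing.maximalIdeal O ^ n • (⊤ : Submodule O M)) ↔ ∃ z, x = ℓ ^ n • z := by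
  rw [hO.maximalIdeal_eq, Ideal.span_singleton_pow, Submodule.ideal_span_singleton_smul,
    Submodule.mem_smul_pointwise_iff_exists]
  simp only [Submodule.mem_top, true_and, ← Nat.cast_pow, Nat.cast_smul_eq_nsmul, eq_comm]

variable (O) in
theorem eq_zero_of_forall_exists_nsmul [Module.Finite O M] (x : M)
    (h : ∀ n, ∃ z, x = ℓ ^ n • z) : x = 0 := by
  have : IsHausdorff (IsLocalRing.maximalIdeal O) M := inferInstance
  refine this.haus x fun n => ?_
  rw [SModEq.zero]
  exact (mem_maximalIdeal_pow_smul_iff n x).2 (h n)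

variable [Module.Free O M]

variable (O) in
include hO in
theorem nsmul_eq_zero {x : M} (h : ℓ • x = 0) : x = 0 := by
  have h' : (ℓ : O) • x = 0 := by rw [Nat.cast_smul_eq_nsmul]; exact h
  have := hO.prime.ne_zero
  exact (smul_eq_zero.1 h').resolve_left (by exact_mod_cast this)

variable (O) in
include hO in
theorem pow_nsmul_eq_zero {n : ℕ} {x : M} (h : ℓ ^ n • x = 0) : x = 0 := by
  induction n with
  | zero => simpa using h
  | succ n ih => exact ih (nsmul_eq_zero O (by rw [← mul_nsmul, ← pow_succ]; exact h))

variable (O) in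
/-- Finite free modules are complete for the `ℓ`-adic topology. -/
theorem exists_limit [Module.Finite O M] {s : ℕ → M}
    (h2 : ∀ m n, m ≤ n → ∃ z, s n - s m = ℓ ^ m • z) : ∃ x, ∀ n, ∃ z, s n - x = ℓ ^ n • z := by
  let b := Module.Free.chooseBasis O M
  have hc : ∀ i, ∃ a : O, ∀ n, b.repr (s n) i ≡ a
      [SMOD ((IsLocalRing.maximalIdeal O) ^ n • ⊤ : Submodule O O)] := by
    intro i
    refine hO.complete.toIsPrecomplete.prec fun {m n} hmn => ?_
    rw [SModEq.sub_mem, mem_maximalIdeal_pow_smul_iff]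
    obtain ⟨z, hz⟩ := h2 m n hmn
    refine ⟨-b.repr z i, ?_⟩
    have := congrArg (fun x => b.repr x i) hz
    simp only [map_sub, Finsupp.sub_apply, map_nsmul, Finsupp.smul_apply] at this
    rw [smul_neg, ← this]; abel
  choose a ha using hc
  let x : M := ∑ i, a i • b i
  refine ⟨x, fun n => ?_⟩
  have : ∀ i, ∃ c, b.repr (s n) i - a i = ℓ ^ n • c := fun i => by
    have := ha i n
    rwa [SModEq.sub_mem, mem_maximalIdeal_pow_smul_iff] at this
  choose c hc using this
  refine ⟨∑ i, c i • b i, ?_⟩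
  calc s n - x = ∑ i, b.repr (s n) i • b i - x := by rw [b.sum_repr]
    _ = _ := by
      rw [Finset.smul_sum, ← Finset.sum_sub_distrib]
      exact Finset.sum_congr rfl fun i _ => by rw [← sub_smul, hc, smul_assoc]

variable (O) in
/-- A map that contracts the `ℓ`-adic topology has a fixed point. -/
theorem exists_fixedPoint [Module.Finite O M] (F : M → M)
    (hF : ∀ m x y, (∃ z, x - y = ℓ ^ m • z) → ∃ z, F x - F y = ℓ ^ (m + 1) • z) :
    ∃ x, F x = x := by
  -- The iterates of 0 form a Cauchy sequence. Inverses, square roots, idempotents and norms are all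
  -- obtained below as fixed points of such contractions.
  let s : ℕ → M := fun n => F^[n] 0
  have hs : ∀ n, F (s n) = s (n + 1) := fun n => (Function.iterate_succ_apply' F n 0).symm
  have h1 : ∀ n, ∃ z, s (n + 1) - s n = ℓ ^ n • z := by
    intro n
    induction n with
    | zero => exact ⟨_, by simp; rfl⟩
    | succ n ih => have := hF n _ _ ih; rwa [hs, hs] at this
  have h2 : ∀ m n, m ≤ n → ∃ z, s n - s m = ℓ ^ m • z := by
    intro m n hmn
    induction n, hmn using Nat.le_induction with
    | base => exact ⟨0, by simp⟩
    | succ n hmn ih =>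
      obtain ⟨z, hz⟩ := ih
      obtain ⟨w, hw⟩ := h1 n
      refine ⟨ℓ ^ (n - m) • w + z, ?_⟩
      rw [smul_add, ← hz, smul_smul, ← pow_add, Nat.add_sub_cancel' hmn, ← hw]; abel
  obtain ⟨x, hx⟩ := exists_limit O h2
  refine ⟨x, ?_⟩
  rw [← sub_eq_zero]
  refine eq_zero_of_forall_exists_nsmul O _ fun n => ?_
  obtain ⟨z, hz⟩ := hF n _ _ (hx n)
  obtain ⟨w, hw⟩ := hx (n + 1)
  refine ⟨ℓ • (w - z), ?_⟩
  rw [smul_smul, ← pow_succ, smul_sub, ← hz, ← hw, hs]; abel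

end Complete

/-! ### Units, elements of finite order, square roots and idempotents near a given element. -/

section Ring

/-- Modulo ℓ² one has (1 + ℓw)^i = 1 + iℓw, and the sum of all i < ℓ is divisible by ℓ because ℓ is
odd. -/
theorem sum_one_add_nsmul_pow {A : Type*} [Ring A] {ℓ : ℕ} (hodd : Odd ℓ) (w : A) :
    ∃ v : A, ∑ i ∈ Finset.range ℓ, (1 + ℓ • w) ^ i = ℓ • (1 + ℓ • v) := by
  have h1 : ∀ i : ℕ, ∃ v : A, (1 + ℓ • w) ^ i = 1 + i • ℓ • w + (ℓ ^ 2) • v := by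
    intro i
    induction i with
    | zero => exact ⟨0, by simp⟩
    | succ i ih =>
      obtain ⟨v, hv⟩ := ih
      refine ⟨i • (w * w) + v + ℓ • (v * w), ?_⟩
      rw [pow_succ, hv]
      simp only [nsmul_eq_mul, Nat.cast_pow, Nat.cast_add, Nat.cast_one]
      have e1 := (Nat.cast_commute ℓ w).eq
      have e2 := (Nat.cast_commute ℓ v).eq
      simp only [add_mul, mul_add, one_mul, mul_one, ← mul_assoc, pow_two]
      have c1 : (i : A) * ℓ * w * ℓ * w = ℓ * ℓ * i * w * w := by
        rw [mul_assoc ((i : A) * ℓ) w, ← e1, (Nat.cast_commute i (ℓ : A)).eq]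
        simp only [← mul_assoc]
        rw [mul_assoc (ℓ : A) i, (Nat.cast_commute i (ℓ : A)).eq]; simp only [← mul_assoc]
      have c2 : (ℓ : A) * ℓ * v * ℓ * w = ℓ * ℓ * ℓ * v * w := by
        rw [mul_assoc ((ℓ : A) * ℓ) v, ← e2]; simp only [← mul_assoc]
      rw [c1, c2]; abel
  choose v hv using h1
  obtain ⟨m, hm⟩ := hodd
  have hs : ∑ i ∈ Finset.range ℓ, i = ℓ * m := by
    have h2 : (ℓ - 1) = 2 * m := by omega
    have := Finset.sum_range_id_mul_two ℓ
    rw [h2] at this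
    nlinarith
  refine ⟨m • w + ∑ i ∈ Finset.range ℓ, v i, ?_⟩
  rw [Finset.sum_congr rfl fun i _ => hv i, Finset.sum_add_distrib, Finset.sum_add_distrib,
    ← Finset.sum_smul, hs, ← Finset.smul_sum]
  simp only [Finset.sum_const, Finset.card_range, smul_add, smul_smul, pow_two]
  rw [mul_right_comm, add_assoc, mul_assoc]

variable {ℓ : ℕ} (O : Type*) [CommRing O] [IsDomain O] [IsDiscreteValuationRing O]
  [hO : AbsolutelyUnramified ℓ O]

section Noncomm

variable {A : Type*} [Ring A] [Algebra O A] [Module.Finite O A] [Module.Free O A]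

include O hO

/-- The ring need not be commutative, so a right inverse and a left inverse are found separately, as
fixed points of x ↦ 1 - ℓvx and x ↦ 1 - ℓxv. -/
theorem isUnit_one_add_nsmul (v : A) : IsUnit (1 + ℓ • v) := by
  obtain ⟨x, hx⟩ := exists_fixedPoint O (fun x : A => 1 - ℓ • (v * x)) (by
    rintro m x y ⟨z, hz⟩
    refine ⟨-(v * z), ?_⟩
    rw [sub_sub_sub_cancel_left, ← smul_sub, ← mul_sub, ← neg_sub, hz, pow_succ']
    simp only [mul_neg, smul_neg, mul_smul_comm, mul_nsmul'])
  obtain ⟨y, hy⟩ := exists_fixedPoint O (fun x : A => 1 - ℓ • (x * v)) (by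
    rintro m x y ⟨z, hz⟩
    refine ⟨-(z * v), ?_⟩
    rw [sub_sub_sub_cancel_left, ← smul_sub, ← sub_mul, ← neg_sub, hz, pow_succ']
    simp only [neg_mul, smul_neg, smul_mul_assoc, mul_nsmul'])
  rw [isUnit_iff_exists_and_exists]
  refine ⟨⟨x, ?_⟩, ⟨y, ?_⟩⟩
  · rw [add_mul, one_mul, smul_mul_assoc]
    nth_rewrite 1 [← hx]; abel
  · rw [mul_add, mul_one, mul_smul_comm]
    nth_rewrite 1 [← hy]; abel

theorem isUnit_natCast_add_nsmul {n : ℕ} (hn : ¬ ℓ ∣ n) (v : A) : IsUnit ((n : A) + ℓ • v) := by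
  obtain ⟨u, hu⟩ := (isUnit_iff_not_dvd O n).2 hn
  have h : (n : A) + ℓ • v = algebraMap O A u * (1 + ℓ • (algebraMap O A (u⁻¹ : Oˣ) * v)) := by
    rw [mul_add, mul_one, mul_smul_comm, ← mul_assoc, ← map_mul, Units.mul_inv, map_one, one_mul,
      hu, map_natCast]
  rw [h]
  exact (u.isUnit.map (algebraMap O A)).mul (isUnit_one_add_nsmul O _)

/-- An element of finite order congruent to `1` modulo `ℓ` is `1`. -/
theorem eq_one_of_pow_eq_one {x w : A} (hx : x = 1 + ℓ • w) {m : ℕ} (hm : m ≠ 0)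
    (h : x ^ m = 1) : x = 1 := by
  have hodd : Odd ℓ := hO.prime.odd_of_ne_two (by have := hO.five_le; omega)
  -- The geometric sum of y kills y - 1 = ℓu. It is a unit if p ≠ ℓ and ℓ times a unit if p = ℓ.
  have hprime : ∀ p : ℕ, p.Prime → ∀ y u : A, y = 1 + ℓ • u → y ^ p = 1 → y = 1 := by
    intro p hp y u hy hyp
    have h1 : (∑ i ∈ Finset.range p, y ^ i) * (ℓ • u) = 0 := by
      have := geom_sum_mul y p
      rwa [hyp, sub_self, hy, add_sub_cancel_left, ← hy] at this
    have h2 : ℓ • u = 0 := by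
      by_cases hpl : ℓ ∣ p
      · obtain rfl : ℓ = p := (Nat.prime_dvd_prime_iff_eq hO.prime hp).1 hpl
        obtain ⟨v, hv⟩ := sum_one_add_nsmul_pow hodd u
        rw [hy, hv, smul_mul_assoc] at h1
        have := nsmul_eq_zero O h1
        exact (isUnit_one_add_nsmul O v).mul_right_eq_zero.1 this
      · have h3 : ∃ v : A, ∑ i ∈ Finset.range p, y ^ i = p + ℓ • v := by
          have : ∀ i, ∃ v : A, y ^ i = 1 + ℓ • v := by
            intro i
            induction i with
            | zero => exact ⟨0, by simp⟩
            | succ i ih =>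
              obtain ⟨v, hv⟩ := ih
              refine ⟨u + v * (1 + ℓ • u), ?_⟩
              rw [pow_succ, hv, hy, add_mul, one_mul, smul_add, smul_mul_assoc, add_assoc]
          choose v hv using this
          exact ⟨∑ i ∈ Finset.range p, v i, by
            rw [Finset.sum_congr rfl fun i _ => hv i, Finset.sum_add_distrib, Finset.smul_sum]
            simp⟩
        obtain ⟨v, hv⟩ := h3
        rw [hv] at h1
        exact (isUnit_natCast_add_nsmul O hpl v).mul_right_eq_zero.1 h1
    rw [hy, h2, add_zero]
  have hpow : ∀ i, ∃ v : A, x ^ i = 1 + ℓ • v := by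
    intro i
    induction i with
    | zero => exact ⟨0, by simp⟩
    | succ i ih =>
      obtain ⟨v, hv⟩ := ih
      refine ⟨w + v * (1 + ℓ • w), ?_⟩
      rw [pow_succ, hv, hx, add_mul, one_mul, smul_add, smul_mul_assoc, add_assoc]
  -- For a prime p dividing the order of x, a power of x of exact order p would contradict the prime
  -- case.
  by_contra hne
  have ho : orderOf x ≠ 1 := fun h => hne (orderOf_eq_one_iff.1 h)
  obtain ⟨p, hp, q, hq⟩ := Nat.exists_prime_and_dvd ho
  have hq0 : 0 < orderOf x := orderOf_pos_iff.2 (isOfFinOrder_iff_pow_eq_one.2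
    ⟨m, Nat.pos_of_ne_zero hm, h⟩)
  obtain ⟨v, hv⟩ := hpow q
  have h1 := hprime p hp (x ^ q) v hv (by rw [← pow_mul, mul_comm, ← hq, pow_orderOf_eq_one])
  have h2 := Nat.le_of_dvd (Nat.pos_of_ne_zero (by rintro rfl; omega)) (orderOf_dvd_of_pow_eq_one h1)
  have := hp.two_le
  have hq1 : 0 < q := Nat.pos_of_ne_zero (by rintro rfl; omega)
  nlinarith

end Noncomm

section Comm

variable {R : Type*} [CommRing R] [Algebra O R] [Module.Finite O R] [Module.Free O R]

include hO

theorem exists_half : ∃ a : O, 2 * a = 1 := by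
  have h : IsUnit ((2 : ℕ) : O) := (isUnit_iff_not_dvd O 2).2 fun h => by
    have := Nat.le_of_dvd (by norm_num) h
    have := hO.five_le
    omega
  obtain ⟨u, hu⟩ := h
  exact ⟨(u⁻¹ : Oˣ), by rw [← u.mul_inv, hu]; simp⟩

include O

/-- The equation amounts to 2y + ℓy² = a, a fixed point problem for y ↦ (a - ℓy²)/2. -/
theorem exists_sq_eq_one_add_nsmul (a : R) : ∃ y : R, (1 + ℓ • y) ^ 2 = 1 + ℓ • a := by
  obtain ⟨c, hc⟩ := exists_half O
  have hc' : (2 : R) * algebraMap O R c = 1 := by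
    rw [← map_ofNat (algebraMap O R) 2, ← map_mul, hc, map_one]
  obtain ⟨y, hy⟩ := exists_fixedPoint O
    (fun y : R => algebraMap O R c * (a - ℓ • y ^ 2)) (by
      rintro m x y ⟨z, hz⟩
      refine ⟨-(algebraMap O R c * z * (x + y)), ?_⟩
      simp only [nsmul_eq_mul, Nat.cast_pow] at hz ⊢
      linear_combination (-(algebraMap O R c) * ℓ * (x + y)) * hz)
  refine ⟨y, ?_⟩
  simp only [nsmul_eq_mul] at hy ⊢
  linear_combination (-2 * (ℓ : R)) * hy + (ℓ : R) * (a - ℓ * y ^ 2) * hc'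

/-- The condition on y is (2a - 1)y + c + ℓy² = 0, and 2a - 1 is invertible because its square is 1
+ 4ℓc. -/
theorem exists_isIdempotentElem {a c : R} (h : a ^ 2 - a = ℓ • c) :
    ∃ y : R, IsIdempotentElem (a + ℓ • y) := by
  obtain ⟨d, hd⟩ : ∃ d, (2 * a - 1) * d = 1 := by
    have : IsUnit ((2 * a - 1) ^ 2) := by
      have e : (2 * a - 1) ^ 2 = 1 + ℓ • (4 * c) := by
        simp only [nsmul_eq_mul] at h ⊢
        linear_combination 4 * h
      rw [e]; exact isUnit_one_add_nsmul O _
    exact (isUnit_pow_iff two_ne_zero).1 this |>.exists_right_inv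
  obtain ⟨y, hy⟩ := exists_fixedPoint O (fun y : R => -d * (c + ℓ • y ^ 2)) (by
      rintro m x y ⟨z, hz⟩
      refine ⟨-(d * z * (x + y)), ?_⟩
      simp only [nsmul_eq_mul, Nat.cast_pow] at hz ⊢
      linear_combination (-d * ℓ * (x + y)) * hz)
  refine ⟨y, ?_⟩
  simp only [nsmul_eq_mul, IsIdempotentElem] at hy h ⊢
  linear_combination h - ℓ * (2 * a - 1) * hy - ℓ * (c + ℓ * y ^ 2) * hd

end Comm

end Ring

end AbsolutelyUnramified

open IsLocalRing Module

namespace AbsolutelyUnramified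

/-! ### Reduction modulo ℓ, and averaging over a group of order prime to ℓ. -/

section Reduction

variable {ℓ : ℕ} {O : Type*} [CommRing O] [IsDomain O] [IsDiscreteValuationRing O]
  [hO : AbsolutelyUnramified ℓ O]

/-- `π` identifies `Q` with `M / ℓ M`. -/
structure IsReduction {M Q : Type*} [AddCommGroup M] [Module O M] [AddCommGroup Q] [Module O Q]
    (ℓ : ℕ) (π : M →ₗ[O] Q) : Prop where
  surjective : Function.Surjective π
  exists_nsmul : ∀ x, π x = 0 → ∃ y, x = ℓ • y

variable (O) in
theorem residue_natCast : residue O (ℓ : O) = 0 := by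
  rw [residue_eq_zero_iff, hO.maximalIdeal_eq]
  exact Ideal.mem_span_singleton_self _

variable (O) in
theorem charP_residueField : CharP (ResidueField O) ℓ := by
  have h : ((ℓ : ℕ) : ResidueField O) = 0 := by rw [← residue_natCast O, map_natCast]
  exact (CharP.charP_iff_prime_eq_zero hO.prime).2 h

theorem exists_of_residue_eq_zero {a : O} (h : residue O a = 0) : ∃ b, a = ℓ • b := by
  rw [residue_eq_zero_iff, hO.maximalIdeal_eq, Ideal.mem_span_singleton] at h
  obtain ⟨b, rfl⟩ := h
  exact ⟨b, by rw [nsmul_eq_mul]⟩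

section

variable {Q : Type*} [AddCommGroup Q] [Module O Q] [Module (ResidueField O) Q]
  [IsScalarTower O (ResidueField O) Q]

theorem residue_smul (a : O) (q : Q) : residue O a • q = a • q := by
  rw [← one_smul (ResidueField O) q, ← smul_assoc, ← smul_assoc, Algebra.smul_def]
  simp [Algebra.smul_def]

variable (O) in
include O hO in
theorem nsmul_residue_eq_zero (q : Q) : ℓ • q = 0 := by
  rw [← Nat.cast_smul_eq_nsmul O, ← residue_smul, residue_natCast, zero_smul]

end

section Finite

variable {M : Type*} [AddCommGroup M] [Module O M] [Module.Finite O M]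

/-- Nakayama's lemma. -/
theorem eq_top_of_forall_exists_add_nsmul (N : Submodule O M)
    (h : ∀ x, ∃ y ∈ N, ∃ z, x = y + ℓ • z) : N = ⊤ := by
  rw [eq_top_iff]
  refine Submodule.le_of_le_smul_of_le_jacobson_bot (I := maximalIdeal O) Module.Finite.fg_top
    (IsLocalRing.maximalIdeal_le_jacobson _) fun x _ => ?_
  obtain ⟨y, hy, z, rfl⟩ := h x
  refine Submodule.add_mem_sup hy ?_
  rw [← Nat.cast_smul_eq_nsmul O]
  refine Submodule.smul_mem_smul ?_ trivial
  rw [hO.maximalIdeal_eq]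
  exact Ideal.mem_span_singleton_self _

end Finite

theorem exists_linearMap_eq_nsmul {M N : Type*} [AddCommGroup M] [Module O M] [AddCommGroup N]
    [Module O N] [Module.Free O M] (g : N →ₗ[O] M) (h : ∀ x, ∃ y, g x = ℓ • y) :
    ∃ g' : N →ₗ[O] M, g = ℓ • g' := by
  choose f hf using h
  have inj : ∀ a b : M, ℓ • a = ℓ • b → a = b := fun a b hab => by
    rw [← sub_eq_zero] at hab ⊢
    exact nsmul_eq_zero O (by rw [smul_sub, hab])
  refine ⟨{ toFun := f, map_add' := fun x y => inj _ _ ?_, map_smul' := fun a x => inj _ _ ?_ }, ?_⟩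
  · rw [← hf, map_add, smul_add, hf, hf]
  · rw [← hf, map_smul, RingHom.id_apply, smul_comm, hf]
  · ext x; simp [hf]

section Basis

variable {M Q : Type*} [AddCommGroup M] [Module O M] [Module.Finite O M] [Module.Free O M]
  [AddCommGroup Q] [Module O Q] [Module (ResidueField O) Q] [IsScalarTower O (ResidueField O) Q]
  {π : M →ₗ[O] Q}

theorem IsReduction.finrank_eq (hπ : IsReduction ℓ π) : finrank (ResidueField O) Q = finrank O M := by
  let b := Module.finBasis O M
  have hli : LinearIndependent (ResidueField O) (fun i => π (b i)) := by
    rw [Fintype.linearIndependent_iff]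
    intro g hg i
    choose a ha using fun i => residue_surjective (R := O) (g i)
    have h0 : π (∑ i, a i • b i) = 0 := by
      rw [map_sum, ← hg]
      exact Finset.sum_congr rfl fun i _ => by rw [map_smul, ← ha, residue_smul]
    obtain ⟨y, hy⟩ := hπ.exists_nsmul _ h0
    have h1 := congrArg (fun x => b.repr x i) hy
    simp only [Basis.repr_sum_self, map_nsmul, Finsupp.smul_apply] at h1
    rw [← ha, h1, map_nsmul, nsmul_eq_mul, ← map_natCast (residue O), residue_natCast, zero_mul]
  have hsp : ⊤ ≤ Submodule.span (ResidueField O) (Set.range fun i => π (b i)) := by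
    rintro q -
    obtain ⟨x, rfl⟩ := hπ.surjective q
    rw [← b.sum_repr x, map_sum]
    refine Submodule.sum_mem _ fun i _ => ?_
    rw [map_smul, ← residue_smul]
    exact Submodule.smul_mem _ _ (Submodule.subset_span ⟨i, rfl⟩)
  rw [finrank_eq_card_basis (Basis.mk hli hsp), Fintype.card_fin]

omit hO [Module.Free O M] in
theorem IsReduction.finite (hπ : IsReduction ℓ π) : Module.Finite (ResidueField O) Q := by
  have : Module.Finite O Q := Module.Finite.of_surjective π hπ.surjective
  exact Module.Finite.of_restrictScalars_finite O _ _

-- This provides a free lift for every finite-dimensional residual space.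
omit [Module.Finite O M] [Module.Free O M] in
theorem isReduction_basis {ι : Type*} [Fintype ι] (b : Basis ι (ResidueField O) Q) :
    IsReduction ℓ (Fintype.linearCombination O (fun i => b i) : (ι → O) →ₗ[O] Q) := by
  constructor
  · intro q
    choose a ha using fun i => residue_surjective (R := O) (b.repr q i)
    refine ⟨a, ?_⟩
    conv_rhs => rw [← b.sum_repr q]
    rw [Fintype.linearCombination_apply]
    exact Finset.sum_congr rfl fun i _ => by rw [← ha, residue_smul]
  · intro x hx
    rw [Fintype.linearCombination_apply] at hx
    have h1 : ∀ i, residue O (x i) = 0 := by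
      refine Fintype.linearIndependent_iff.1 b.linearIndependent _ ?_
      rw [← hx]
      exact Finset.sum_congr rfl fun i _ => residue_smul _ _
    choose y hy using fun i => exists_of_residue_eq_zero (h1 i)
    exact ⟨y, funext hy⟩

end Basis

section Average

variable {H : Type*} [Group H] [Finite H] (hH : ¬ ℓ ∣ Nat.card H)

include hO hH in
omit [Group H] [Finite H] in
theorem exists_inv_card : ∃ c : O, (Nat.card H : O) * c = 1 :=
  ((isUnit_iff_not_dvd O _).2 hH).exists_right_inv

include hH in
/-- An equivariant map out of a projective module lifts to an equivariant map. -/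
theorem exists_equivariant_lift {M M' Q : Type*} [AddCommGroup M] [Module O M]
    [Module.Projective O M] [AddCommGroup M'] [Module O M'] [AddCommGroup Q] [Module O Q]
    (α : Representation O H M) (α' : Representation O H M') (σ : H → Q → Q)
    (π : M' →ₗ[O] Q) (hπ : Function.Surjective π) (hπσ : ∀ h x, π (α' h x) = σ h (π x))
    (g : M →ₗ[O] Q) (hg : ∀ h x, g (α h x) = σ h (g x)) :
    ∃ f : M →ₗ[O] M', (∀ h x, f (α h x) = α' h (f x)) ∧ ∀ x, π (f x) = g x := by
  have := Fintype.ofFinite H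
  obtain ⟨f, hf⟩ := Module.projective_lifting_property π g hπ
  obtain ⟨c, hc⟩ := exists_inv_card (O := O) hH
  have hfx : ∀ x, π (f x) = g x := fun x => LinearMap.congr_fun hf x
  -- Average of the conjugates of an arbitrary linear lift; `c` is the inverse of the order of H in
  -- O.
  refine ⟨c • ∑ h, α' h ∘ₗ f ∘ₗ α h⁻¹, fun h x => ?_, fun x => ?_⟩
  · simp only [LinearMap.smul_apply, LinearMap.sum_apply, LinearMap.comp_apply, map_smul, map_sum]
    congr 1
    refine Fintype.sum_equiv (Equiv.mulLeft h⁻¹) _ _ fun y => ?_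
    simp only [Equiv.coe_mulLeft, mul_inv_rev, inv_inv, map_mul, Module.End.mul_apply]
    rw [← Module.End.mul_apply (α' h), ← map_mul, mul_inv_cancel, map_one, Module.End.one_apply]
  · simp only [LinearMap.smul_apply, LinearMap.sum_apply, LinearMap.comp_apply, map_smul, map_sum]
    have : ∀ h, π (α' h (f (α h⁻¹ x))) = g x := fun h => by
      rw [hπσ, hfx, ← hg, ← Module.End.mul_apply, ← map_mul, mul_inv_cancel, map_one,
        Module.End.one_apply]
    rw [Finset.sum_congr rfl fun h _ => this h, Finset.sum_const, Finset.card_univ,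
      ← Nat.card_eq_fintype_card, ← Nat.cast_smul_eq_nsmul O, smul_smul, mul_comm, hc, one_smul]

end Average

end Reduction

end AbsolutelyUnramified

namespace AbsolutelyUnramified

/-! ### Lifting representations of H to O. -/

section LiftCoprime

variable {ℓ : ℕ} {O : Type*} [CommRing O] [IsDomain O] [IsDiscreteValuationRing O]
  [hO : AbsolutelyUnramified ℓ O]

/-- The commutative ring structure on a subalgebra with commuting elements. -/
abbrev commRingOfComm {A : Type*} [Ring A] [Algebra O A] (R : Subalgebra O A)
    (h : ∀ x ∈ R, ∀ y ∈ R, x * y = y * x) : CommRing R :=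
  { (inferInstance : Ring R) with
    mul_comm := fun x y => Subtype.ext (h x x.2 y y.2) }

/-- Idempotents modulo `ℓ` lift to idempotents lying in the double centralizer. -/
theorem exists_isIdempotentElem_commute {A : Type*} [Ring A] [Algebra O A] [Module.Finite O A]
    [Module.Free O A] {a c : A} (h : a ^ 2 - a = ℓ • c) :
    ∃ y : A, IsIdempotentElem (a + ℓ • y) ∧ ∀ b, Commute a b → Commute (a + ℓ • y) b := by
  -- The double centralizer `R` of a lies in the centralizer `S` of a, so it is commutative, and the
  -- commutative idempotent lifting applies inside it.
  let S : Subalgebra O A := Subalgebra.centralizer O {a}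
  let R : Subalgebra O A := Subalgebra.centralizer O (S : Set A)
  have hmemS : ∀ x, x ∈ S ↔ a * x = x * a := fun x => by
    simp [S, Subalgebra.mem_centralizer_iff]
  have hmemR : ∀ x, x ∈ R ↔ ∀ y, a * y = y * a → y * x = x * y := fun x => by
    simp only [R, Subalgebra.mem_centralizer_iff, SetLike.mem_coe, hmemS]
  have hRS : ∀ x ∈ R, a * x = x * a := fun x hx => (hmemR x).1 hx a rfl
  have hcomm : ∀ x ∈ R, ∀ y ∈ R, x * y = y * x := fun x hx y hy =>
    (hmemR y).1 hy x (hRS x hx)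
  have hfin : Module.Finite O (Subalgebra.toSubmodule R) := inferInstance
  have hfree : Module.Free O (Subalgebra.toSubmodule R) := inferInstance
  let := commRingOfComm R hcomm
  have : Module.Finite O R := hfin
  have : Module.Free O R := hfree
  have haR : a ∈ R := (hmemR a).2 fun y hy => hy.symm
  have hcR : c ∈ R := (hmemR c).2 fun y hy => by
    have h1 : y * (a ^ 2 - a) = (a ^ 2 - a) * y := by
      rw [mul_sub, sub_mul, pow_two, ← mul_assoc, ← hy, mul_assoc, ← hy, mul_assoc]
    rw [h, mul_smul_comm, smul_mul_assoc, ← sub_eq_zero, ← smul_sub] at h1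
    exact sub_eq_zero.1 (nsmul_eq_zero O h1)
  obtain ⟨y, hy⟩ := exists_isIdempotentElem O (R := R) (a := ⟨a, haR⟩) (c := ⟨c, hcR⟩)
    (Subtype.ext h)
  refine ⟨y, congrArg Subtype.val hy, fun b hb => ?_⟩
  have hmem : a + ℓ • (y : A) ∈ R := R.add_mem haR (R.nsmul_mem y.2 ℓ)
  exact ((hmemR _).1 hmem b hb.eq).symm

variable {H : Type*} [Group H] [Finite H] (hH : ¬ ℓ ∣ Nat.card H)
  {Q : Type*} [AddCommGroup Q] [Module O Q] [Module (ResidueField O) Q]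
  [IsScalarTower O (ResidueField O) Q] [Module.Finite (ResidueField O) Q]

/-- Transport of a lattice with group action to standard coordinates. -/
theorem exists_coordinates {G M : Type*} [Monoid G] [AddCommGroup M] [Module O M]
    [Module.Finite O M] [Module.Free O M] (α : Representation O G M) :
    ∃ (n : ℕ) (α' : Representation O G (Fin n → O)) (e : (Fin n → O) ≃ₗ[O] M),
      ∀ g x, e (α' g x) = α g (e x) := by
  let e := (Module.finBasis O M).equivFun.symm
  refine ⟨_, (LinearEquiv.conjRingEquiv e.symm : End O M →* End O _).comp α, e, fun g x => ?_⟩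
  simp [LinearEquiv.conjRingEquiv]

omit [Module.Finite (ResidueField O) Q] in
omit [IsDomain O] [IsDiscreteValuationRing O] hO [Module (ResidueField O) Q]
  [IsScalarTower O (ResidueField O) Q] in
theorem IsReduction.comp_equiv {M N : Type*} [AddCommGroup M] [Module O M] [AddCommGroup N]
    [Module O N] {π : M →ₗ[O] Q} (hπ : IsReduction ℓ π) (e : N ≃ₗ[O] M) :
    IsReduction ℓ (π ∘ₗ (e : N →ₗ[O] M)) := by
  refine ⟨hπ.surjective.comp e.surjective, fun x hx => ?_⟩
  obtain ⟨y, hy⟩ := hπ.exists_nsmul _ hx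
  exact ⟨e.symm y, by rw [← map_nsmul, ← hy]; simp⟩

include hH in
/-- Representations of a group of order prime to `ℓ` lift to characteristic zero. -/
theorem exists_lift_coprime (σ : Representation (ResidueField O) H Q) :
    ∃ (n : ℕ) (α : Representation O H (Fin n → O)) (π : (Fin n → O) →ₗ[O] Q),
      IsReduction ℓ π ∧ ∀ h x, π (α h x) = σ h (π x) := by
  have := Fintype.ofFinite H
  obtain ⟨c, hc⟩ := exists_inv_card (O := O) hH
  let bQ := Module.finBasis (ResidueField O) Q
  obtain ⟨n, πF, hπF⟩ : ∃ n, ∃ π : (Fin n → O) →ₗ[O] Q, IsReduction ℓ π :=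
    ⟨_, _, isReduction_basis bQ⟩
  -- These lifts of the operators σ h are merely linear: they need not be multiplicative in h.
  have ha : ∀ h, ∃ a : (Fin n → O) →ₗ[O] (Fin n → O), ∀ x, πF (a x) = σ h (πF x) := fun h => by
    obtain ⟨a, ha⟩ := Module.projective_lifting_property πF
      ((σ h).restrictScalars O ∘ₗ πF) hπF.surjective
    exact ⟨a, fun x => LinearMap.congr_fun ha x⟩
  choose a ha using ha
  obtain ⟨red, hredx⟩ : ∃ red : (H → Fin n → O) →ₗ[O] (H → Q), ∀ f x, red f x = πF (f x) :=
    ⟨LinearMap.pi fun h => πF ∘ₗ LinearMap.proj h, fun f x => rfl⟩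
  let τ : Representation O H (H → Fin n → O) :=
    { toFun := fun h => LinearMap.funLeft O (Fin n → O) (fun x => x * h)
      map_one' := by ext; simp [LinearMap.funLeft]
      map_mul' := fun g h => by
        refine LinearMap.ext fun f => funext fun x => ?_
        simp [LinearMap.funLeft_apply, mul_assoc] }
  have hτ : ∀ h f x, τ h f x = f (x * h) := fun h f x => rfl
  -- Modulo ℓ, Q embeds into the functions on H by q ↦ (x ↦ σ x q), with retraction `r` below. The
  -- operator `e0` lifts the resulting projector, so it is idempotent only modulo ℓ.
  obtain ⟨e0, he0⟩ : ∃ e0 : End O (H → Fin n → O),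
      ∀ f x, e0 f x = c • ∑ y, a (x * y⁻¹) (f y) :=
    ⟨LinearMap.pi fun x => c • ∑ y, a (x * y⁻¹) ∘ₗ LinearMap.proj y, fun f x => by
      simp [LinearMap.sum_apply]⟩
  obtain ⟨r, hr⟩ : ∃ r : (H → Q) →ₗ[O] Q, ∀ f, r f = c • ∑ y, σ y⁻¹ (f y) :=
    ⟨c • ∑ y, (σ y⁻¹).restrictScalars O ∘ₗ LinearMap.proj y, fun f => by
      simp [LinearMap.sum_apply]⟩
  have hsmul : ∀ h (d : O) (q : Q), σ h (d • q) = d • σ h q := fun h d q => by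
    rw [← residue_smul, map_smul, residue_smul]
  have hrι : ∀ q, r (fun x => σ x q) = q := fun q => by
    rw [hr]
    have : ∀ y, σ y⁻¹ (σ y q) = q := fun y => by
      rw [← Module.End.mul_apply, ← map_mul, inv_mul_cancel, map_one, Module.End.one_apply]
    rw [Finset.sum_congr rfl fun y _ => this y, Finset.sum_const, Finset.card_univ,
      ← Nat.card_eq_fintype_card, ← Nat.cast_smul_eq_nsmul O, smul_smul, mul_comm, hc, one_smul]
  have hrede0 : ∀ f, red (e0 f) = fun x => σ x (r (red f)) := fun f => by
    funext x
    rw [hredx, he0, hr, map_smul, map_sum, hsmul, map_sum]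
    refine congrArg _ (Finset.sum_congr rfl fun y _ => ?_)
    rw [ha, map_mul, Module.End.mul_apply, hredx]
  have hredker : ∀ f, red f = 0 → ∃ y, f = ℓ • y := fun f hf => by
    choose y hy using fun x => hπF.exists_nsmul (f x) (by rw [← hredx, hf]; rfl)
    exact ⟨y, funext hy⟩
  have hredsurj : Function.Surjective red := fun f => by
    choose y hy using fun x => hπF.surjective (f x)
    exact ⟨y, funext fun x => by rw [hredx, hy]⟩
  obtain ⟨d, hd⟩ : ∃ d, e0 ^ 2 - e0 = ℓ • d := by
    refine exists_linearMap_eq_nsmul _ fun f => hredker _ ?_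
    rw [LinearMap.sub_apply, pow_two, Module.End.mul_apply, map_sub, hrede0, hrede0, hrι, sub_self]
  obtain ⟨y, hidem, hcomm⟩ := exists_isIdempotentElem_commute (O := O) hd
  set e : End O (H → Fin n → O) := e0 + ℓ • y with he
  -- The kernel of `e0` depends on x y⁻¹ alone, so `e0` commutes with right translations, and the
  -- corrected idempotent inherits this.
  have hτe : ∀ h, Commute e (τ h) := fun h => hcomm _ <| by
    refine LinearMap.ext fun f => funext fun x => ?_
    rw [Module.End.mul_apply, Module.End.mul_apply, hτ, he0, he0]
    refine congrArg _ (Fintype.sum_equiv (Equiv.mulRight h) _ _ fun y => ?_)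
    rw [hτ]
    simp [mul_assoc]
  have hred : ∀ f, red (e f) = fun x => σ x (r (red f)) := fun f => by
    rw [he, LinearMap.add_apply, map_add, hrede0, LinearMap.smul_apply, map_nsmul]
    have : ℓ • red (y f) = 0 := funext fun x => nsmul_residue_eq_zero O _
    rw [this, add_zero]
  -- The image of a true idempotent commuting with translations is an H-stable direct summand; it is
  -- the desired lift of Q.
  let N := LinearMap.range e
  have hN : ∀ x ∈ N, e x = x := by
    rintro _ ⟨x, rfl⟩
    exact LinearMap.congr_fun hidem x
  let α : Representation O H N :=
    { toFun := fun h => (τ h).restrict fun x hx => by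
        obtain ⟨z, rfl⟩ := hx
        exact ⟨τ h z, LinearMap.congr_fun (hτe h).eq z⟩
      map_one' := by ext; simp
      map_mul' := fun g h => by
        refine LinearMap.ext fun x => Subtype.ext ?_
        simp }
  have hα : ∀ h x, (α h x : H → Fin n → O) = τ h x := fun h x => rfl
  let π : N →ₗ[O] Q := r ∘ₗ red ∘ₗ N.subtype
  have hπ : IsReduction ℓ π := by
    constructor
    · intro q
      obtain ⟨p, hp⟩ := hredsurj fun x => σ x q
      refine ⟨⟨e p, p, rfl⟩, ?_⟩
      change r (red (e p)) = q
      rw [hred, hrι, hp, hrι]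
    · rintro ⟨x, hx⟩ h0
      have h1 : r (red x) = 0 := h0
      have h2 : red x = 0 := by
        rw [← hN x hx, hred, h1]; funext; simp
      obtain ⟨z, hz⟩ := hredker x h2
      refine ⟨⟨e z, z, rfl⟩, Subtype.ext ?_⟩
      change x = ℓ • e z
      rw [← map_nsmul, ← hz, hN x hx]
  have hπα : ∀ h x, π (α h x) = σ h (π x) := fun h x => by
    change r (red (τ h x)) = σ h (r (red x))
    rw [hr, hr, hsmul, map_sum]
    refine congrArg _ (Fintype.sum_equiv (Equiv.mulRight h) _ _ fun y => ?_)
    rw [← Module.End.mul_apply, ← map_mul]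
    rw [hredx, hτ]
    simp [hredx]
  obtain ⟨n, α', eq, heq⟩ := exists_coordinates α
  exact ⟨n, α', π ∘ₗ eq, hπ.comp_equiv eq, fun h x => by simp [heq, hπα]⟩

end LiftCoprime

end AbsolutelyUnramified

/-! ### Finite rings: commutativity and reducedness. -/

section ReducedFinite

open scoped Pointwise

/-- A finite reduced ring is commutative. -/
theorem mul_comm_of_finite_of_isReduced (R : Type u) [Ring R] [Finite R] [IsReduced R] (x y : R) :
    x * y = y * x := by
  have hart : IsArtinianRing R := inferInstance
  -- The Jacobson radical is nilpotent, hence zero. In the resulting matrix blocks an off-diagonal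
  -- matrix unit would be nilpotent, so all blocks have size one, over finite division rings, which
  -- are fields.
  have hss : IsSemisimpleRing R := by
    rw [IsArtinianRing.isSemisimpleRing_iff_jacobson, eq_bot_iff]
    intro a ha
    obtain ⟨n, hn⟩ := IsSemiprimaryRing.isNilpotent (R := R)
    have : a ^ n ∈ (Ring.jacobson R) ^ n := Ideal.pow_mem_pow ha n
    rw [hn] at this
    exact (Submodule.mem_bot R).2 (IsReduced.eq_zero a ⟨n, this⟩)
  obtain ⟨n, D, d, _, hd, ⟨e⟩⟩ := IsSemisimpleRing.exists_ringEquiv_pi_matrix_divisionRing R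
  have hred : IsReduced (∀ i, Matrix (Fin (d i)) (Fin (d i)) (D i)) :=
    isReduced_of_injective e.symm e.symm.injective
  have hfin : Finite (∀ i, Matrix (Fin (d i)) (Fin (d i)) (D i)) := Finite.of_equiv R e.toEquiv
  apply e.injective
  rw [map_mul, map_mul]
  funext i
  have h1 : d i = 1 := by
    by_contra hne
    have hd2 : 2 ≤ d i := by have := (hd i).out; omega
    let E : Matrix (Fin (d i)) (Fin (d i)) (D i) :=
      Matrix.single ⟨0, by omega⟩ ⟨1, by omega⟩ 1
    have hE : E * E = 0 := 
      Matrix.single_mul_single_of_ne (1 : D i) _ _ _ (Fin.ne_of_val_ne one_ne_zero) (1 : D i)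
    have hnil : IsNilpotent (Pi.single i E : ∀ i, Matrix (Fin (d i)) (Fin (d i)) (D i)) :=
      ⟨2, by rw [pow_two, ← Pi.single_mul, hE, Pi.single_zero]⟩
    have := congrFun (hred.eq_zero _ hnil) i
    rw [Pi.single_eq_same] at this
    have h2 := congrFun (congrFun this ⟨0, by omega⟩) ⟨1, by omega⟩
    simp [E] at h2
  have hD : Finite (D i) := by
    refine Finite.of_injective
      (fun a => (Pi.single i (Matrix.scalar (Fin (d i)) a) :
        ∀ i, Matrix (Fin (d i)) (Fin (d i)) (D i))) fun a b hab => ?_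
    have := Pi.single_injective i hab
    have : NeZero (d i) := hd i
    exact Matrix.scalar_inj.1 ‹_›
  let F := littleWedderburn (D i)
  have hmul : ∀ a b : D i, a * b = b * a := fun a b => F.mul_comm a b
  ext p q
  have hs : ∀ r s : Fin (d i), r = s := fun r s => Fin.ext (by omega)
  rw [Pi.mul_apply, Pi.mul_apply, Matrix.mul_apply, Matrix.mul_apply]
  refine Finset.sum_congr rfl fun r _ => ?_
  rw [hmul, hs p r, hs q r]

variable {ℓ : ℕ} [hℓ : Fact ℓ.Prime] {R : Type u} [Ring R] [Finite R]

/-- A finite ring of characteristic `ℓ` with an automorphism of `ℓ`-power order whose nonzero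
fixed points are units is reduced. -/
theorem isReduced_of_fixed_isUnit [CharP R ℓ] [Nontrivial R] (θ : R ≃+* R) {n : ℕ}
    (hθ : ∀ x, θ^[ℓ ^ n] x = x) (hfix : ∀ x, θ x = x → x ≠ 0 → IsUnit x) : IsReduced R := by
  let φ : MulAut Rˣ := Units.mapEquiv (θ : R ≃* R)
  have hφ : ∀ (m : ℕ) (u : Rˣ), (((φ ^ m) u : Rˣ) : R) = θ^[m] u := by
    intro m
    induction m with
    | zero => intro u; simp
    | succ m ih =>
      intro u
      rw [pow_succ, MulAut.mul_apply, ih, Function.iterate_succ_apply]; rfl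
  have hφn : φ ^ ℓ ^ n = 1 := MulEquiv.ext fun u => Units.ext (by rw [hφ, hθ]; rfl)
  have hp : IsPGroup ℓ (Subgroup.zpowers φ) := by
    rintro ⟨_, m, rfl⟩
    refine ⟨n, Subtype.ext ?_⟩
    change (φ ^ m) ^ ℓ ^ n = 1
    rw [← zpow_natCast, zpow_comm, zpow_natCast, hφn, one_zpow]
  -- For a fixed x of ℓ-power order, x - 1 is fixed and nilpotent in characteristic ℓ, hence not a
  -- unit, hence zero.
  have hne : ∀ (x : R) (m : ℕ), x ^ ℓ ^ m = 1 → θ x = x → x = 1 := by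
    intro x m hx hθx
    by_contra hne
    have hu := hfix (x - 1) (by rw [map_sub, hθx, map_one]) (sub_ne_zero.2 hne)
    have h0 : (x - 1) ^ ℓ ^ m = 0 := by
      rw [sub_pow_char_pow_of_commute _ _ (Commute.one_right x), hx, one_pow, sub_self]
    exact not_isUnit_zero (h0 ▸ hu.pow (ℓ ^ m))
  -- The number of Sylow ℓ-subgroups is 1 modulo ℓ, so the ℓ-group generated by φ normalizes one of
  -- them.
  obtain ⟨S, hS⟩ := hp.nonempty_fixed_point_of_prime_not_dvd_card (Sylow ℓ Rˣ) (by
    have := card_sylow_modEq_one ℓ Rˣ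
    intro h
    have h1 := (Nat.modEq_zero_iff_dvd.2 h).symm.trans this
    have h2 := (Nat.modEq_iff_dvd' (Nat.zero_le 1)).1 h1
    exact hℓ.out.one_lt.ne' (Nat.dvd_one.1 h2))
  have hSφ : ∀ g : Subgroup.zpowers φ, ∀ u ∈ S, g • u ∈ S := by
    intro g u hu
    have h1 := hS g
    have h2 : g • u ∈ g • (S : Subgroup Rˣ) := Subgroup.smul_mem_pointwise_smul u g _ hu
    rw [← h1]
    exact h2
  let X : SubMulAction (Subgroup.zpowers φ) Rˣ := ⟨S, fun g u hu => hSφ g u hu⟩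
  -- An ℓ-group acting on a nontrivial ℓ-group fixes a nontrivial element, which `hne` forbids. So
  -- the Sylow ℓ-subgroups of the unit group are trivial.
  have hcard : ¬ ℓ ∣ Nat.card S := by
    intro hdvd
    obtain ⟨b, hb, hb1⟩ := hp.exists_fixed_point_of_prime_dvd_card_of_fixed_point X
      (show ℓ ∣ Nat.card X from hdvd) (a := ⟨1, S.one_mem⟩)
      (fun g => Subtype.ext (smul_one g))
    obtain ⟨m, hm⟩ := S.isPGroup' ⟨b.1, b.2⟩
    have h1 : φ b.1 = b.1 := congrArg Subtype.val (hb ⟨φ, Subgroup.mem_zpowers φ⟩)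
    have h2 := hne (b.1 : R) m
      (by rw [← Units.val_pow_eq_pow_val]; exact congrArg Units.val (congrArg Subtype.val hm))
      (congrArg Units.val h1)
    exact hb1 (Subtype.ext (Units.ext h2.symm))
  refine ⟨fun x ⟨m, hx⟩ => ?_⟩
  obtain ⟨e, he⟩ : ∃ e, m ≤ ℓ ^ e := ⟨m, (Nat.lt_pow_self hℓ.out.one_lt).le⟩
  -- For nilpotent x the unit 1 + x has ℓ-power order and lies in a Sylow ℓ-subgroup, so it is 1.
  have h1 : (1 + x) ^ ℓ ^ e = 1 := by
    rw [add_pow_char_pow_of_commute _ _ (Commute.one_left x), one_pow,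
      pow_eq_zero_of_le he hx, add_zero]
  have hu : IsUnit (1 + x) := by
    have h2 : IsUnit ((1 + x) ^ ℓ ^ e) := by rw [h1]; exact isUnit_one
    exact (isUnit_pow_iff (pow_pos hℓ.out.pos e).ne').1 h2
  obtain ⟨u, hu⟩ := hu
  have h3 : u ^ ℓ ^ e = 1 := Units.ext (by rw [Units.val_pow_eq_pow_val, hu, h1]; rfl)
  have h4 : u = 1 := by
    by_contra hne1
    have hz : IsPGroup ℓ (Subgroup.zpowers u) := by
      rintro ⟨_, j, rfl⟩
      refine ⟨e, Subtype.ext ?_⟩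
      change (u ^ j) ^ ℓ ^ e = 1
      rw [← zpow_natCast, zpow_comm, zpow_natCast, h3, one_zpow]
    obtain ⟨S', hS'⟩ := hz.exists_le_sylow
    have h5 : Nat.card S' = 1 := by
      rw [Nat.card_congr (Sylow.equiv S' S).toEquiv]
      obtain ⟨j, hj⟩ := IsPGroup.iff_card.1 S.isPGroup'
      rcases Nat.eq_zero_or_pos j with rfl | hj0
      · simpa using hj
      · exact absurd (hj ▸ dvd_pow_self ℓ hj0.ne') hcard
    have h6 : (S' : Subgroup Rˣ) = ⊥ := Subgroup.card_eq_one.1 h5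
    have h7 := hS' (Subgroup.mem_zpowers u)
    rw [h6] at h7
    exact hne1 (Subgroup.mem_bot.1 h7)
  rw [h4, Units.val_one] at hu
  simpa using hu.symm

end ReducedFinite

/-! ### Surjectivity of the trace in characteristic ℓ. -/

section Trace

variable {ℓ : ℕ} [hℓ : Fact ℓ.Prime] {R : Type*} [CommRing R]

/-- If `φ y = y + 1` then `(φ - 1)^n (y^n) = n!`. -/
theorem iterate_sub_one_pow_eq_factorial (T : Module.End ℤ R) (hmul : ∀ x y, T (x * y) = T x * T y)
    (h1 : T 1 = 1) {y : R} (hy : T y = y + 1) (n : ℕ) : ((T - 1) ^ n) (y ^ n) = n.factorial := by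
  have hTpow : ∀ x m, T (x ^ m) = T x ^ m := fun x m => by
    induction m with
    | zero => simpa using h1
    | succ m ih => rw [pow_succ, hmul, ih, pow_succ]
  have hTn : ∀ m : ℕ, T m = m := fun m => by
    rw [← nsmul_one, map_nsmul, h1]
  -- On polynomial expressions in y the map T is the shift y ↦ y + 1, so T - 1 is the forward
  -- difference operator.
  have key : ∀ (m : ℕ) (F : R → R), (∀ k : ℕ, T (F (y + k)) = F (y + k + 1)) →
      ((T - 1) ^ m) (F y) = ((fwdDiff (1 : R))^[m] F) y := by
    intro m
    induction m with
    | zero => intro F _; simp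
    | succ m ih =>
      intro F hF
      rw [pow_succ, Module.End.mul_apply, Function.iterate_succ_apply]
      have h0 : (T - 1) (F y) = (fwdDiff (1 : R) F) y := by
        have := hF 0
        simp only [Nat.cast_zero, add_zero] at this
        rw [fwdDiff, ← this]; rfl
      rw [h0]
      refine ih _ fun k => ?_
      simp only [fwdDiff, map_sub]
      have := hF (k + 1)
      push_cast at this
      rw [hF k, add_assoc y k 1, this]
  have := key n (fun z => z ^ n) fun k => by
    rw [hTpow, map_add, hy, hTn, add_right_comm]
  rw [this, fwdDiff_iter_eq_factorial]
  rfl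

/-- Over the prime field, (X^q - 1)/(X - 1) = (X - 1)^(q - 1) when q is a power of ℓ. The trace is
thus a power of T - 1. -/
theorem sum_pow_eq_sub_one_pow {E : Type*} [Ring E] [CharP E ℓ] (T : E) (b : ℕ) :
    ∑ i ∈ Finset.range (ℓ ^ b), T ^ i = (T - 1) ^ (ℓ ^ b - 1) := by
  have hpos : 0 < ℓ ^ b := pow_pos hℓ.out.pos b
  have hpoly : ∑ i ∈ Finset.range (ℓ ^ b), (Polynomial.X : Polynomial (ZMod ℓ)) ^ i =
      (Polynomial.X - 1) ^ (ℓ ^ b - 1) := by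
    have h0 : (Polynomial.X - 1 : Polynomial (ZMod ℓ)) ≠ 0 := Polynomial.X_sub_C_ne_zero 1
    apply mul_right_cancel₀ h0
    rw [geom_sum_mul, ← pow_succ, Nat.sub_add_cancel hpos, sub_pow_char_pow, one_pow]
  have := congrArg (Polynomial.eval₂RingHom' (ZMod.castHom (dvd_refl ℓ) E) T
    (fun a => by
      obtain ⟨n, rfl⟩ := ZMod.natCast_zmod_surjective a
      rw [map_natCast]; exact Nat.cast_commute n T)) hpoly
  rw [map_sum, map_pow, map_sub, map_one] at this
  simp only [map_pow, Polynomial.eval₂RingHom'_apply, Polynomial.eval₂_X] at this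
  exact this

/-- The trace of a cyclic `ℓ`-group of automorphisms in characteristic `ℓ`
is surjective if the ring of invariants is a field. -/
theorem exists_sum_iterate_eq_one [CharP R ℓ] [Nontrivial R] (θ : R ≃+* R) {b : ℕ}
    (hθ : ∀ x, θ^[ℓ ^ b] x = x) (hmin : ∀ c, b = c + 1 → ∃ x, θ^[ℓ ^ c] x ≠ x)
    (hfix : ∀ x, θ x = x → x ≠ 0 → IsUnit x) :
    ∃ x, ∑ i ∈ Finset.range (ℓ ^ b), θ^[i] x = 1 := by
  let T : Module.End ℤ R := (θ : R →+ R).toIntLinearMap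
  have hT : ∀ x, T x = θ x := fun x => rfl
  have hTpow : ∀ (m : ℕ) x, (T ^ m) x = θ^[m] x := by
    intro m
    induction m with
    | zero => intro x; simp
    | succ m ih => intro x; rw [pow_succ, Module.End.mul_apply, ih, Function.iterate_succ_apply]; rfl
  have hchar : CharP (Module.End ℤ R) ℓ := by
    have : Nontrivial (Module.End ℤ R) :=
      ⟨0, 1, fun h => zero_ne_one (α := R) (DFunLike.congr_fun h 1)⟩
    refine (CharP.charP_iff_prime_eq_zero hℓ.out).2 (LinearMap.ext fun x => ?_)
    rw [← nsmul_one]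
    change ℓ • x = 0
    rw [nsmul_eq_mul, CharP.cast_eq_zero, zero_mul]
  have hNpow : ∀ i, (T - 1) ^ ℓ ^ i = T ^ ℓ ^ i - 1 := fun i => by
    rw [sub_pow_char_pow_of_commute _ _ (Commute.one_right T), one_pow]
  have hinv : ∀ x y, θ x = x → x * y = 1 → θ y = y := fun x y hx hxy => by
    have h1 : x * θ y = 1 := by rw [← hx, ← map_mul, hxy, map_one]
    calc θ y = (x * y) * θ y := by rw [hxy, one_mul]
      _ = y * (x * θ y) := by ring
      _ = y := by rw [h1, mul_one]
  have hNfix : ∀ (m : ℕ) f x, θ f = f → ((T - 1) ^ m) (f * x) = f * ((T - 1) ^ m) x := by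
    intro m f x hf
    induction m generalizing x with
    | zero => simp
    | succ m ih =>
      rw [pow_succ, Module.End.mul_apply, Module.End.mul_apply]
      have : (T - 1) (f * x) = f * (T - 1) x := by
        change θ (f * x) - f * x = f * (θ x - x)
        rw [map_mul, hf, mul_sub]
      rw [this, ih]
  have hN0 : (T - 1) ^ ℓ ^ b = 0 := by
    rw [hNpow]; exact LinearMap.ext fun x => by
      change (T ^ ℓ ^ b) x - x = 0
      rw [hTpow, hθ, sub_self]
  -- the top of a Jordan block
  obtain ⟨D, hD⟩ : ∃ D, (T - 1) ^ (D + 1) = 0 ∧ (T - 1) ^ D ≠ 0 := by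
    classical
    have hex : ∃ n, (T - 1) ^ n = 0 := ⟨_, hN0⟩
    have h0 : Nat.find hex ≠ 0 := fun h => by
      have := Nat.find_spec hex
      rw [h, pow_zero] at this
      exact one_ne_zero this
    obtain ⟨D, hD⟩ := Nat.exists_eq_succ_of_ne_zero h0
    refine ⟨D, ?_, Nat.find_min hex (by omega)⟩
    have := Nat.find_spec hex
    rwa [hD] at this
  obtain ⟨x, hx⟩ : ∃ x, ((T - 1) ^ D) x = 1 := by
    obtain ⟨x, hx⟩ : ∃ x, ((T - 1) ^ D) x ≠ 0 := by
      by_contra! h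
      exact hD.2 (LinearMap.ext h)
    have hf : θ (((T - 1) ^ D) x) = ((T - 1) ^ D) x := by
      have := DFunLike.congr_fun hD.1 x
      rw [pow_succ', Module.End.mul_apply] at this
      exact sub_eq_zero.1 this
    obtain ⟨g, hg⟩ := (hfix _ hf hx).exists_right_inv
    exact ⟨g * x, by rw [hNfix _ _ _ (hinv _ _ hf hg), mul_comm, hg]⟩
  -- By minimality of b, (T - 1)^(ℓ^i) = T^(ℓ^i) - 1 does not vanish for i < b, so the longest
  -- Jordan block has length D + 1 > ℓ^i.
  have hDle : ∀ i < b, ℓ ^ i ≤ D := by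
    intro i hi
    obtain ⟨c, rfl⟩ := Nat.exists_eq_succ_of_ne_zero (Nat.ne_zero_of_lt hi)
    have h1 : ℓ ^ i ≤ ℓ ^ c := Nat.pow_le_pow_right hℓ.out.pos (by omega)
    refine h1.trans ?_
    by_contra hlt
    obtain ⟨x, hx⟩ := hmin c rfl
    have h2 : (T - 1) ^ ℓ ^ c = 0 := pow_eq_zero_of_le (by omega) hD.1
    rw [hNpow] at h2
    have h3 := DFunLike.congr_fun h2 x
    exact hx (by rw [← hTpow]; exact sub_eq_zero.1 h3)
  -- Going ℓ^i places up the Jordan block from 1 gives an Artin–Schreier element for T^(ℓ^i): it is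
  -- moved to itself plus 1.
  let y : ℕ → R := fun i => ((T - 1) ^ (D - ℓ ^ i)) x
  have hy : ∀ i < b, (T ^ ℓ ^ i) (y i) = y i + 1 := by
    intro i hi
    have h1 : ((T - 1) ^ ℓ ^ i) (y i) = 1 := by
      change ((T - 1) ^ ℓ ^ i) (((T - 1) ^ (D - ℓ ^ i)) x) = 1
      rw [← Module.End.mul_apply, ← pow_add, Nat.add_sub_cancel' (hDle i hi), hx]
    rw [hNpow] at h1
    have h2 : (T ^ ℓ ^ i) (y i) - y i = 1 := h1
    rw [← h2]; abel
  have hTmul : ∀ (m : ℕ) x y, (T ^ m) (x * y) = (T ^ m) x * (T ^ m) y := by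
    intro m x y
    rw [hTpow, hTpow, hTpow, iterate_map_mul]
  have hTone : ∀ m : ℕ, (T ^ m) 1 = 1 := fun m => by rw [hTpow, iterate_map_one]
  have hypow : ∀ i < b, ∀ m : ℕ, ((T ^ ℓ ^ i) ^ m) (y i) = y i + m := by
    intro i hi m
    induction m with
    | zero => simp
    | succ m ih =>
      rw [pow_succ', Module.End.mul_apply, ih, map_add, hy i hi, ← nsmul_one, map_nsmul, hTone,
        nsmul_one]
      push_cast; ring
  have hyfix : ∀ i j, i < j → j < b → (T ^ ℓ ^ j) (y i) = y i := by
    intro i j hij hj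
    have h1 : ℓ ^ j = ℓ ^ i * ℓ ^ (j - i) := by rw [← pow_add]; congr 1; omega
    rw [h1, pow_mul, hypow i (by omega)]
    have : ((ℓ ^ (j - i) : ℕ) : R) = 0 := by
      rw [Nat.cast_pow, CharP.cast_eq_zero, zero_pow (by omega)]
    rw [this, add_zero]
  let Z : ℕ → R := fun j => ∏ i ∈ Finset.range j, y i ^ (ℓ - 1)
  -- Split ℓ^(j+1) - 1 as (ℓ^j - 1) + ℓ^j(ℓ - 1): the second part turns the new factor into (ℓ -
  -- 1)!, leaving `Z j` untouched. For j = b this is the trace of `Z b`, a unit by Wilson's theorem.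
  have hZ : ∀ j ≤ b, ((T - 1) ^ (ℓ ^ j - 1)) (Z j) = ((ℓ - 1).factorial ^ j : ℕ) := by
    intro j
    induction j with
    | zero => intro _; simp [Z]
    | succ j ih =>
      intro hj
      have e1 : ℓ ^ (j + 1) - 1 = (ℓ ^ j - 1) + ℓ ^ j * (ℓ - 1) := by
        have h1 := Nat.pos_of_ne_zero (pow_ne_zero j hℓ.out.ne_zero)
        have h2 := hℓ.out.pos
        obtain ⟨l, rfl⟩ : ∃ l, ℓ = l + 1 := ⟨ℓ - 1, by omega⟩
        rw [pow_succ, Nat.add_sub_cancel, mul_add, mul_one]; omega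
      have e2 : Z (j + 1) = Z j * y j ^ (ℓ - 1) := Finset.prod_range_succ _ _
      have hZfix : (T ^ ℓ ^ j) (Z j) = Z j := by
        rw [hTpow]
        have : θ^[ℓ ^ j] (Z j) = ∏ i ∈ Finset.range j, (θ^[ℓ ^ j] (y i)) ^ (ℓ - 1) := by
          have h := map_prod ((θ : R →+* R) ^ ℓ ^ j) (fun i => y i ^ (ℓ - 1)) (Finset.range j)
          have hc : ∀ z, ((θ : R →+* R) ^ ℓ ^ j) z = θ^[ℓ ^ j] z := fun z => by
            rw [RingHom.coe_pow]; rfl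
          simp only [hc] at h
          refine h.trans (Finset.prod_congr rfl fun i _ => ?_)
          rw [iterate_map_pow]
        rw [this]
        refine Finset.prod_congr rfl fun i hi => ?_
        rw [← hTpow, hyfix i j (Finset.mem_range.1 hi) (by omega)]
      have hΔ : ∀ (m : ℕ) w, ((T ^ ℓ ^ j - 1) ^ m) (Z j * w) = Z j * ((T ^ ℓ ^ j - 1) ^ m) w := by
        intro m
        induction m with
        | zero => intro w; simp
        | succ m ih' =>
          intro w
          rw [pow_succ, Module.End.mul_apply, Module.End.mul_apply]
          have : (T ^ ℓ ^ j - 1) (Z j * w) = Z j * (T ^ ℓ ^ j - 1) w := by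
            change (T ^ ℓ ^ j) (Z j * w) - Z j * w = Z j * ((T ^ ℓ ^ j) w - w)
            rw [hTmul, hZfix, mul_sub]
          rw [this, ih']
      rw [e1, pow_add, Module.End.mul_apply, pow_mul, hNpow, e2, hΔ,
        iterate_sub_one_pow_eq_factorial (T ^ ℓ ^ j) (hTmul _) (hTone _) (hy j (by omega)),
        mul_comm, ← nsmul_eq_mul, map_nsmul, ih (by omega), nsmul_eq_mul, ← Nat.cast_mul, pow_succ']
  have hu : IsUnit (((ℓ - 1).factorial ^ b : ℕ) : R) := by
    rw [Nat.cast_pow]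
    refine IsUnit.pow b ?_
    rw [ ← map_natCast (ZMod.castHom (dvd_refl ℓ) R), ZMod.wilsons_lemma]
    exact (isUnit_one.neg).map _
  obtain ⟨g, hg⟩ := hu.exists_right_inv
  have hgfix : θ g = g := hinv _ _ (map_natCast θ _) hg
  refine ⟨g * Z b, ?_⟩
  have h1 := (hNfix (ℓ ^ b - 1) g (Z b) hgfix).trans (by rw [hZ b le_rfl, mul_comm, hg])
  rw [← sum_pow_eq_sub_one_pow] at h1
  rw [← h1, LinearMap.sum_apply]
  exact Finset.sum_congr rfl fun i _ => (hTpow i _).symm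

end Trace

namespace AbsolutelyUnramified

/-! ### Norms and roots of principal units; lifting commutativity from the reduction. -/

section Norm

variable {ℓ : ℕ} (O : Type*) [CommRing O] [IsDomain O] [IsDiscreteValuationRing O]
  [hO : AbsolutelyUnramified ℓ O]

-- The remainder is kept as a polynomial, so that the norm of 1 + ℓxY can be handled for all
-- invariant Y at once.
open Polynomial in
theorem exists_prod_one_add_eq {R ι : Type*} [CommRing R] (ℓ : ℕ) (c : ι → R) (s : Finset ι) :
    ∃ W : R[X], ∏ i ∈ s, (1 + ℓ • (C (c i) * X)) =
      1 + ℓ • (C (∑ i ∈ s, c i) * X) + (ℓ ^ 2) • W := by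
  classical
  induction s using Finset.induction_on with
  | empty => exact ⟨0, by simp⟩
  | insert a s ha ih =>
    obtain ⟨W, hW⟩ := ih
    refine ⟨W + C (c a) * X * (C (∑ i ∈ s, c i) * X) + ℓ • (C (c a) * X * W), ?_⟩
    rw [Finset.prod_insert ha, Finset.sum_insert ha, hW, map_add]
    simp only [nsmul_eq_mul, Nat.cast_pow]
    ring

include O hO

/-- Norm surjectivity on principal units. -/
theorem exists_prod_iterate_eq {R : Type*} [CommRing R] [Algebra O R] [Module.Finite O R]
    [Module.Free O R] (θ : R ≃ₐ[O] R) {q : ℕ} (hθ : ∀ x, θ^[q] x = x)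
    {x₀ v : R} (hx₀ : ∑ i ∈ Finset.range q, θ^[i] x₀ = 1 + ℓ • v) {a : R} (ha : θ a = a) :
    ∃ y, ∏ i ∈ Finset.range q, θ^[i] (1 + ℓ • y) = 1 + ℓ • a := by
  have hsum : ∀ x, θ (∑ i ∈ Finset.range q, θ^[i] x) = ∑ i ∈ Finset.range q, θ^[i] x := fun x => by
    rw [map_sum]
    simp only [← Function.iterate_succ_apply' θ]
    have h1 := Finset.sum_range_succ (fun i => θ^[i] x) q
    rw [Finset.sum_range_succ', hθ] at h1
    simpa using h1
  have hprod : ∀ x, θ (∏ i ∈ Finset.range q, θ^[i] x) = ∏ i ∈ Finset.range q, θ^[i] x := by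
    intro x
    rcases Nat.eq_zero_or_pos q with rfl | hq
    · simp
    obtain ⟨q, rfl⟩ := Nat.exists_eq_succ_of_ne_zero hq.ne'
    rw [map_prod]
    simp only [← Function.iterate_succ_apply' θ]
    rw [Finset.prod_range_succ, Finset.prod_range_succ' (fun i => θ^[i] x), hθ]
    simp
  obtain ⟨u, hu⟩ := (isUnit_one_add_nsmul O v).exists_right_inv
  have huθ : θ u = u := by
    have h1 : (1 + ℓ • v) * θ u = 1 := by
      conv_lhs => rw [← hx₀, ← hsum x₀, hx₀]
      rw [← map_mul, hu, map_one]
    calc θ u = ((1 + ℓ • v) * u) * θ u := by rw [hu, one_mul]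
      _ = u * ((1 + ℓ • v) * θ u) := by ring
      _ = u := by rw [h1, mul_one]
  have hit : ∀ (f : R), θ f = f → ∀ i, θ^[i] f = f := fun f hf i =>
    Function.iterate_fixed hf i
  -- Dividing by the trace, an invariant unit, gives an element of trace exactly 1.
  let x₁ := u * x₀
  have hx₁ : ∑ i ∈ Finset.range q, θ^[i] x₁ = 1 := by
    simp only [x₁, iterate_map_mul, hit u huθ]
    rw [← Finset.mul_sum, hx₀, mul_comm, hu]
  obtain ⟨W, hW⟩ := exists_prod_one_add_eq ℓ (fun i => θ^[i] x₁) (Finset.range q)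
  rw [hx₁] at hW
  have hWY : ∀ Y, ∏ i ∈ Finset.range q, (1 + ℓ • (θ^[i] x₁ * Y)) =
      1 + ℓ • Y + (ℓ ^ 2) • W.eval Y := fun Y => by
    have := congrArg (Polynomial.eval Y) hW
    simpa [Polynomial.eval_prod] using this
  have hN : ∀ Y, θ Y = Y → ∏ i ∈ Finset.range q, θ^[i] (1 + ℓ • (x₁ * Y)) =
      1 + ℓ • Y + (ℓ ^ 2) • W.eval Y := fun Y hY => by
    rw [← hWY]
    refine Finset.prod_congr rfl fun i _ => ?_
    rw [iterate_map_add, iterate_map_one, iterate_map_nsmul, iterate_map_mul, hit Y hY]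
  have hWθ : ∀ Y, θ Y = Y → θ (W.eval Y) = W.eval Y := fun Y hY => by
    have h1 := hprod (1 + ℓ • (x₁ * Y))
    rw [hN Y hY, map_add, map_add, map_nsmul, map_nsmul, map_one, hY, add_right_inj,
      ← sub_eq_zero, ← smul_sub] at h1
    exact sub_eq_zero.1 (pow_nsmul_eq_zero O h1)
  let R₀ : Submodule O R := LinearMap.eqLocus θ.toLinearMap LinearMap.id
  have hR₀ : ∀ x, x ∈ R₀ ↔ θ x = x := fun x => Iff.rfl
  -- For invariant Y the norm of 1 + ℓx₁Y is 1 + ℓ(Y + ℓW(Y)). The equation Y + ℓW(Y) = a is solved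
  -- inside the submodule of invariants, where this formula is valid.
  obtain ⟨Y, hY⟩ := exists_fixedPoint O (M := R₀)
    (fun Y => ⟨a - ℓ • W.eval (Y : R), by
      rw [hR₀, map_sub, map_nsmul, ha, hWθ Y Y.2]⟩) (by
    rintro m Y Y' ⟨Z, hZ⟩
    obtain ⟨r, hr⟩ := Polynomial.sub_dvd_eval_sub (Y : R) (Y' : R) W
    have hZ' : (Y : R) - Y' = ℓ ^ m • (Z : R) := congrArg Subtype.val hZ
    rw [hZ'] at hr
    have hmem : θ (Z * r) = Z * r := by
      have h1 : θ (W.eval (Y : R) - W.eval (Y' : R)) = W.eval (Y : R) - W.eval (Y' : R) := by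
        rw [map_sub, hWθ _ Y.2, hWθ _ Y'.2]
      rw [hr, smul_mul_assoc, map_nsmul, ← sub_eq_zero, ← smul_sub] at h1
      exact sub_eq_zero.1 (pow_nsmul_eq_zero O h1)
    refine ⟨⟨-(Z * r), by rw [hR₀, map_neg, hmem]⟩, Subtype.ext ?_⟩
    change a - ℓ • W.eval (Y : R) - (a - ℓ • W.eval (Y' : R)) = ℓ ^ (m + 1) • -((Z : R) * r)
    rw [sub_sub_sub_cancel_left, ← smul_sub, ← neg_sub, hr, smul_neg, smul_neg, smul_mul_assoc,
      smul_smul, pow_succ'])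
  have hY' : a - ℓ • W.eval (Y : R) = Y := congrArg Subtype.val hY
  refine ⟨x₁ * Y, ?_⟩
  rw [hN _ Y.2]
  nth_rewrite 1 [← hY']
  rw [smul_sub, smul_smul, ← pow_two]; abel

/-- A principal unit whose `n`-th power is an `ℓ ^ k`-th power, with `n ∣ ℓ ^ b` in the ring, is
an `ℓ ^ (k - b)`-th power. -/
theorem exists_pow_eq_of_pow_eq {R : Type*} [CommRing R] [Algebra O R] [Module.Finite O R]
    [Module.Free O R] [Nontrivial R] (hunit : ∀ f : R, (∀ g, f ≠ ℓ • g) → IsUnit f)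
    {c a δ y : R} (hc : c = 1 + ℓ • a) {n b k : ℕ} (hbk : b ≤ k) (hn : c ^ n = δ ^ ℓ ^ k)
    (hy : n * y = (ℓ : R) ^ b) : ∃ d a' : R, d = 1 + ℓ • a' ∧ d ^ ℓ ^ (k - b) = c := by
  have hp := hO.prime
  have hnot : ∀ g : R, IsUnit (ℓ • g) → False := fun g hg => by
    obtain ⟨w, hw⟩ := hg.exists_right_inv
    have h1 : IsUnit (0 : R) := by
      have h2 := isUnit_one_add_nsmul O (-(g * w))
      rwa [smul_neg, ← smul_mul_assoc, hw, add_neg_cancel] at h2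
    exact not_isUnit_zero h1
  have hpow : ∀ (x w : R), x = 1 + ℓ • w → ∀ m : ℕ, ∃ w', x ^ m = 1 + ℓ • w' := by
    intro x w hx m
    obtain ⟨r, hr⟩ := sub_dvd_pow_sub_pow x 1 m
    refine ⟨w * r, ?_⟩
    rw [one_pow, hx, add_sub_cancel_left, ← hx, sub_eq_iff_eq_add] at hr
    rw [hr, smul_mul_assoc, add_comm]
  -- Otherwise δ - 1 is a unit, although its ℓ^k-th power is congruent to δ^(ℓ^k) - 1 = c^n - 1,
  -- hence to 0, modulo ℓ.
  have hδ : ∃ w, δ = 1 + ℓ • w := by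
    by_contra! hne
    have hu := hunit (δ - 1) fun g hg => hne g (by rw [← hg]; ring)
    obtain ⟨r, hr⟩ := exists_add_pow_prime_pow_eq hp (δ - 1) 1 k
    obtain ⟨w, hw⟩ := hpow c a hc n
    rw [sub_add_cancel, one_pow, ← hn, hw] at hr
    refine hnot (w - (δ - 1) * r) ?_
    have : ℓ • (w - (δ - 1) * r) = (δ - 1) ^ ℓ ^ k := by
      simp only [nsmul_eq_mul] at hr ⊢
      linear_combination hr
    rw [this]; exact hu.pow _
  obtain ⟨w, hw⟩ := hδ
  have hinv : ∀ (x w : R), x = 1 + ℓ • w → ∃ x' w', x * x' = 1 ∧ x' = 1 + ℓ • w' := by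
    rintro x w rfl
    obtain ⟨x', hx'⟩ := (isUnit_one_add_nsmul O w).exists_right_inv
    refine ⟨x', -(w * x'), hx', ?_⟩
    rw [smul_neg, ← smul_mul_assoc, ← sub_eq_add_neg, eq_sub_iff_add_eq, ← hx']; ring
  have hmul : ∀ x y : R, (∃ w, x = 1 + ℓ • w) → (∃ w, y = 1 + ℓ • w) → ∃ w, x * y = 1 + ℓ • w := by
    rintro _ _ ⟨w, rfl⟩ ⟨w', rfl⟩
    exact ⟨w + w' + ℓ • (w * w'), by simp only [nsmul_eq_mul]; ring⟩
  have hn0 : n ≠ 0 := by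
    rintro rfl
    have h1 : ℓ ^ b • (1 : R) = 0 := by rw [nsmul_one, Nat.cast_pow, ← hy]; simp
    exact one_ne_zero (pow_nsmul_eq_zero O h1)
  obtain ⟨b', m, hm, rfl⟩ := Nat.exists_eq_pow_mul_and_not_dvd hn0 ℓ hp.ne_one
  have hb' : b' ≤ b := by
    by_contra! hlt
    obtain ⟨e, rfl⟩ := Nat.exists_eq_add_of_lt hlt
    have h1 : ℓ ^ b • (1 - ℓ • ((ℓ : R) ^ e * m * y)) = 0 := by
      push_cast at hy
      simp only [nsmul_eq_mul, Nat.cast_pow]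
      linear_combination -hy
    have h2 := sub_eq_zero.1 (pow_nsmul_eq_zero O h1)
    exact hnot _ (h2 ▸ isUnit_one)
  obtain ⟨δ', w', hδδ', hδ'⟩ := hinv δ w hw
  -- Here n = ℓ^b' m. The quotient of c^m by δ^(ℓ^(k - b')) is congruent to 1 and its ℓ^b'-th power
  -- is 1, so it equals 1.
  have h3 : c ^ m = (δ ^ ℓ ^ (b - b')) ^ ℓ ^ (k - b) := by
    have h4 : c ^ m * δ' ^ ℓ ^ (k - b') = 1 := by
      obtain ⟨w1, hw1⟩ := hmul _ _ (hpow c a hc m) (hpow δ' w' hδ' (ℓ ^ (k - b')))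
      refine eq_one_of_pow_eq_one O hw1 (pow_ne_zero b' hp.ne_zero) ?_
      rw [mul_pow, ← pow_mul, ← pow_mul, mul_comm m, hn, ← pow_add, Nat.sub_add_cancel (hb'.trans hbk),
        ← mul_pow, hδδ', one_pow]
    rw [← pow_mul, ← pow_add, show b - b' + (k - b) = k - b' by omega]
    calc c ^ m = c ^ m * (δ * δ') ^ ℓ ^ (k - b') := by rw [hδδ', one_pow, mul_one]
      _ = (c ^ m * δ' ^ ℓ ^ (k - b')) * δ ^ ℓ ^ (k - b') := by ring
      _ = _ := by rw [h4, one_mul]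
  obtain ⟨c', w'', hcc', hc'⟩ := hinv c a hc
  have hcop : Nat.Coprime m (ℓ ^ (k - b)) :=
    (Nat.Coprime.pow_left _ ((Nat.Prime.coprime_iff_not_dvd hp).2 hm)).symm
  -- Since m is prime to ℓ, the exponent m can be removed: the root is δ^(ℓ^(b - b') s) c^(-t).
  obtain ⟨s, t, hst⟩ : ∃ s t : ℕ, m * s = 1 + ℓ ^ (k - b) * t := by
    rcases (Nat.one_le_iff_ne_zero.2 (pow_ne_zero (k - b) hp.ne_zero)).eq_or_lt with h1 | h1
    · exact ⟨1, m - 1, by have : m ≠ 0 := by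
                            rintro rfl; exact hm (dvd_zero _)
                          rw [← h1]; omega⟩
    · obtain ⟨s, hs⟩ := Nat.exists_mul_mod_eq_one_of_coprime hcop h1
      refine ⟨s, m * s / ℓ ^ (k - b), ?_⟩
      have := Nat.mod_add_div (m * s) (ℓ ^ (k - b))
      omega
  obtain ⟨w2, hw2⟩ := hmul _ _ (hpow _ _ hw (ℓ ^ (b - b') * s)) (hpow _ _ hc' t)
  refine ⟨_, w2, hw2, ?_⟩
  rw [mul_pow, ← pow_mul, ← pow_mul, mul_comm t, mul_right_comm, pow_mul, pow_mul δ, ← h3, ← pow_mul,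
    hst, pow_add, pow_one, mul_assoc, ← mul_pow, hcc', one_pow, mul_one]

/-- A complete torsion-free ring with commutative perfect reduction is commutative. -/
theorem mul_comm_of_mod {A : Type*} [Ring A] [Algebra O A] [Module.Finite O A] [Module.Free O A]
    (hc : ∀ x y : A, ∃ z, x * y - y * x = ℓ • z) (hpow : ∀ x : A, ∃ w v, x = w ^ ℓ + ℓ • v)
    (x y : A) : x * y = y * x := by
  rw [← sub_eq_zero]
  refine eq_zero_of_forall_exists_nsmul O _ fun n => ?_
  induction n generalizing x y with
  | zero => exact ⟨_, by rw [pow_zero, one_smul]⟩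
  | succ n ih =>
    rcases n with _ | n
    · simpa using hc x y
    obtain ⟨w, v, rfl⟩ := hpow x
    obtain ⟨z, hz⟩ := ih w y
    obtain ⟨z', hz'⟩ := ih v y
    -- If [w, y] is divisible by ℓ^(n+1), then [w^m, y] is m times a multiple of ℓ^(n+1), up to
    -- ℓ^(n+2). For m = ℓ one more factor ℓ is gained, and x is an ℓ-th power modulo ℓ.
    have key : ∀ m : ℕ, ∃ r, w ^ m * y - y * w ^ m =
        ℓ ^ (n + 1) • (m • (w ^ (m - 1) * z) + ℓ • r) := by
      intro m
      induction m with
      | zero => exact ⟨0, by simp⟩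
      | succ m ihm =>
        obtain ⟨r, hr⟩ := ihm
        obtain ⟨s, hs⟩ := hc z w
        rcases m with _ | m
        · exact ⟨0, by simp [hz]⟩
        refine ⟨r * w + (m + 1) • (w ^ m * s), ?_⟩
        have e1 : w ^ (m + 1 + 1) * y - y * w ^ (m + 1 + 1) =
            w ^ (m + 1) * (w * y - y * w) + (w ^ (m + 1) * y - y * w ^ (m + 1)) * w := by
          rw [pow_succ w (m + 1)]; noncomm_ring
        have e2 : z * w = w * z + ℓ • s := by rw [← hs]; abel
        rw [e1, hz, hr, smul_mul_assoc, mul_smul_comm, ← smul_add]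
        congr 1
        simp only [Nat.add_sub_cancel]
        rw [add_mul, smul_mul_assoc, mul_assoc, e2, mul_add, ← mul_assoc (w ^ m), ← pow_succ]
        simp only [smul_mul_assoc, mul_smul_comm, smul_add, smul_smul]
        rw [add_smul (m + 1) 1, one_smul, mul_comm (m + 1) ℓ]
        abel
    obtain ⟨r, hr⟩ := key ℓ
    refine ⟨w ^ (ℓ - 1) * z + r + z', ?_⟩
    have e3 : (w ^ ℓ + ℓ • v) * y - y * (w ^ ℓ + ℓ • v) =
        (w ^ ℓ * y - y * w ^ ℓ) + ℓ • (v * y - y * v) := by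
      rw [add_mul, mul_add, smul_mul_assoc, mul_smul_comm, smul_sub]; abel
    rw [e3, hr, hz', ← smul_add, smul_smul, smul_smul, ← pow_succ', ← pow_succ, ← smul_add]

end Norm

end AbsolutelyUnramified

namespace AbsolutelyUnramified

/-! ### Rings in which ℓ is a uniformizer, and determinants over them. -/

section Scalars

variable {ℓ : ℕ} (O : Type*) [CommRing O] [IsDomain O] [IsDiscreteValuationRing O]
  [hO : AbsolutelyUnramified ℓ O] {R : Type*} [CommRing R] [Algebra O R] [Module.Finite O R]
  [Module.Free O R] [Nontrivial R]

include O hO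

-- The hypothesis `hunit` says that ℓ generates the only maximal ideal; with ℓ-adic separatedness
-- this gives the unit times power of ℓ factorization of a discrete valuation ring. It will hold for
-- the commutant of the whole group.
omit [Free O R] [Nontrivial R] in
theorem exists_eq_pow_nsmul_unit (hunit : ∀ f : R, (∀ g, f ≠ ℓ • g) → IsUnit f) {f : R}
    (hf : f ≠ 0) : ∃ (n : ℕ) (u : Rˣ), f = ℓ ^ n • (u : R) := by
  classical
  have h : ∃ n, ¬ ∃ z, f = ℓ ^ n • z := by
    by_contra! h
    exact hf (eq_zero_of_forall_exists_nsmul O f h)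
  have h0 : Nat.find h ≠ 0 := fun h0 => by
    have := Nat.find_spec h
    rw [h0] at this
    exact this ⟨f, by simp⟩
  obtain ⟨n, hn⟩ := Nat.exists_eq_succ_of_ne_zero h0
  obtain ⟨z, hz⟩ := not_not.1 (Nat.find_min h (m := n) (by omega))
  have hs := Nat.find_spec h
  rw [hn] at hs
  obtain ⟨u, hu⟩ := hunit z fun g hg => hs ⟨g, by rw [hz, hg, smul_smul, ← pow_succ]⟩
  exact ⟨n, u, by rw [hu, hz]⟩

theorem isDomain_of_isUnit_of_ne (hunit : ∀ f : R, (∀ g, f ≠ ℓ • g) → IsUnit f) : IsDomain R := by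
  have : NoZeroDivisors R := ⟨fun {a b} hab => by
    by_contra! hne
    obtain ⟨n, u, hu⟩ := exists_eq_pow_nsmul_unit O hunit hne.1
    rw [hu, smul_mul_assoc] at hab
    have := pow_nsmul_eq_zero O hab
    exact hne.2 ((Units.mul_right_eq_zero u).1 this)⟩
  exact NoZeroDivisors.to_isDomain R

theorem isPrincipalIdealRing_of_isUnit_of_ne (hunit : ∀ f : R, (∀ g, f ≠ ℓ • g) → IsUnit f) :
    IsPrincipalIdealRing R := by
  have := isDomain_of_isUnit_of_ne O hunit
  have hnot : ¬ IsUnit (ℓ : R) := fun h => by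
    obtain ⟨w, hw⟩ := h.exists_right_inv
    have h2 := isUnit_one_add_nsmul O (-w)
    rw [smul_neg, nsmul_eq_mul, hw, add_neg_cancel] at h2
    exact not_isUnit_zero h2
  have hne : (ℓ : R) ≠ 0 := fun h => by
    have : ℓ • (1 : R) = 0 := by rw [nsmul_one, h]
    exact one_ne_zero (nsmul_eq_zero O this)
  have hirr : Irreducible (ℓ : R) := by
    refine ⟨hnot, fun a b hab => ?_⟩
    by_contra! hcon
    have hdiv : ∀ a : R, ¬ IsUnit a → ∃ g, a = ℓ • g := fun a ha => by
      by_contra! h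
      exact ha (hunit a h)
    obtain ⟨g, rfl⟩ := hdiv a hcon.1
    obtain ⟨g', rfl⟩ := hdiv b hcon.2
    refine hnot (IsUnit.of_mul_eq_one (g * g') (mul_left_cancel₀ hne ?_))
    rw [mul_one]
    nth_rewrite 3 [hab]
    simp only [nsmul_eq_mul]; ring
  have : IsDiscreteValuationRing R :=
    IsDiscreteValuationRing.ofHasUnitMulPowIrreducibleFactorization
      ⟨ℓ, hirr, fun {f} hf => by
        obtain ⟨n, u, hu⟩ := exists_eq_pow_nsmul_unit O hunit hf
        exact ⟨n, u, by rw [hu, nsmul_eq_mul, Nat.cast_pow]⟩⟩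
  infer_instance

variable {M : Type*} [AddCommGroup M] [Module O M] [Module.Finite O M] [Module.Free O M]
  [Module R M] [IsScalarTower O R M]

omit [IsDomain O] [IsDiscreteValuationRing O] hO [Module.Finite O R] [Free O R] [Nontrivial R]
  [Free O M] in
theorem finite_of_isUnit_of_ne : Module.Finite R M := Module.Finite.of_restrictScalars_finite O R M

theorem free_of_isUnit_of_ne (hunit : ∀ f : R, (∀ g, f ≠ ℓ • g) → IsUnit f) : Module.Free R M := by
  have := isDomain_of_isUnit_of_ne O hunit
  have := isPrincipalIdealRing_of_isUnit_of_ne O hunit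
  have : Module.Finite R M := finite_of_isUnit_of_ne O
  have : Module.IsTorsionFree R M := by
    refine Module.isTorsionFree_iff_smul_eq_zero.2 fun r m h => ?_
    by_contra! hne
    obtain ⟨n, u, rfl⟩ := exists_eq_pow_nsmul_unit O hunit hne.1
    rw [smul_assoc] at h
    have := pow_nsmul_eq_zero O h
    rw [← Units.smul_def, smul_eq_zero_iff_eq] at this
    exact hne.2 this
  infer_instance

/-- A scalar that becomes an `ℓ ^ k`-th power of an operator normalizing the action of a group of
order prime to `ℓ`. -/
theorem exists_pow_eq_of_end_pow_eq [Nontrivial M]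
    (hunit : ∀ f : R, (∀ g, f ≠ ℓ • g) → IsUnit f) {H : Type*} [Group H] [Finite H]
    (hH : ¬ ℓ ∣ Nat.card H) (α : Representation R H M) (T : (End R M)ˣ) {b k : ℕ} (hbk : b ≤ k)
    {c a : R} (hc : c = 1 + ℓ • a) (hT : ((T ^ ℓ ^ k : (End R M)ˣ) : End R M) = c • 1)
    (hscalar : ∀ X : End R M, (∀ h, Commute X (α h)) →
      ∃ y : R, ∑ i ∈ Finset.range (ℓ ^ b), ((T ^ i : (End R M)ˣ) : End R M) * X *
        ((T ^ i)⁻¹ : (End R M)ˣ) = y • 1) :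
    ∃ d a' : R, d = 1 + ℓ • a' ∧ d ^ ℓ ^ (k - b) = c := by
  have := Fintype.ofFinite H
  have := isDomain_of_isUnit_of_ne O hunit
  have : Module.Finite R M := finite_of_isUnit_of_ne O
  have : Module.Free R M := free_of_isUnit_of_ne O hunit
  -- The determinant makes c^n an ℓ^k-th power, n being the rank of M over R.
  have hdet : c ^ finrank R M = (LinearMap.det (T : End R M)) ^ ℓ ^ k := by
    rw [← map_pow, ← Units.val_pow_eq_pow_val, hT, LinearMap.det_smul, map_one, mul_one]
  obtain ⟨e, he⟩ := exists_inv_card (O := O) hH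
  obtain ⟨X₀, hX₀⟩ : ∃ X₀ : End R M, LinearMap.trace R M X₀ = 1 := by
    let bM := Module.Free.chooseBasis R M
    obtain ⟨i⟩ : Nonempty (Module.Free.ChooseBasisIndex R M) := bM.index_nonempty
    exact ⟨(bM.coord i).smulRight (bM i), by rw [LinearMap.trace_smulRight]; simp⟩
  -- An operator of trace 1 averaged over H still has trace 1. Taking the trace of the hypothesis
  -- `hscalar` for it gives ℓ^b = n y, which bounds the ℓ-part of the rank.
  let X : End R M := algebraMap O R e • ∑ h, α h * X₀ * α h⁻¹
  have hXα : ∀ h, Commute X (α h) := fun h => by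
    change X * α h = α h * X
    simp only [X, smul_mul_assoc, mul_smul_comm, Finset.sum_mul, Finset.mul_sum]
    congr 1
    refine Fintype.sum_equiv (Equiv.mulLeft h⁻¹) _ _ fun y => ?_
    simp only [Equiv.coe_mulLeft, mul_inv_rev, inv_inv, map_mul]
    rw [← mul_assoc, ← mul_assoc, ← mul_assoc, ← mul_assoc, ← map_mul, mul_inv_cancel, map_one,
      one_mul]
  have hXtr : LinearMap.trace R M X = 1 := by
    simp only [X, map_smul, map_sum]
    have : ∀ h, LinearMap.trace R M (α h * X₀ * α h⁻¹) = 1 := fun h => by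
      rw [LinearMap.trace_mul_comm, ← mul_assoc, ← map_mul, inv_mul_cancel, map_one, one_mul, hX₀]
    rw [Finset.sum_congr rfl fun h _ => this h, Finset.sum_const, Finset.card_univ,
      ← Nat.card_eq_fintype_card, nsmul_one, ← map_natCast (algebraMap O R), smul_eq_mul,
      ← map_mul, mul_comm, he, map_one]
  obtain ⟨y, hy⟩ := hscalar X hXα
  have h1 := congrArg (LinearMap.trace R M) hy
  rw [map_sum, map_smul, LinearMap.trace_one] at h1
  have h2 : ∀ i, LinearMap.trace R M (((T ^ i : (End R M)ˣ) : End R M) * X *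
      ((T ^ i)⁻¹ : (End R M)ˣ)) = 1 := fun i => by
    rw [LinearMap.trace_conj, hXtr]
  rw [Finset.sum_congr rfl fun i _ => h2 i, Finset.sum_const, Finset.card_range, nsmul_one] at h1
  exact exists_pow_eq_of_pow_eq O hunit hc hbk hdet (y := y)
    (by rw [mul_comm, ← smul_eq_mul, ← h1, Nat.cast_pow])

end Scalars

end AbsolutelyUnramified

namespace AbsolutelyUnramified

/-! ### The reduction modulo ℓ of a ring with an automorphism. -/

section ResidueRing

variable {ℓ : ℕ} (O : Type*) [CommRing O] [IsDomain O] [IsDiscreteValuationRing O]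
  [hO : AbsolutelyUnramified ℓ O]

include O hO

/-- If an automorphism of `ℓ`-power order modulo `ℓ` has only units as fixed points modulo `ℓ`,
then the reduction modulo `ℓ` is a reduced commutative ring. -/
theorem exists_residueRing {R : Type u} [Ring R] [Algebra O R] [Module.Finite O R]
    [Module.Free O R] [Nontrivial R] (θ : R ≃+* R) {n : ℕ}
    (hθ : ∀ x, ∃ z, θ^[ℓ ^ n] x = x + ℓ • z)
    (hfix : ∀ f z, θ f = f + ℓ • z → (∀ g, f ≠ ℓ • g) → IsUnit f) :
    ∃ (S : Type u) (_ : CommRing S) (p : R →+* S) (θ' : S ≃+* S), Finite S ∧ CharP S ℓ ∧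
      IsReduced S ∧ Nontrivial S ∧ Function.Surjective p ∧ (∀ x, p x = 0 ↔ ∃ z, x = ℓ • z) ∧
      (∀ x, θ' (p x) = p (θ x)) := by
  have : Fact ℓ.Prime := ⟨hO.prime⟩
  let I : Ideal R := Ideal.span {(ℓ : R)}
  have hI : ∀ x, x ∈ I ↔ ∃ z, x = ℓ • z := fun x => by
    simp only [I, Ideal.mem_span_singleton', nsmul_eq_mul, eq_comm, (Nat.cast_commute ℓ _).eq]
  have : I.IsTwoSided := ⟨fun {a} b ha => by
    obtain ⟨z, rfl⟩ := (hI a).1 ha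
    exact (hI _).2 ⟨z * b, by rw [smul_mul_assoc]⟩⟩
  have hmap : I = I.map (θ : R →+* R) := by
    simp only [I, Ideal.map_span, Set.image_singleton, map_natCast]
  let p : R →+* R ⧸ I := Ideal.Quotient.mk I
  have hp : ∀ x, p x = 0 ↔ ∃ z, x = ℓ • z := fun x => by
    rw [← hI]; exact Ideal.Quotient.eq_zero_iff_mem
  have hsurj : Function.Surjective p := Ideal.Quotient.mk_surjective
  let θ' : R ⧸ I ≃+* R ⧸ I := Ideal.quotientEquiv I I θ hmap
  have hθ' : ∀ x, θ' (p x) = p (θ x) := fun x => rfl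
  have hfin : Finite (R ⧸ I) := by
    let b := Module.finBasis O R
    choose s hs using residue_surjective (R := O)
    refine Finite.of_surjective
      (fun c : Fin (finrank O R) → ResidueField O => p (∑ i, s (c i) • b i)) fun q => ?_
    obtain ⟨x, rfl⟩ := hsurj q
    refine ⟨fun i => residue O (b.repr x i), ?_⟩
    rw [← sub_eq_zero, ← map_sub, hp]
    choose z hz using fun i => exists_of_residue_eq_zero
      (a := s (residue O (b.repr x i)) - b.repr x i) (by rw [map_sub, hs, sub_self])
    refine ⟨∑ i, z i • b i, ?_⟩
    conv_lhs => rw [← b.sum_repr x]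
    rw [b.repr_sum_self, ← Finset.sum_sub_distrib, Finset.smul_sum]
    exact Finset.sum_congr rfl fun i _ => by rw [← sub_smul, hz, smul_assoc]
  have hnt : Nontrivial (R ⧸ I) := by
    refine nontrivial_of_ne (p 1) 0 fun h => ?_
    obtain ⟨z, hz⟩ := (hp 1).1 h
    have h2 := isUnit_one_add_nsmul O (-z)
    rw [smul_neg, ← hz, add_neg_cancel] at h2
    exact not_isUnit_zero h2
  have hchar : CharP (R ⧸ I) ℓ := by
    refine (CharP.charP_iff_prime_eq_zero hO.prime).2 ?_
    rw [← map_natCast p, hp]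
    exact ⟨1, by rw [nsmul_one]⟩
  have hiter : ∀ m x, θ'^[m] (p x) = p (θ^[m] x) := fun m x => by
    induction m with
    | zero => rfl
    | succ m ih => rw [Function.iterate_succ_apply', ih, hθ', Function.iterate_succ_apply']
  have hpz : ∀ z, p (ℓ • z) = 0 := fun z => (hp _).2 ⟨z, rfl⟩
  have hred : IsReduced (R ⧸ I) := isReduced_of_fixed_isUnit (ℓ := ℓ) θ' (n := n) (fun x => by
      obtain ⟨x, rfl⟩ := hsurj x
      obtain ⟨z, hz⟩ := hθ x
      rw [hiter, hz, map_add, hpz, add_zero]) fun x hx hx0 => by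
    obtain ⟨x, rfl⟩ := hsurj x
    rw [hθ', ← sub_eq_zero, ← map_sub, hp] at hx
    obtain ⟨z, hz⟩ := hx
    exact (hfix x z (by rw [← hz]; abel) fun g hg => hx0 (by rw [hg, hpz])).map p
  let cr : CommRing (R ⧸ I) :=
    { (inferInstance : Ring (R ⧸ I)) with mul_comm := mul_comm_of_finite_of_isReduced (R ⧸ I) }
  exact ⟨R ⧸ I, cr, p, θ', hfin, hchar, hred, hnt, hsurj, hp, hθ'⟩

/-- The reduction is finite, reduced and commutative, so its Frobenius is bijective and every
element is an ℓ-th power modulo ℓ; this is what `mul_comm_of_mod` asks for. -/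
theorem mul_comm_of_fixed_isUnit {R : Type u} [Ring R] [Algebra O R] [Module.Finite O R]
    [Module.Free O R] [Nontrivial R] (θ : R ≃+* R) {n : ℕ}
    (hθ : ∀ x, ∃ z, θ^[ℓ ^ n] x = x + ℓ • z)
    (hfix : ∀ f z, θ f = f + ℓ • z → (∀ g, f ≠ ℓ • g) → IsUnit f) (x y : R) :
    x * y = y * x := by
  obtain ⟨S, _, p, θ', _, _, _, _, hsurj, hp, -⟩ := exists_residueRing O θ hθ hfix
  have : Fact ℓ.Prime := ⟨hO.prime⟩
  have hfrob : Function.Surjective (frobenius S ℓ) :=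
    Finite.surjective_of_injective (frobenius_inj S ℓ)
  refine mul_comm_of_mod O (fun x y => ?_) (fun x => ?_) x y
  · rw [← hp, map_sub, map_mul, map_mul, mul_comm, sub_self]
  · obtain ⟨w, hw⟩ := hfrob (p x)
    obtain ⟨w, rfl⟩ := hsurj w
    have h : p (x - w ^ ℓ) = 0 := by rw [map_sub, map_pow, ← hw, frobenius_def, sub_self]
    obtain ⟨v, hv⟩ := (hp _).1 h
    exact ⟨w, v, by rw [← hv]; abel⟩

/-- Take b minimal with θ^(ℓ^b) trivial modulo ℓ, as the trace argument requires. Then θ^(ℓ^b) is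
congruent to 1 and of finite order, so it is trivial on R itself. -/
theorem exists_sum_iterate_eq_one_add {R : Type u} [CommRing R] [Algebra O R] [Module.Finite O R]
    [Module.Free O R] [Nontrivial R] (θ : R ≃ₐ[O] R) {k : ℕ} (hθ : ∀ x, θ^[ℓ ^ k] x = x)
    (hfix : ∀ f z, θ f = f + ℓ • z → (∀ g, f ≠ ℓ • g) → IsUnit f) :
    ∃ b ≤ k, (∀ x, θ^[ℓ ^ b] x = x) ∧
      ∃ x₀ v, ∑ i ∈ Finset.range (ℓ ^ b), θ^[i] x₀ = 1 + ℓ • v := by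
  classical
  have hp' := hO.prime
  have : Fact ℓ.Prime := ⟨hO.prime⟩
  obtain ⟨S, _, p, θ', _, _, _, _, hsurj, hp, hθ'⟩ :=
    exists_residueRing O (θ : R ≃+* R) (n := k) (fun x => ⟨0, by simpa using hθ x⟩) hfix
  have hiter : ∀ m x, θ'^[m] (p x) = p (θ^[m] x) := fun m x => by
    induction m with
    | zero => rfl
    | succ m ih => rw [Function.iterate_succ_apply', ih, hθ', Function.iterate_succ_apply']; rfl
  have hex : ∃ b, ∀ x, θ'^[ℓ ^ b] x = x := ⟨k, fun x => by
    obtain ⟨x, rfl⟩ := hsurj x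
    rw [hiter, hθ]⟩
  obtain ⟨b, hb, hmin⟩ : ∃ b, (∀ x, θ'^[ℓ ^ b] x = x) ∧ ∀ m < b, ¬ ∀ x, θ'^[ℓ ^ m] x = x :=
    ⟨Nat.find hex, Nat.find_spec hex, fun m hm => Nat.find_min hex hm⟩
  have hbk : b ≤ k := by
    by_contra! h
    exact hmin k h fun x => by
      obtain ⟨x, rfl⟩ := hsurj x
      rw [hiter, hθ]
  refine ⟨b, hbk, fun x => ?_, ?_⟩
  · have hpow : ∀ m x, ((θ.toLinearMap : End O R) ^ m) x = θ^[m] x := fun m x => by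
      rw [Module.End.pow_apply]; rfl
    obtain ⟨w, hw⟩ := exists_linearMap_eq_nsmul ((θ.toLinearMap : End O R) ^ ℓ ^ b - 1) fun x => by
      rw [LinearMap.sub_apply, hpow, ← hp, map_sub, ← hiter, hb, Module.End.one_apply, sub_self]
    have h1 := eq_one_of_pow_eq_one O (x := (θ.toLinearMap : End O R) ^ ℓ ^ b) (w := w)
      (by rw [← hw]; abel) (m := ℓ ^ (k - b)) (pow_ne_zero _ hp'.ne_zero) (by
        rw [← pow_mul, ← pow_add, Nat.add_sub_cancel' hbk]
        exact LinearMap.ext fun x => by rw [hpow, hθ]; rfl)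
    rw [← hpow, h1]; rfl
  · obtain ⟨x, hx⟩ := exists_sum_iterate_eq_one (ℓ := ℓ) θ' hb (fun c hc => by
        have := hmin c (by omega)
        push Not at this
        exact this) fun x hx hx0 => by
      obtain ⟨x, rfl⟩ := hsurj x
      rw [hθ', ← sub_eq_zero, ← map_sub, hp] at hx
      obtain ⟨z, hz⟩ := hx
      exact (hfix x z (by rw [← hz]; simp) fun g hg => hx0 ((hp _).2 ⟨g, hg⟩)).map p
    obtain ⟨x, rfl⟩ := hsurj x
    have h : p (∑ i ∈ Finset.range (ℓ ^ b), θ^[i] x - 1) = 0 := by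
      rw [map_sub, map_one, map_sum, ← hx, sub_eq_zero]
      exact Finset.sum_congr rfl fun i _ => (hiter i x).symm
    obtain ⟨v, hv⟩ := (hp _).1 h
    exact ⟨x, v, by rw [← hv]; ring⟩

end ResidueRing

end AbsolutelyUnramified

namespace AbsolutelyUnramified

/-! ### Correcting a normalizing operator to finite order. -/

section Correction

variable {ℓ : ℕ} (O : Type*) [CommRing O] [IsDomain O] [IsDiscreteValuationRing O]
  [hO : AbsolutelyUnramified ℓ O]

theorem exists_inv_eq_one_add_nsmul {A : Type*} [Ring A] {n : ℕ} {z : Aˣ} {w : A}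
    (h : (z : A) = 1 + n • w) : ∃ w' : A, ((z⁻¹ : Aˣ) : A) = 1 + n • w' := by
  refine ⟨-((z⁻¹ : Aˣ) * w), ?_⟩
  have h1 : ((z⁻¹ : Aˣ) : A) * z = 1 := z.inv_mul
  rw [h, mul_add, mul_one, mul_smul_comm] at h1
  rw [smul_neg, ← h1]; abel

omit [IsDomain O] [IsDiscreteValuationRing O] in
/-- The commutant of a group action, with conjugation by an operator normalizing the action. -/
theorem exists_conj_centralizer {H M : Type*} [Group H] [AddCommGroup M] [Module O M]
    (α : Representation O H M) (ψ : MulAut H) (t : (End O M)ˣ)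
    (ht : ∀ h, (t : End O M) * α h = α (ψ h) * t) :
    ∃ θ : Subalgebra.centralizer O (Set.range α) ≃ₐ[O] Subalgebra.centralizer O (Set.range α),
      ∀ x, (θ x : End O M) * t = t * x := by
  have hinv : ∀ h, ((t⁻¹ : (End O M)ˣ) : End O M) * α (ψ h) = α h * (t⁻¹ : (End O M)ˣ) := fun h => by
    rw [Units.inv_mul_eq_iff_eq_mul, ← mul_assoc, ht, mul_assoc, Units.mul_inv, mul_one]
  have hmem : ∀ x : End O M, x ∈ Subalgebra.centralizer O (Set.range α) ↔
      ∀ h, α h * x = x * α h := fun x => by simp [Subalgebra.mem_centralizer_iff]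
  let e : End O M ≃ₐ[O] End O M := MulSemiringAction.toAlgEquiv O (End O M) (ConjAct.toConjAct t)
  have he : ∀ x, e x = t * x * (t⁻¹ : (End O M)ˣ) := fun x => ConjAct.units_smul_def _ _
  have hmap : (Subalgebra.centralizer O (Set.range α)).map (e : End O M →ₐ[O] End O M) =
      Subalgebra.centralizer O (Set.range α) := by
    apply le_antisymm
    · rintro _ ⟨x, hx, rfl⟩
      refine (hmem _).2 fun h => ?_
      obtain ⟨h, rfl⟩ := ψ.surjective h
      have hx' := (hmem x).1 hx h
      change α (ψ h) * e x = e x * α (ψ h)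
      rw [he, mul_assoc _ _ (α (ψ h)), hinv, ← mul_assoc, ← mul_assoc, ← ht, mul_assoc _ (α h),
        hx']
      simp only [mul_assoc]
    · intro x hx
      refine ⟨(t⁻¹ : (End O M)ˣ) * x * t, (hmem _).2 fun h => ?_, ?_⟩
      · have hx' := (hmem x).1 hx (ψ h)
        rw [mul_assoc _ _ (α h), ht, ← mul_assoc, ← mul_assoc, ← hinv, mul_assoc _ (α (ψ h)), hx']
        noncomm_ring
      · change e _ = x
        rw [he]
        simp [mul_assoc]
  let θ := (e.subalgebraMap (Subalgebra.centralizer O (Set.range α))).trans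
    (Subalgebra.equivOfEq _ _ hmap)
  refine ⟨θ, fun x => ?_⟩
  have : (θ x : End O M) = e x := rfl
  rw [this, he, mul_assoc, Units.inv_mul, mul_one]

variable {O}
variable {H M : Type*} [Group H] [AddCommGroup M] [Module O M] [Module.Finite O M]
    [Module.Free O M] [Nontrivial M] {α : Representation O H M} {ψ : MulAut H}
    {t : (End O M)ˣ} {k : ℕ}

variable (α t) in
/-- The hypotheses under which an operator normalizing an action can be corrected: the action
of `α` and `t` is irreducible modulo `ℓ`. -/
structure IsNormalizingLift (ℓ : ℕ) (ψ : MulAut H) (k : ℕ) : Prop where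
  conj : ∀ h, (t : End O M) * α h = α (ψ h) * t
  aut_pow : ψ ^ ℓ ^ k = 1
  pow_eq : ∃ w, (t : End O M) ^ ℓ ^ k = 1 + ℓ • w
  isUnit : ∀ f z : End O M, (∀ h, Commute (α h) f) → f * t = t * f + ℓ • z → (∀ g, f ≠ ℓ • g) →
    IsUnit f

namespace IsNormalizingLift

omit [IsDomain O] [IsDiscreteValuationRing O] hO [Module.Finite O M] [Module.Free O M]
  [Nontrivial M] in
theorem pow_mul (h : IsNormalizingLift α t ℓ ψ k) (x : H) :
    α x * (t : End O M) ^ ℓ ^ k = (t : End O M) ^ ℓ ^ k * α x := by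
  have h1 : ∀ m : ℕ, (t : End O M) ^ m * α x = α ((ψ ^ m) x) * (t : End O M) ^ m := fun m => by
    induction m with
    | zero => simp
    | succ m ih => rw [pow_succ', mul_assoc, ih, ← mul_assoc, h.conj, pow_succ' ψ, mul_assoc]; rfl
  rw [h1, h.aut_pow]; rfl

/-- Conjugation by t is an automorphism of the commutant, of ℓ-power order modulo ℓ; its fixed
points modulo ℓ are units or divisible by ℓ, by the irreducibility encoded in `IsNormalizingLift`.
-/
theorem mul_comm (h : IsNormalizingLift α t ℓ ψ k) {x y : End O M} (hx : ∀ h, Commute (α h) x)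
    (hy : ∀ h, Commute (α h) y) : x * y = y * x := by
  obtain ⟨θ, hθ⟩ := exists_conj_centralizer O α ψ t h.conj
  let R := Subalgebra.centralizer O (Set.range α)
  have hmem : ∀ x : End O M, x ∈ R ↔ ∀ h, Commute (α h) x := fun x => by
    simp [R, Subalgebra.mem_centralizer_iff, Commute, SemiconjBy]
  have hfin : Module.Finite O (Subalgebra.toSubmodule R) := inferInstance
  have hfree : Module.Free O (Subalgebra.toSubmodule R) := inferInstance
  have : Module.Finite O R := hfin
  have : Module.Free O R := hfree
  have hdiv : ∀ x : R, (∃ z : End O M, (x : End O M) = ℓ • z) → ∃ z : R, x = ℓ • z := by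
    rintro x ⟨z, hz⟩
    refine ⟨⟨z, (hmem _).2 fun h => ?_⟩, Subtype.ext hz⟩
    have h1 := ((hmem x).1 x.2 h).eq
    rw [hz, mul_smul_comm, smul_mul_assoc, ← sub_eq_zero, ← smul_sub] at h1
    exact sub_eq_zero.1 (nsmul_eq_zero O h1)
  have hiter : ∀ (m : ℕ) (x : R), ((θ^[m] x : R) : End O M) * (t : End O M) ^ m =
      (t : End O M) ^ m * x := fun m x => by
    induction m with
    | zero => simp
    | succ m ih =>
      rw [Function.iterate_succ_apply', pow_succ', ← mul_assoc, hθ, mul_assoc, ih, ← mul_assoc]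
  have hunit : ∀ x : R, IsUnit (x : End O M) → IsUnit x := by
    rintro x ⟨u, hu⟩
    have hx := (hmem x).1 x.2
    rw [← hu] at hx
    have h1 : ((u⁻¹ : (End O M)ˣ) : End O M) ∈ R :=
      (hmem _).2 fun h => (hx h).units_inv_right
    exact ⟨⟨x, ⟨_, h1⟩, Subtype.ext (by simp [← hu]), Subtype.ext (by simp [← hu])⟩, rfl⟩
  obtain ⟨w, hw⟩ := h.pow_eq
  have := mul_comm_of_fixed_isUnit O (R := R) (θ : R ≃+* R) (n := k) (fun x => ?_) (fun f z hf hne => ?_)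
    ⟨x, (hmem x).2 hx⟩ ⟨y, (hmem y).2 hy⟩
  · exact congrArg Subtype.val this
  · have h1 := hiter (ℓ ^ k) x
    rw [hw, mul_add, add_mul, mul_one, one_mul, mul_smul_comm, smul_mul_assoc] at h1
    obtain ⟨z, hz⟩ := hdiv (θ^[ℓ ^ k] x - x) ⟨w * x - (θ^[ℓ ^ k] x : R) * w, by
      rw [smul_sub, AddSubgroupClass.coe_sub, sub_eq_sub_iff_add_eq_add, h1, add_comm]⟩
    exact ⟨z, by rw [← hz]; simp⟩
  · refine hunit f (h.isUnit f (-(z * t)) ((hmem f).1 f.2) ?_ fun g hg => ?_)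
    · have h1 := hθ f
      have h2 : ((θ f : R) : End O M) = f + ℓ • z := by
        have := congrArg Subtype.val hf
        simpa using this
      rw [h2, add_mul, smul_mul_assoc] at h1
      rw [smul_neg, ← h1]; abel
    · obtain ⟨z, hz⟩ := hdiv f ⟨g, hg⟩
      exact hne z hz

variable [Finite H] (hH : ¬ ℓ ∣ Nat.card H)
include hH

/-- A normalizing operator can be corrected, by an operator congruent to `1` and commuting
with the action, to one of finite order. -/
theorem exists_pow_eq_one (h : IsNormalizingLift α t ℓ ψ k) :
    ∃ (z : (End O M)ˣ) (w : End O M), (z : End O M) = 1 + ℓ • w ∧ (∀ h, Commute (α h) z) ∧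
      (z * t) ^ ℓ ^ k = 1 := by
  have hp' := hO.prime
  obtain ⟨θ, hθ⟩ := exists_conj_centralizer O α ψ t h.conj
  let R := Subalgebra.centralizer O (Set.range α)
  have hmem : ∀ x : End O M, x ∈ R ↔ ∀ h, Commute (α h) x := fun x => by
    simp [R, Subalgebra.mem_centralizer_iff, Commute, SemiconjBy]
  have hfin : Module.Finite O (Subalgebra.toSubmodule R) := inferInstance
  have hfree : Module.Free O (Subalgebra.toSubmodule R) := inferInstance
  have hcomm : ∀ x ∈ R, ∀ y ∈ R, x * y = y * x := fun x hx y hy =>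
    h.mul_comm ((hmem x).1 hx) ((hmem y).1 hy)
  have hdiv : ∀ z : End O M, ℓ • z ∈ R → z ∈ R := by
    refine fun z hz => (hmem _).2 fun h => ?_
    have h1 := ((hmem _).1 hz h).eq
    rw [mul_smul_comm, smul_mul_assoc, ← sub_eq_zero, ← smul_sub] at h1
    exact sub_eq_zero.1 (nsmul_eq_zero O h1)
  have hiter : ∀ (m : ℕ) (x : R), ((θ^[m] x : R) : End O M) * (t : End O M) ^ m =
      (t : End O M) ^ m * x := fun m x => by
    induction m with
    | zero => simp
    | succ m ih =>
      rw [Function.iterate_succ_apply', pow_succ', ← mul_assoc, hθ, mul_assoc, ih, ← mul_assoc]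
  have hinvR : ∀ u : (End O M)ˣ, (u : End O M) ∈ R → ((u⁻¹ : (End O M)ˣ) : End O M) ∈ R :=
    fun u hu => (hmem _).2 fun h => ((hmem _).1 hu h).units_inv_right
  let cR := commRingOfComm R hcomm
  have : Module.Finite O R := hfin
  have : Module.Free O R := hfree
  have hcR : ((t : End O M) ^ ℓ ^ k) ∈ R := (hmem _).2 h.pow_mul
  have hfull : ∀ x : R, θ^[ℓ ^ k] x = x := fun x => by
    have h1 := hiter (ℓ ^ k) x
    rw [hcomm _ hcR _ x.2] at h1
    rw [← Units.val_pow_eq_pow_val] at h1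
    exact Subtype.ext ((Units.mul_left_inj _).1 h1)
  have hfix : ∀ f z : R, θ f = f + ℓ • z → (∀ g, f ≠ ℓ • g) → IsUnit f := fun f z hf hne => by
    have h1 : IsUnit (f : End O M) := by
      refine h.isUnit f (-(z * t)) ((hmem f).1 f.2) ?_ fun g hg => ?_
      · have h1 := hθ f
        have h2 : ((θ f : R) : End O M) = f + ℓ • z := congrArg Subtype.val hf
        rw [h2, add_mul, smul_mul_assoc] at h1
        rw [smul_neg, ← h1]; abel
      · exact hne ⟨g, hdiv g (hg ▸ f.2)⟩ (Subtype.ext hg)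
    obtain ⟨u, hu⟩ := h1
    exact ⟨⟨f, ⟨_, hinvR u (hu ▸ f.2)⟩, Subtype.ext (by simp [← hu]),
      Subtype.ext (by simp [← hu])⟩, rfl⟩
  obtain ⟨b, hbk, hb, x₀, v, hx₀⟩ := exists_sum_iterate_eq_one_add O (R := R) θ hfull hfix
  -- The invariants of θ, that is, the commutant of α and t together. They play the role of scalars:
  -- M is regarded as an R₀-module.
  let R₀ : Subalgebra O (End O M) := Subalgebra.centralizer O (Set.range α ∪ {(t : End O M)})
  have hmem₀ : ∀ x : End O M, x ∈ R₀ ↔ x ∈ R ∧ t * x = x * t := fun x => by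
    rw [hmem]
    simp [R₀, Subalgebra.mem_centralizer_iff, Commute, SemiconjBy, _root_.or_imp, forall_and,
      _root_.and_comm]
  have hθR₀ : ∀ x : R, θ x = x → (x : End O M) ∈ R₀ := fun x hx =>
    (hmem₀ _).2 ⟨x.2, by rw [← hθ, hx]⟩
  have hR₀θ : ∀ x (hx : x ∈ R₀), θ ⟨x, ((hmem₀ _).1 hx).1⟩ = ⟨x, ((hmem₀ _).1 hx).1⟩ := by
    intro x hx
    refine Subtype.ext ((Units.mul_left_inj t).1 ?_)
    rw [hθ]
    exact ((hmem₀ _).1 hx).2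
  have hdiv₀ : ∀ z : End O M, ℓ • z ∈ R₀ → z ∈ R₀ := by
    refine fun z hz => (hmem₀ _).2 ⟨hdiv z ((hmem₀ _).1 hz).1, ?_⟩
    have h1 := ((hmem₀ _).1 hz).2
    rw [mul_smul_comm, smul_mul_assoc, ← sub_eq_zero, ← smul_sub] at h1
    exact sub_eq_zero.1 (nsmul_eq_zero O h1)
  have hinvR₀ : ∀ u : (End O M)ˣ, (u : End O M) ∈ R₀ → ((u⁻¹ : (End O M)ˣ) : End O M) ∈ R₀ :=
    fun u hu => (hmem₀ _).2 ⟨hinvR u ((hmem₀ _).1 hu).1,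
      (Commute.units_inv_right (((hmem₀ _).1 hu).2 : Commute _ _)).eq⟩
  have hfin₀ : Module.Finite O (Subalgebra.toSubmodule R₀) := inferInstance
  have hfree₀ : Module.Free O (Subalgebra.toSubmodule R₀) := inferInstance
  let cR₀ := commRingOfComm R₀ fun x hx y hy =>
    hcomm x ((hmem₀ _).1 hx).1 y ((hmem₀ _).1 hy).1
  have : Module.Finite O R₀ := hfin₀
  have : Module.Free O R₀ := hfree₀
  have hunit₀ : ∀ f : R₀, (∀ g, f ≠ ℓ • g) → IsUnit f := fun f hne => by
    have h1 : IsUnit (f : End O M) := by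
      refine h.isUnit f 0 ((hmem f).1 ((hmem₀ _).1 f.2).1) ?_ fun g hg => ?_
      · rw [((hmem₀ _).1 f.2).2, smul_zero, add_zero]
      · exact hne ⟨g, hdiv₀ g (hg ▸ f.2)⟩ (Subtype.ext hg)
    obtain ⟨u, hu⟩ := h1
    exact ⟨⟨f, ⟨_, hinvR₀ u (hu ▸ f.2)⟩, Subtype.ext (by simp [← hu]),
      Subtype.ext (by simp [← hu])⟩, rfl⟩
  have hsm : ∀ (r : R₀) (x : M), r • x = (r : End O M) x := fun r x => rfl
  have htow : IsScalarTower O R₀ M := ⟨fun a r x => rfl⟩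
  let lin : ∀ f : End O M, (∀ r : R₀, f * (r : End O M) = r * f) → End R₀ M := fun f hf =>
    { toFun := f, map_add' := map_add f, map_smul' := fun r x => LinearMap.congr_fun (hf r) x }
  have hlin : ∀ f hf x, lin f hf x = f x := fun f hf x => rfl
  have hα₀ : ∀ g (r : R₀), α g * (r : End O M) = r * α g := fun g r =>
    (hmem r).1 ((hmem₀ _).1 r.2).1 g
  let α₀ : Representation R₀ H M :=
    { toFun := fun g => lin (α g) (hα₀ g)
      map_one' := LinearMap.ext fun x => LinearMap.congr_fun (map_one α) x
      map_mul' := fun g g' => LinearMap.ext fun x => LinearMap.congr_fun (map_mul α g g') x }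
  have ht₀ : ∀ r : R₀, (t : End O M) * (r : End O M) = r * t := fun r => ((hmem₀ _).1 r.2).2
  have htinv₀ : ∀ r : R₀, ((t⁻¹ : (End O M)ˣ) : End O M) * (r : End O M) =
      r * (t⁻¹ : (End O M)ˣ) := fun r => (Commute.units_inv_left (ht₀ r : Commute _ _)).eq
  let T : (End R₀ M)ˣ :=
    ⟨lin t ht₀, lin (t⁻¹ : (End O M)ˣ) htinv₀,
      LinearMap.ext fun x => by
        change (t : End O M) (((t⁻¹ : (End O M)ˣ) : End O M) x) = x
        rw [← Module.End.mul_apply, Units.mul_inv]; rfl,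
      LinearMap.ext fun x => by
        change ((t⁻¹ : (End O M)ˣ) : End O M) ((t : End O M) x) = x
        rw [← Module.End.mul_apply, Units.inv_mul]; rfl⟩
  have hT : ∀ (m : ℕ) x, ((T ^ m : (End R₀ M)ˣ) : End R₀ M) x = ((t : End O M) ^ m) x := fun m => by
    induction m with
    | zero => intro x; simp
    | succ m ih =>
      intro x
      rw [pow_succ, Units.val_mul, Module.End.mul_apply, ih, pow_succ, Module.End.mul_apply]; rfl
  have hTinv : ∀ (m : ℕ) x, (((T ^ m)⁻¹ : (End R₀ M)ˣ) : End R₀ M) x =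
      (((t ^ m)⁻¹ : (End O M)ˣ) : End O M) x := fun m => by
    induction m with
    | zero => intro x; simp
    | succ m ih =>
      intro x
      rw [pow_succ', mul_inv_rev, Units.val_mul, Module.End.mul_apply, pow_succ', mul_inv_rev,
        Units.val_mul, Module.End.mul_apply, ← ih]; rfl
  obtain ⟨w, hw⟩ := h.pow_eq
  have hc₀ : (t : End O M) ^ ℓ ^ k ∈ R₀ :=
    (hmem₀ _).2 ⟨hcR, by rw [← pow_succ, ← pow_succ']⟩
  have hw₀ : w ∈ R₀ := hdiv₀ w (by
    have := R₀.sub_mem hc₀ R₀.one_mem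
    rwa [hw, add_sub_cancel_left] at this)
  -- Over R₀ the operator t^(ℓ^k) is a scalar. For X commuting with α, the sum of its conjugates by
  -- powers of t is θ-invariant, hence also a scalar.
  obtain ⟨d, a', hd, hdc⟩ := exists_pow_eq_of_end_pow_eq O (R := R₀) hunit₀ hH α₀ T hbk
    (c := ⟨_, hc₀⟩) (a := ⟨w, hw₀⟩) (Subtype.ext hw)
    (LinearMap.ext fun x => by rw [hT]; rfl) (fun X hX => by
      let X' : End O M := X.restrictScalars O
      have hX' : X' ∈ R := (hmem _).2 fun g => LinearMap.ext fun x =>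
        (LinearMap.congr_fun (hX g).eq x).symm
      have hsum : θ (∑ i ∈ Finset.range (ℓ ^ b), θ^[i] ⟨X', hX'⟩) =
          ∑ i ∈ Finset.range (ℓ ^ b), θ^[i] ⟨X', hX'⟩ := by
        rw [map_sum]
        simp only [← Function.iterate_succ_apply' θ]
        have h1 := Finset.sum_range_succ (fun i => θ^[i] ⟨X', hX'⟩) (ℓ ^ b)
        rw [Finset.sum_range_succ', hb] at h1
        simpa using h1
      refine ⟨⟨_, hθR₀ _ hsum⟩, LinearMap.ext fun x => ?_⟩
      rw [LinearMap.smul_apply, hsm, Module.End.one_apply, LinearMap.sum_apply,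
        AddSubmonoidClass.coe_finsetSum, LinearMap.sum_apply]
      refine Finset.sum_congr rfl fun i _ => ?_
      rw [Module.End.mul_apply, Module.End.mul_apply, hT, hTinv]
      change ((t : End O M) ^ i * X' * (((t ^ i)⁻¹ : (End O M)ˣ) : End O M)) x = _
      rw [← hiter i ⟨X', hX'⟩, mul_assoc, ← Units.val_pow_eq_pow_val, Units.mul_inv, mul_one])
  have hd' : (d : End O M) = 1 + ℓ • (a' : End O M) := congrArg Subtype.val hd
  have hdc' : (d : End O M) ^ ℓ ^ (k - b) = (t : End O M) ^ ℓ ^ k := congrArg Subtype.val hdc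
  obtain ⟨D, hD⟩ := isUnit_one_add_nsmul O (a' : End O M)
  rw [← hd'] at hD
  obtain ⟨a, ha⟩ := exists_inv_eq_one_add_nsmul (z := D) (hD.trans hd')
  have hDR₀ : ((D⁻¹ : (End O M)ˣ) : End O M) ∈ R₀ := hinvR₀ D (hD ▸ d.2)
  have haR₀ : a ∈ R₀ := hdiv₀ a (by
    have := R₀.sub_mem hDR₀ R₀.one_mem
    rwa [ha, add_sub_cancel_left] at this)
  -- Choose r of norm d⁻¹. Then (r t)^(ℓ^k) = N(r)^(ℓ^(k - b)) t^(ℓ^k) = d^(-ℓ^(k - b)) t^(ℓ^k) = 1.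
  obtain ⟨y, hy⟩ := exists_prod_iterate_eq O (R := R) θ hb hx₀ (a := ⟨a, ((hmem₀ _).1 haR₀).1⟩)
    (hR₀θ a haR₀)
  set r : R := 1 + ℓ • y with hr
  obtain ⟨z, hz⟩ := isUnit_one_add_nsmul O (y : End O M)
  have hzr : (z : End O M) = r := hz
  have hprod : ∀ m, ((z * t : (End O M)ˣ) : End O M) ^ m =
      ((∏ i ∈ Finset.range m, θ^[i] r : R) : End O M) * (t : End O M) ^ m := fun m => by
    induction m with
    | zero => simp
    | succ m ih =>
      rw [pow_succ, ih, Units.val_mul, hzr, mul_assoc, ← mul_assoc _ (r : End O M), ← hiter,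
        Finset.prod_range_succ, pow_succ, mul_assoc, ← mul_assoc]
      rfl
  have hper : ∀ (j : ℕ), ∏ i ∈ Finset.range (ℓ ^ b * j), θ^[i] r =
      (∏ i ∈ Finset.range (ℓ ^ b), θ^[i] r) ^ j := fun j => by
    induction j with
    | zero => simp
    | succ j ih =>
      rw [Nat.mul_succ, Finset.prod_range_add, ih, pow_succ]
      refine congrArg _ (Finset.prod_congr rfl fun i _ => ?_)
      rw [add_comm, Function.iterate_add_apply, Function.iterate_mul]
      congr 1
      exact Function.iterate_fixed (hb r) j
  have hDr : ((∏ i ∈ Finset.range (ℓ ^ b), θ^[i] r : R) : End O M) = (D⁻¹ : (End O M)ˣ) := by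
    rw [hy, ha]; rfl
  refine ⟨z, y, hz, fun g => hzr ▸ (hmem _).1 r.2 g, Units.ext ?_⟩
  rw [Units.val_pow_eq_pow_val, hprod]
  have hk : ℓ ^ k = ℓ ^ b * ℓ ^ (k - b) := by rw [← pow_add, Nat.add_sub_cancel' hbk]
  rw [← hdc']
  nth_rewrite 1 [hk]
  rw [hper, SubmonoidClass.coe_pow, hDr, ← hD, ← Units.val_pow_eq_pow_val,
    ← Units.val_pow_eq_pow_val, ← Units.val_mul, inv_pow, inv_mul_cancel]

end IsNormalizingLift

end Correction

end AbsolutelyUnramified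

/-! ### Symplectic forms and inverse adjoints. -/

/-- A perfect alternating bilinear form. -/
structure IsSymplecticForm {R M : Type*} [CommRing R] [AddCommGroup M] [Module R M]
    (b : M →ₗ[R] M →ₗ[R] R) : Prop where
  self_eq_zero : ∀ x, b x x = 0
  bijective : Function.Bijective b

namespace IsSymplecticForm

variable {R M : Type*} [CommRing R] [AddCommGroup M] [Module R M] {b : M →ₗ[R] M →ₗ[R] R}

theorem neg (hb : IsSymplecticForm b) (x y : M) : - b x y = b y x :=
  LinearMap.IsAlt.neg hb.self_eq_zero x y

theorem eq_zero_of_left (hb : IsSymplecticForm b) {x : M} (h : ∀ y, b x y = 0) : x = 0 :=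
  (map_eq_zero_iff b hb.bijective.1).1 (LinearMap.ext h)

theorem eq_zero_of_right (hb : IsSymplecticForm b) {x : M} (h : ∀ y, b y x = 0) : x = 0 :=
  hb.eq_zero_of_left fun y => by rw [← hb.neg, h, neg_zero]

theorem exists_eq (hb : IsSymplecticForm b) (f : M →ₗ[R] R) : ∃ x, ∀ y, b x y = f y := by
  obtain ⟨x, hx⟩ := hb.bijective.2 f
  exact ⟨x, fun y => by rw [hx]⟩

/-- The inverse adjoint of an automorphism. -/
theorem exists_adjoint (hb : IsSymplecticForm b) :
    ∃ D : (End R M)ˣ →* (End R M)ˣ,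
      ∀ x v w, b ((D x : End R M) v) ((x : End R M) w) = b v w := by
  have h1 : ∀ x : (End R M)ˣ, ∃ y : End R M, ∀ v w, b (y v) ((x : End R M) w) = b v w := fun x => by
    let e := LinearEquiv.ofBijective b hb.bijective
    refine ⟨e.symm.toLinearMap ∘ₗ LinearMap.lcomp R R ((x⁻¹ : (End R M)ˣ) : End R M) ∘ₗ
      e.toLinearMap, fun v w => ?_⟩
    have h2 : ∀ f, b (e.symm f) = f := fun f => e.apply_symm_apply f
    simp only [LinearMap.comp_apply, LinearEquiv.coe_coe]
    rw [h2, LinearMap.lcomp_apply, ← Module.End.mul_apply, Units.inv_mul]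
    rfl
  have huniq : ∀ (x : (End R M)ˣ) (y y' : End R M), (∀ v w, b (y v) ((x : End R M) w) = b v w) →
      (∀ v w, b (y' v) ((x : End R M) w) = b v w) → y = y' := fun x y y' hy hy' => by
    refine LinearMap.ext fun v => hb.bijective.1 (LinearMap.ext fun w => ?_)
    have : w = (x : End R M) (((x⁻¹ : (End R M)ˣ) : End R M) w) := by
      rw [← Module.End.mul_apply, Units.mul_inv]; rfl
    rw [this, hy, hy']
  choose D hD using h1
  have hone : D 1 = 1 := huniq 1 _ _ (hD 1) fun v w => rfl
  have hmul : ∀ x y, D (x * y) = D x * D y := fun x y => huniq _ _ _ (hD _) fun v w => by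
    rw [Units.val_mul, Module.End.mul_apply, Module.End.mul_apply, hD, hD]
  exact ⟨MonoidHom.toHomUnits ⟨⟨D, hone⟩, hmul⟩, hD⟩

theorem adjoint_unique (hb : IsSymplecticForm b) {x y y' : (End R M)ˣ}
    (hy : ∀ v w, b ((y : End R M) v) ((x : End R M) w) = b v w)
    (hy' : ∀ v w, b ((y' : End R M) v) ((x : End R M) w) = b v w) : y = y' := by
  refine Units.ext (LinearMap.ext fun v => hb.bijective.1 (LinearMap.ext fun w => ?_))
  have : w = (x : End R M) (((x⁻¹ : (End R M)ˣ) : End R M) w) := by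
    rw [← Module.End.mul_apply, Units.mul_inv]; rfl
  rw [this, hy, hy']

end IsSymplecticForm

/-- Multiplicativity of the norm `x ↦ (x t) ^ n t ^ (- n)` on a commutative subgroup normalized
by `t`. -/
theorem mul_pow_mul_inv_pow {G : Type*} [Group G] (C : Subgroup G) (t : G)
    (hC : ∀ x ∈ C, ∀ y ∈ C, x * y = y * x) (ht : ∀ x ∈ C, t * x * t⁻¹ ∈ C) (n : ℕ) :
    (∀ x ∈ C, (x * t) ^ n * (t ^ n)⁻¹ ∈ C) ∧ ∀ x ∈ C, ∀ y ∈ C,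
      (x * y * t) ^ n * (t ^ n)⁻¹ = ((x * t) ^ n * (t ^ n)⁻¹) * ((y * t) ^ n * (t ^ n)⁻¹) := by
  have hstep : ∀ n (x : G), (x * t) ^ (n + 1) * (t ^ (n + 1))⁻¹ =
      x * (t * ((x * t) ^ n * (t ^ n)⁻¹) * t⁻¹) := fun n x => by
    rw [pow_succ', pow_succ t]; group
  induction n with
  | zero => simp
  | succ n ih =>
    refine ⟨fun x hx => ?_, fun x hx y hy => ?_⟩
    · rw [hstep]
      exact C.mul_mem hx (ht _ (ih.1 x hx))
    · rw [hstep, hstep, hstep, ih.2 x hx y hy]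
      have h1 := hC _ (ht _ (ih.1 x hx)) y hy
      generalize (x * t) ^ n * (t ^ n)⁻¹ = X at *
      generalize (y * t) ^ n * (t ^ n)⁻¹ = Y at *
      calc _ = x * (y * (t * X * t⁻¹)) * (t * Y * t⁻¹) := by group
        _ = _ := by rw [← h1]; group

/-! ### Making the corrected operator symplectic. -/

namespace AbsolutelyUnramified

variable {ℓ : ℕ} {O : Type*} [CommRing O] [IsDomain O] [IsDiscreteValuationRing O]
  [hO : AbsolutelyUnramified ℓ O] {M : Type*} [AddCommGroup M] [Module O M]

theorem exists_eq_nsmul_of_form [Module.Free O M] {b : M →ₗ[O] M →ₗ[O] O} (hb : IsSymplecticForm b)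
    (f : End O M) (h : ∀ v w, ∃ a, b (f v) w = ℓ • a) : ∃ g, f = ℓ • g := by
  refine exists_linearMap_eq_nsmul f fun v => ?_
  obtain ⟨g, hg⟩ := exists_linearMap_eq_nsmul (b (f v)) (h v)
  obtain ⟨y, hy⟩ := hb.exists_eq g
  refine ⟨y, hb.bijective.1 (LinearMap.ext fun w => ?_)⟩
  rw [map_nsmul, hg, LinearMap.smul_apply, LinearMap.smul_apply, hy]

theorem exists_mul_eq_one_add_nsmul {A : Type*} [Ring A] {n : ℕ} {x y : A}
    (hx : ∃ w, x = 1 + n • w) (hy : ∃ w, y = 1 + n • w) : ∃ w, x * y = 1 + n • w := by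
  obtain ⟨w, rfl⟩ := hx
  obtain ⟨w', rfl⟩ := hy
  exact ⟨w + w' + w * (n • w'), by simp only [nsmul_eq_mul]; noncomm_ring⟩

namespace IsNormalizingLift

variable {H : Type*} [Group H] {α : Representation O H M} {ψ : MulAut H} {t : (End O M)ˣ} {k : ℕ}

omit [IsDomain O] [IsDiscreteValuationRing O] hO in
theorem exists_pow_eq_add {A : Type*} [Ring A] {n : ℕ} {x y : A}
    (hx : ∃ w, x = y + n • w) (m : ℕ) : ∃ w, x ^ m = y ^ m + n • w := by
  obtain ⟨w, rfl⟩ := hx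
  induction m with
  | zero => exact ⟨0, by simp⟩
  | succ m ih =>
    obtain ⟨v, hv⟩ := ih
    refine ⟨y ^ m * w + v * y + v * (n • w), ?_⟩
    rw [pow_succ, hv, pow_succ]
    simp only [nsmul_eq_mul, mul_add, add_mul, ← (Nat.cast_commute n (y ^ m)).left_comm]
    noncomm_ring

omit [IsDomain O] [IsDiscreteValuationRing O] hO in
theorem congr (h : IsNormalizingLift α t ℓ ψ k) {y : (End O M)ˣ}
    (hy : ∃ w, (y : End O M) = 1 + ℓ • w) (hyα : ∀ g, Commute (α g) y) :
    IsNormalizingLift α (t * y) ℓ ψ k := by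
  obtain ⟨w, hw⟩ := hy
  have ht : ((t * y : (End O M)ˣ) : End O M) = t + ℓ • (t * w) := by
    rw [Units.val_mul, hw, mul_add, mul_one, mul_smul_comm]
  refine ⟨fun g => ?_, h.aut_pow, ?_, fun f z hf hfz hne => ?_⟩
  · rw [Units.val_mul, mul_assoc, ← (hyα g).eq, ← mul_assoc, h.conj, mul_assoc]
  · obtain ⟨v, hv⟩ := exists_pow_eq_add ⟨_, ht⟩ (ℓ ^ k)
    obtain ⟨v', hv'⟩ := h.pow_eq
    exact ⟨v' + v, by rw [hv, hv', smul_add, add_assoc]⟩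
  · refine h.isUnit f (z + t * w * f - f * (t * w)) hf ?_ hne
    rw [ht, mul_add, add_mul, mul_smul_comm, smul_mul_assoc] at hfz
    rw [smul_sub, smul_add, add_sub_assoc', add_comm (ℓ • z), ← add_assoc, ← hfz]
    abel

variable [Module.Finite O M] [Module.Free O M] [Nontrivial M]

theorem exists_sq_eq (h : IsNormalizingLift α t ℓ ψ k) {u : (End O M)ˣ}
    (hu : ∃ w, (u : End O M) = 1 + ℓ • w) (huα : ∀ g, Commute (α g) u) :
    ∃ y : (End O M)ˣ, (∃ w, (y : End O M) = 1 + ℓ • w) ∧ (∀ g, Commute (α g) y) ∧ y * y = u := by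
  let R := Subalgebra.centralizer O (Set.range α)
  have hmem : ∀ x : End O M, x ∈ R ↔ ∀ h, Commute (α h) x := fun x => by
    simp [R, Subalgebra.mem_centralizer_iff, Commute, SemiconjBy]
  have hfin : Module.Finite O (Subalgebra.toSubmodule R) := inferInstance
  have hfree : Module.Free O (Subalgebra.toSubmodule R) := inferInstance
  let cR := commRingOfComm R fun x hx y hy => h.mul_comm ((hmem x).1 hx) ((hmem y).1 hy)
  have : Module.Finite O R := hfin
  have : Module.Free O R := hfree
  obtain ⟨w, hw⟩ := hu
  have hwR : w ∈ R := (hmem _).2 fun g => by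
    have h1 := (huα g).eq
    rw [hw, mul_add, add_mul, mul_one, one_mul, add_right_inj, mul_smul_comm, smul_mul_assoc,
      ← sub_eq_zero, ← smul_sub] at h1
    exact sub_eq_zero.1 (nsmul_eq_zero O h1)
  obtain ⟨y, hy⟩ := exists_sq_eq_one_add_nsmul O (R := R) ⟨w, hwR⟩
  obtain ⟨Y, hY⟩ := isUnit_one_add_nsmul O (y : End O M)
  refine ⟨Y, ⟨y, hY⟩, fun g => ?_, Units.ext ?_⟩
  · rw [hY]
    exact (hmem _).1 (R.add_mem R.one_mem (R.nsmul_mem y.2 ℓ)) g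
  · rw [Units.val_mul, hw, hY, ← pow_two]
    exact congrArg Subtype.val hy

variable [Finite H] (hH : ¬ ℓ ∣ Nat.card H)
include hH

/-- A normalizing operator that preserves a symplectic form modulo `ℓ` is congruent to
one of finite order that preserves the form. -/
theorem exists_symplectic (h : IsNormalizingLift α t ℓ ψ k) {b : M →ₗ[O] M →ₗ[O] O}
    (hb : IsSymplecticForm b) (hbα : ∀ g v w, b (α g v) (α g w) = b v w)
    (hbt : ∀ v w, ∃ a, b ((t : End O M) v) ((t : End O M) w) = b v w + ℓ • a) :
    ∃ u : (End O M)ˣ, (∃ w, (u : End O M) = t + ℓ • w) ∧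
      (∀ g, (u : End O M) * α g = α (ψ g) * u) ∧ u ^ ℓ ^ k = 1 ∧
      ∀ v w, b ((u : End O M) v) ((u : End O M) w) = b v w := by
  obtain ⟨D, hD⟩ := hb.exists_adjoint
  have hDD : ∀ x, D (D x) = x := fun x => hb.adjoint_unique (hD _) fun v w => by
    rw [← hb.neg, hD, hb.neg]
  have hDsurj : ∀ (x : (End O M)ˣ) (w : M), ∃ w', (x : End O M) w' = w := fun x w =>
    ⟨((x⁻¹ : (End O M)ˣ) : End O M) w, by rw [← Module.End.mul_apply, Units.mul_inv]; rfl⟩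
  let αu : H →* (End O M)ˣ := α.toHomUnits
  have hαu : ∀ g, (αu g : End O M) = α g := fun g => rfl
  have hDα : ∀ g, D (αu g) = αu g := fun g => hb.adjoint_unique (hD _) fun v w => hbα g v w
  let C : Subgroup (End O M)ˣ := Subgroup.centralizer (Set.range αu)
  have hC : ∀ x : (End O M)ˣ, x ∈ C ↔ ∀ g, Commute (α g) x := fun x => by
    simp only [C, Subgroup.mem_centralizer_iff, Set.forall_mem_range, Commute, SemiconjBy, ← hαu,
      ← Units.val_mul, Units.ext_iff]
  have hC' : ∀ x ∈ C, ∀ g, αu g * x = x * αu g := fun x hx g =>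
    (Subgroup.mem_centralizer_iff.1 hx) _ ⟨g, rfl⟩
  have hCD : ∀ x ∈ C, D x ∈ C := fun x hx => by
    refine Subgroup.mem_centralizer_iff.2 ?_
    rintro _ ⟨g, rfl⟩
    rw [← hDα, ← map_mul, hC' x hx, map_mul]
  have hcomm : ∀ x ∈ C, ∀ y ∈ C, x * y = y * x := fun x hx y hy =>
    Units.ext (h.mul_comm ((hC x).1 hx) ((hC y).1 hy))
  let U : (End O M)ˣ → Prop := fun x => ∃ w, (x : End O M) = 1 + ℓ • w
  have hUone : ∀ x, U x → x * x = 1 → x = 1 := by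
    rintro x ⟨w, hw⟩ hx
    refine Units.ext (eq_one_of_pow_eq_one O hw two_ne_zero ?_)
    rw [pow_two, ← Units.val_mul, hx]; rfl
  have hUmul : ∀ x y, U x → U y → U (x * y) := fun x y hx hy =>
    exists_mul_eq_one_add_nsmul hx hy
  have hUinv : ∀ x, U x → U x⁻¹ := by
    rintro x ⟨w, hw⟩
    exact exists_inv_eq_one_add_nsmul hw
  have hcong : ∀ x : (End O M)ˣ, (∀ v w, ∃ a, b ((x : End O M) v) ((x : End O M) w) =
      b v w + ℓ • a) → ∃ g, (D x : End O M) = x + ℓ • g := fun x hx => by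
    obtain ⟨g, hg⟩ := exists_eq_nsmul_of_form hb ((D x : End O M) - x) fun v w => by
      obtain ⟨w, rfl⟩ := hDsurj x w
      obtain ⟨a, ha⟩ := hx v w
      exact ⟨-a, by rw [LinearMap.sub_apply, map_sub, LinearMap.sub_apply, hD, ha, smul_neg]; ring⟩
    exact ⟨g, by rw [← hg]; abel⟩
  have hUD : ∀ x, U x → U (D x) := by
    rintro x ⟨w, hw⟩
    obtain ⟨g, hg⟩ := hcong x fun v v' => by
      refine ⟨b v (w v') + b (w v) v' + ℓ • b (w v) (w v'), ?_⟩
      simp only [hw, LinearMap.add_apply, Module.End.one_apply, LinearMap.smul_apply, map_add,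
        map_nsmul, smul_add]
      abel
    exact ⟨w + g, by rw [hg, hw, smul_add, add_assoc]⟩
  -- make the operator symplectic
  obtain ⟨g, hg⟩ := hcong t hbt
  have hUu : U (t⁻¹ * D t) := ⟨(t⁻¹ : (End O M)ˣ) * g, by
    rw [Units.val_mul, hg, mul_add, Units.inv_mul, mul_smul_comm]⟩
  have htconj : ∀ g, t * αu g = αu (ψ g) * t := fun g => Units.ext (h.conj g)
  have huC : t⁻¹ * D t ∈ C := by
    refine Subgroup.mem_centralizer_iff.2 ?_
    rintro _ ⟨g, rfl⟩
    have h1 : D t * αu g = αu (ψ g) * D t := by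
      rw [← hDα, ← map_mul, htconj, map_mul, hDα]
    rw [mul_assoc, h1, ← mul_assoc, ← mul_assoc]
    congr 1
    rw [eq_inv_mul_iff_mul_eq, ← mul_assoc, htconj, mul_inv_cancel_right]
  -- With y² = t⁻¹ D(t), the map D inverts y: the square of y D(y) is 1 and y D(y) is congruent to
  -- 1. Hence D(ty) = D(t) y⁻¹ = ty, so ty preserves the form.
  obtain ⟨y, hyU, hyC, hyu⟩ := h.exists_sq_eq hUu ((hC _).1 huC)
  replace hyC := (hC y).2 hyC
  have hyD : y * D y = 1 := by
    refine hUone _ (hUmul _ _ hyU (hUD _ hyU)) ?_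
    have h1 : D y * D y = (t⁻¹ * D t)⁻¹ := by
      rw [← map_mul, hyu, map_mul, hDD, map_inv, mul_inv_rev, inv_inv]
    calc y * D y * (y * D y) = y * (D y * y) * D y := by group
      _ = y * y * (D y * D y) := by rw [hcomm _ (hCD y hyC) _ hyC]; group
      _ = 1 := by rw [hyu, h1, mul_inv_cancel]
  have hDt : D (t * y) = t * y := by
    rw [map_mul, eq_comm, ← mul_inv_eq_iff_eq_mul, ← eq_inv_of_mul_eq_one_left hyD, mul_assoc, hyu,
      mul_inv_cancel_left]
  have h₂ := h.congr hyU ((hC y).1 hyC)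
  set s : (End O M)ˣ := t * y with hs
  have hst : ∃ w, (s : End O M) = t + ℓ • w := by
    obtain ⟨w, hw⟩ := hyU
    exact ⟨t * w, by rw [hs, Units.val_mul, hw, mul_add, mul_one, mul_smul_comm]⟩
  -- make it of finite order
  obtain ⟨z, w, hzw, hzα, hz⟩ := h₂.exists_pow_eq_one hH
  have hzC : z ∈ C := (hC z).2 hzα
  have hzU : U z := ⟨w, hzw⟩
  have hz' : (D z * s) ^ ℓ ^ k = 1 := by rw [← hDt, ← map_mul, ← map_pow, hz, map_one]
  -- Both z and D(z) correct s to finite order. Their geometric mean y₂ does so too and is moreover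
  -- fixed by D.
  obtain ⟨y₂, hy₂U, hy₂C, hy₂⟩ := h₂.exists_sq_eq (hUmul _ _ hzU (hUD _ hzU))
    ((hC _).1 (C.mul_mem hzC (hCD z hzC)))
  replace hy₂C := (hC y₂).2 hy₂C
  have hDy₂ : D y₂ = y₂ := by
    have h1 : D y₂ * D y₂ = y₂ * y₂ := by
      rw [← map_mul, hy₂, map_mul, hDD, hcomm _ (hCD z hzC) _ hzC]
    have h2 : y₂⁻¹ * D y₂ = 1 := by
      refine hUone _ (hUmul _ _ (hUinv _ hy₂U) (hUD _ hy₂U)) ?_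
      calc y₂⁻¹ * D y₂ * (y₂⁻¹ * D y₂) = y₂⁻¹ * (D y₂ * y₂⁻¹) * D y₂ := by group
        _ = y₂⁻¹ * y₂⁻¹ * (D y₂ * D y₂) := by
          rw [hcomm _ (hCD y₂ hy₂C) _ (C.inv_mem hy₂C)]; group
        _ = 1 := by rw [h1]; group
    exact (inv_mul_eq_one.1 h2).symm
  have hsconj : ∀ g, s * αu g = αu (ψ g) * s := fun g => Units.ext (h₂.conj g)
  have hCs : ∀ x ∈ C, s * x * s⁻¹ ∈ C := fun x hx => by
    refine Subgroup.mem_centralizer_iff.2 ?_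
    rintro _ ⟨g, rfl⟩
    obtain ⟨g, rfl⟩ := ψ.surjective g
    have h1 : αu (ψ g) = s * αu g * s⁻¹ := by rw [hsconj, mul_inv_cancel_right]
    rw [h1]
    calc s * αu g * s⁻¹ * (s * x * s⁻¹) = s * (αu g * x) * s⁻¹ := by group
      _ = _ := by rw [hC' x hx]; group
  have hsn : s ^ ℓ ^ k ∈ C := (hC _).2 fun g => by
    rw [Units.val_pow_eq_pow_val]; exact h₂.pow_mul g
  obtain ⟨hN1, hN2⟩ := mul_pow_mul_inv_pow C s hcomm hCs (ℓ ^ k)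
  -- For the multiplicative norm N(x) = (xs)^q s^(-q) with q = ℓ^k, N(y₂)² = N(z) N(D z) = s^(-2q).
  -- So (y₂ s)^q has square 1, and being congruent to 1 it is 1.
  have hpow : (y₂ * s) ^ ℓ ^ k = 1 := by
    refine hUone _ ?_ ?_
    · have h1 : ∃ w, ((y₂ * s : (End O M)ˣ) : End O M) = s + ℓ • w := by
        obtain ⟨w, hw⟩ := hy₂U
        exact ⟨w * s, by rw [Units.val_mul, hw, add_mul, one_mul, smul_mul_assoc]⟩
      obtain ⟨v, hv⟩ := exists_pow_eq_add h1 (ℓ ^ k)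
      obtain ⟨v', hv'⟩ := h₂.pow_eq
      exact ⟨v' + v, by rw [Units.val_pow_eq_pow_val, hv, hv', smul_add, add_assoc]⟩
    · have h1 := hN2 y₂ hy₂C y₂ hy₂C
      rw [hy₂, hN2 z hzC _ (hCD z hzC), hz, hz', one_mul] at h1
      set P := (y₂ * s) ^ ℓ ^ k
      set Q := s ^ ℓ ^ k
      have hP : P * Q⁻¹ ∈ C := hN1 y₂ hy₂C
      have hcPQ : Q⁻¹ * (P * Q⁻¹) = (P * Q⁻¹) * Q⁻¹ := hcomm _ (C.inv_mem hsn) _ hP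
      have h2 : Q⁻¹ * Q⁻¹ = P * (P * Q⁻¹ * Q⁻¹) := by rw [h1, ← hcPQ]; group
      rw [mul_assoc, ← mul_assoc P P, right_eq_mul] at h2
      exact h2
  have hDu : D (y₂ * s) = y₂ * s := by rw [map_mul, hDy₂, hDt]
  refine ⟨y₂ * s, ?_, fun g => ?_, hpow, fun v w => ?_⟩
  · obtain ⟨w, hw⟩ := hy₂U
    obtain ⟨w', hw'⟩ := hst
    exact ⟨w' + w * s, by
      rw [Units.val_mul, hw, add_mul, one_mul, smul_mul_assoc, smul_add, ← add_assoc, ← hw']⟩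
  · rw [Units.val_mul, mul_assoc, h₂.conj, ← mul_assoc, ← ((hC y₂).1 hy₂C _).eq, mul_assoc]
  · nth_rewrite 1 [← hDu]
    exact hD _ v w

end IsNormalizingLift

end AbsolutelyUnramified

/-! ### Extensions of cyclic ℓ-groups, and lifting their simple modular representations. -/

/-- `G` is the semidirect product of the normal subgroup `H` of order prime to `ℓ` and the
subgroup generated by `t`, of order `ℓ ^ k`. -/
structure IsCyclicExtension {G : Type*} [Group G] (ℓ k : ℕ) (H : Subgroup G) (t : G) : Prop where
  normal : H.Normal
  not_dvd : ¬ ℓ ∣ Nat.card H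
  isComplement : H.IsComplement' (Subgroup.zpowers t)
  orderOf_eq : orderOf t = ℓ ^ k

theorem IsCyclicExtension.exists_hom {G : Type*} [Group G] [Finite G] {ℓ k : ℕ} {H : Subgroup G}
    [H.Normal] {t : G} (hG : IsCyclicExtension ℓ k H t) {A : Type*} [Monoid A] (φ : H →* A) (u : Aˣ)
    (hu : u ^ ℓ ^ k = 1) (hφ : ∀ h, (u : A) * φ h = φ (MulAut.conjNormal t h) * u) :
    ∃ ρ : G →* A, (∀ h : H, ρ h = φ h) ∧ ρ t = u := by
  let φu : H →* Aˣ := φ.toHomUnits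
  have hφu : ∀ h, u * φu h = φu (MulAut.conjNormal t h) * u := fun h => Units.ext (hφ h)
  let F : Subgroup.zpowers t →* Aˣ := monoidHomOfForallMemZpowers
    (g := (⟨t, Subgroup.mem_zpowers t⟩ : Subgroup.zpowers t)) (g' := u) (by
      rintro ⟨x, n, rfl⟩
      exact ⟨n, Subtype.ext (by simp)⟩) (by
      rw [Subgroup.orderOf_mk, hG.orderOf_eq]
      exact orderOf_dvd_of_pow_eq_one hu)
  have hF : F ⟨t, Subgroup.mem_zpowers t⟩ = u := monoidHomOfForallMemZpowers_apply_gen _ _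
  have hpow : ∀ (n : ℕ) h, u ^ n * φu h = φu (MulAut.conjNormal (t ^ n) h) * u ^ n := fun n => by
    induction n with
    | zero => intro h; simp
    | succ n ih =>
      intro h
      rw [pow_succ, mul_assoc, hφu, ← mul_assoc, ih, pow_succ, map_mul, mul_assoc]; rfl
  let Ψ := SemidirectProduct.lift
    (φ := (H.normalizerMonoidHom).comp (Subgroup.inclusion
      (H.normalizer_eq_top ▸ le_top : Subgroup.zpowers t ≤ _))) φu F (by
    rintro ⟨g, hg⟩
    obtain ⟨n, rfl⟩ := (isOfFinOrder_of_finite t).mem_powers_iff_mem_zpowers.2 hg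
    have hFn : F ⟨t ^ n, hg⟩ = u ^ n := by
      rw [← hF, ← map_pow]
      congr 1
    ext h : 1
    have h1 := hpow n h
    change φu _ = F ⟨t ^ n, hg⟩ * φu h * (F ⟨t ^ n, hg⟩)⁻¹
    rw [hFn, h1, mul_inv_cancel_right]
    congr 1)
  let e := SemidirectProduct.mulEquivSubgroup hG.isComplement
  have e1 : ∀ h : H, e.symm h = SemidirectProduct.inl h := fun h => by
    rw [MulEquiv.symm_apply_eq]
    simp [e, SemidirectProduct.mulEquivSubgroup_apply]
  have e2 : e.symm t = SemidirectProduct.inr ⟨t, Subgroup.mem_zpowers t⟩ := by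
    rw [MulEquiv.symm_apply_eq]
    simp [e, SemidirectProduct.mulEquivSubgroup_apply]
  refine ⟨(Units.coeHom A).comp (Ψ.comp e.symm.toMonoidHom), fun h => ?_, ?_⟩
  · change ((Ψ (e.symm h) : Aˣ) : A) = φ h
    rw [e1, SemidirectProduct.lift_inl]; rfl
  · change ((Ψ (e.symm t) : Aˣ) : A) = u
    rw [e2, SemidirectProduct.lift_inr, hF]

theorem IsCyclicExtension.exists_eq_mul {G : Type*} [Group G] [Finite G] {ℓ k : ℕ} {H : Subgroup G}
    {t : G} (hG : IsCyclicExtension ℓ k H t) (g : G) : ∃ (h : H) (n : ℕ), g = h * t ^ n := by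
  obtain ⟨⟨h, ⟨x, hx⟩⟩, rfl⟩ := hG.isComplement.2 g
  obtain ⟨n, rfl⟩ := (isOfFinOrder_of_finite t).mem_powers_iff_mem_zpowers.2 hx
  exact ⟨h, n, rfl⟩

/-- A submodule stable under the group. -/
def Representation.IsStable {R G M : Type*} [CommRing R] [Monoid G] [AddCommGroup M] [Module R M]
    (ρ : Representation R G M) (N : Submodule R M) : Prop :=
  ∀ g, N ≤ N.comap (ρ g)

/-- A nonzero representation without proper nonzero stable submodules. -/
structure Representation.IsSimple {R G M : Type*} [CommRing R] [Monoid G] [AddCommGroup M]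
    [Module R M] (ρ : Representation R G M) : Prop where
  nontrivial : Nontrivial M
  eq_bot_or_eq_top : ∀ N, ρ.IsStable N → N = ⊥ ∨ N = ⊤

namespace AbsolutelyUnramified

variable {ℓ : ℕ} {O : Type*} [CommRing O] [IsDomain O] [IsDiscreteValuationRing O]
  [hO : AbsolutelyUnramified ℓ O]

theorem IsReduction.map_eq_zero_iff {M Q : Type*} [AddCommGroup M] [Module O M] [AddCommGroup Q]
    [Module O Q] [Module (ResidueField O) Q] [IsScalarTower O (ResidueField O) Q] {π : M →ₗ[O] Q}
    (hπ : IsReduction ℓ π) (x : M) : π x = 0 ↔ ∃ y, x = ℓ • y :=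
  ⟨hπ.exists_nsmul x, fun ⟨y, hy⟩ => by rw [hy, map_nsmul, nsmul_residue_eq_zero O]⟩

section Map

variable {M M' Q Q' : Type*} [AddCommGroup M] [Module O M] [AddCommGroup M'] [Module O M']
  [AddCommGroup Q] [Module O Q] [Module (ResidueField O) Q] [IsScalarTower O (ResidueField O) Q]
  [AddCommGroup Q'] [Module O Q'] [Module (ResidueField O) Q']
  [IsScalarTower O (ResidueField O) Q'] {π : M →ₗ[O] Q}

theorem IsReduction.exists_map (hπ : IsReduction ℓ π) (f : M →ₗ[O] Q') :
    ∃ f' : Q →ₗ[ResidueField O] Q', ∀ x, f' (π x) = f x := by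
  choose s hs using hπ.surjective
  have hker : ∀ x y, π x = π y → f x = f y := fun x y hxy => by
    obtain ⟨z, hz⟩ := hπ.exists_nsmul (x - y) (by rw [map_sub, hxy, sub_self])
    rw [← sub_eq_zero, ← map_sub, hz, map_nsmul, nsmul_residue_eq_zero O]
  refine ⟨{ toFun := fun q => f (s q), map_add' := fun p q => ?_, map_smul' := fun a q => ?_ },
    fun x => hker _ _ (hs _)⟩
  · rw [← map_add]
    exact hker _ _ (by rw [hs, map_add, hs, hs])
  · obtain ⟨a, rfl⟩ := residue_surjective a
    rw [RingHom.id_apply, residue_smul, residue_smul, ← map_smul]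
    exact hker _ _ (by rw [hs, map_smul, hs])

/-- Injective modulo ℓ is surjective modulo ℓ by dimension, then surjective by Nakayama, then
bijective. -/
theorem isUnit_of_injective_mod [Module.Finite O M] [Module.Free O M] (hπ : IsReduction ℓ π)
    {f : End O M} {f' : End (ResidueField O) Q} (hf : ∀ x, f' (π x) = π (f x))
    (hinj : Function.Injective f') : IsUnit f := by
  have := hπ.finite
  have hsurj : Function.Surjective f' := LinearMap.injective_iff_surjective.1 hinj
  have h1 : LinearMap.range f = ⊤ := by
    refine eq_top_of_forall_exists_add_nsmul _ fun x => ?_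
    obtain ⟨q, hq⟩ := hsurj (π x)
    obtain ⟨y, rfl⟩ := hπ.surjective q
    obtain ⟨z, hz⟩ := hπ.exists_nsmul (x - f y) (by rw [map_sub, ← hf, hq, sub_self])
    exact ⟨f y, ⟨y, rfl⟩, z, by rw [← hz]; abel⟩
  exact (Module.End.isUnit_iff f).2
    (OrzechProperty.bijective_of_surjective_endomorphism f (LinearMap.range_eq_top.1 h1))

end Map

section Lift

variable {G : Type*} [Group G] [Finite G] {k : ℕ} {H : Subgroup G} [H.Normal] {t : G}
  (hG : IsCyclicExtension ℓ k H t)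
  {Q : Type*} [AddCommGroup Q] [Module O Q] [Module (ResidueField O) Q]
  [IsScalarTower O (ResidueField O) Q] {σ : Representation (ResidueField O) G Q}

include hG

/-- σ t is equivariant up to conjugation by t, so it lifts by averaging over H. The irreducibility
condition is Schur's lemma: an operator commuting with α and, modulo ℓ, with u induces an
endomorphism of the simple σ, which is zero or injective. -/
theorem exists_isNormalizingLift (hσ : σ.IsSimple) {M : Type*} [AddCommGroup M] [Module O M]
    [Module.Finite O M] [Module.Free O M] {α : Representation O H M} {π : M →ₗ[O] Q}
    (hπ : IsReduction ℓ π) (hπα : ∀ h x, π (α h x) = σ h (π x)) :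
    ∃ u : (End O M)ˣ, (∀ x, π ((u : End O M) x) = σ t (π x)) ∧
      IsNormalizingLift α u ℓ (MulAut.conjNormal t) k := by
  have hred : ∀ (f : M →ₗ[O] M), (∀ x, π (f x) = 0) → ∃ g, f = ℓ • g := fun f hf =>
    exists_linearMap_eq_nsmul f fun x => hπ.exists_nsmul _ (hf x)
  have hconj : ∀ h : H, t * h = (MulAut.conjNormal t h : H) * t := fun h => by simp
  obtain ⟨f, hf, hfπ⟩ := exists_equivariant_lift hG.not_dvd α
    (α.comp (MulAut.conjNormal (H := H) t).toMonoidHom)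
    (fun h q => σ (MulAut.conjNormal t h : H) q) π hπ.surjective
    (fun h x => hπα _ x) ((σ t).restrictScalars O ∘ₗ π) (fun h x => by
      simp only [LinearMap.comp_apply, LinearMap.restrictScalars_apply, hπα]
      rw [← Module.End.mul_apply, ← map_mul, hconj, map_mul, Module.End.mul_apply])
  have hσinj : ∀ g, Function.Injective (σ g) := fun g =>
    Function.LeftInverse.injective (g := σ g⁻¹) fun q => by
      rw [← Module.End.mul_apply, ← map_mul, inv_mul_cancel, map_one, Module.End.one_apply]
  have hfπ' : ∀ x, π (f x) = σ t (π x) := hfπ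
  obtain ⟨u, rfl⟩ := isUnit_of_injective_mod hπ (f' := σ t) (fun x => (hfπ' x).symm) (hσinj t)
  refine ⟨u, hfπ', fun h => LinearMap.ext fun x => hf h x, ?_, ?_, fun f z hfα hfu hne => ?_⟩
  · rw [← map_pow, ← hG.orderOf_eq, pow_orderOf_eq_one, map_one]
  · obtain ⟨w, hw⟩ := hred ((u : End O M) ^ ℓ ^ k - 1) fun x => by
      have h1 : ∀ (m : ℕ) x, π (((u : End O M) ^ m) x) = (σ t ^ m) (π x) := fun m => by
        induction m with
        | zero => intro x; simp
        | succ m ih =>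
          intro x
          rw [pow_succ, Module.End.mul_apply, ih, hfπ', pow_succ, Module.End.mul_apply]
      rw [LinearMap.sub_apply, map_sub, h1, ← map_pow, ← hG.orderOf_eq, pow_orderOf_eq_one, map_one]
      simp
    exact ⟨w, by rw [← hw]; abel⟩
  · obtain ⟨f', hf'⟩ := hπ.exists_map (π ∘ₗ f)
    simp only [LinearMap.comp_apply] at hf'
    have hH' : ∀ h : H, ∀ q, f' (σ h q) = σ h (f' q) := fun h q => by
      obtain ⟨x, rfl⟩ := hπ.surjective q
      rw [← hπα, hf', hf', ← hπα]
      exact congrArg π (LinearMap.congr_fun (hfα h).eq x).symm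
    have ht' : ∀ q, f' (σ t q) = σ t (f' q) := fun q => by
      obtain ⟨x, rfl⟩ := hπ.surjective q
      rw [← hfπ', hf', hf', ← hfπ']
      have h1 := congrArg π (LinearMap.congr_fun hfu x)
      rw [LinearMap.add_apply, map_add, LinearMap.smul_apply, map_nsmul, nsmul_residue_eq_zero O,
        add_zero] at h1
      exact h1
    have hpow : ∀ (m : ℕ) q, f' (σ (t ^ m) q) = σ (t ^ m) (f' q) := fun m => by
      induction m with
      | zero => intro q; simp
      | succ m ih => intro q; rw [pow_succ, map_mul, Module.End.mul_apply, ih, ht']; rfl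
    have hst : σ.IsStable (LinearMap.ker f') := fun g q hq => by
      obtain ⟨h, n, rfl⟩ := hG.exists_eq_mul g
      rw [LinearMap.mem_ker] at hq
      rw [Submodule.mem_comap, LinearMap.mem_ker, map_mul, Module.End.mul_apply, hH', hpow, hq,
        map_zero, map_zero]
    rcases hσ.eq_bot_or_eq_top _ hst with h0 | h0
    · exact isUnit_of_injective_mod hπ hf' (LinearMap.ker_eq_bot.1 h0)
    · obtain ⟨g, hg⟩ := hred f fun x => by
        rw [← hf', LinearMap.ker_eq_top.1 h0, LinearMap.zero_apply]
      exact absurd hg (hne g)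

/-- Simple modular representations lift to characteristic zero. -/
theorem exists_lift_of_isSimple [Module.Finite (ResidueField O) Q] (hσ : σ.IsSimple) :
    ∃ (n : ℕ) (ρ : Representation O G (Fin n → O)) (π : (Fin n → O) →ₗ[O] Q),
      IsReduction ℓ π ∧ ∀ g x, π (ρ g x) = σ g (π x) := by
  obtain ⟨n, α, π, hπ, hπα⟩ := exists_lift_coprime hG.not_dvd (σ.comp H.subtype)
  have hnt : Nontrivial (Fin n → O) := by
    have := hσ.nontrivial
    obtain ⟨x, y, hxy⟩ := exists_pair_ne Q
    obtain ⟨x, rfl⟩ := hπ.surjective x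
    obtain ⟨y, rfl⟩ := hπ.surjective y
    exact ⟨x, y, fun h => hxy (by rw [h])⟩
  obtain ⟨u, huπ, hu⟩ := exists_isNormalizingLift hG hσ hπ hπα
  obtain ⟨z, w, hz, hzα, hpow⟩ := hu.exists_pow_eq_one hG.not_dvd
  obtain ⟨ρ, hρH, hρt⟩ := hG.exists_hom α (z * u) hpow fun h => by
    rw [Units.val_mul, mul_assoc, hu.conj, ← mul_assoc, ← (hzα _).eq, mul_assoc]
  refine ⟨n, ρ, π, hπ, fun g x => ?_⟩
  have ht : ∀ x, π (ρ t x) = σ t (π x) := fun x => by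
    rw [hρt, Units.val_mul, hz, add_mul, one_mul, LinearMap.add_apply, map_add, huπ,
      smul_mul_assoc, LinearMap.smul_apply, map_nsmul, nsmul_residue_eq_zero O, add_zero]
  obtain ⟨h, m, rfl⟩ := hG.exists_eq_mul g
  have hpow : ∀ (m : ℕ) x, π (ρ (t ^ m) x) = σ (t ^ m) (π x) := fun m => by
    induction m with
    | zero => intro x; simp
    | succ m ih => intro x; rw [pow_succ, map_mul, Module.End.mul_apply, ih, ht, map_mul]; rfl
  rw [map_mul, Module.End.mul_apply, hρH, hπα, hpow, map_mul]
  rfl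

end Lift

end AbsolutelyUnramified

/-! ### Lifting symplectic forms and simple symplectic representations. -/

/-- A representation preserving a symplectic form. -/
structure IsSymplecticRep {R G M : Type*} [CommRing R] [Group G] [AddCommGroup M] [Module R M]
    (ρ : Representation R G M) (b : M →ₗ[R] M →ₗ[R] R) : Prop where
  form : IsSymplecticForm b
  invariant : ∀ g x y, b (ρ g x) (ρ g y) = b x y

namespace Representation

variable {R G M N : Type*} [CommRing R] [Group G] [AddCommGroup M] [Module R M]
  [AddCommGroup N] [Module R N]

theorem apply_inv_apply (ρ : Representation R G M) (g : G) (x : M) : ρ g (ρ g⁻¹ x) = x := by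
  rw [← Module.End.mul_apply, ← map_mul, mul_inv_cancel, map_one, Module.End.one_apply]

theorem inv_apply_apply (ρ : Representation R G M) (g : G) (x : M) : ρ g⁻¹ (ρ g x) = x := by
  rw [← Module.End.mul_apply, ← map_mul, inv_mul_cancel, map_one, Module.End.one_apply]

end Representation

namespace AbsolutelyUnramified

variable {ℓ : ℕ} {O : Type*} [CommRing O] [IsDomain O] [IsDiscreteValuationRing O]
  [hO : AbsolutelyUnramified ℓ O]

section Form

variable {M Q : Type*} [AddCommGroup M] [Module O M] [Module.Finite O M] [Module.Free O M]
  [AddCommGroup Q] [Module O Q] [Module (ResidueField O) Q] [IsScalarTower O (ResidueField O) Q]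
  {π : M →ₗ[O] Q}

/-- A bilinear form that is symplectic modulo `ℓ` is symplectic. -/
theorem isSymplecticForm_of_isReduction (hπ : IsReduction ℓ π)
    {β : Q →ₗ[ResidueField O] Q →ₗ[ResidueField O] ResidueField O} (hβ : IsSymplecticForm β)
    {b : M →ₗ[O] M →ₗ[O] O} (halt : ∀ x, b x x = 0)
    (hb : ∀ x y, residue O (b x y) = β (π x) (π y)) : IsSymplecticForm b := by
  refine ⟨halt, ?_, ?_⟩
  · rw [← LinearMap.ker_eq_bot, eq_bot_iff]
    intro x hx
    have h1 : ∀ x, b x = 0 → ∃ y, x = ℓ • y := fun x hx => by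
      refine hπ.exists_nsmul x (hβ.eq_zero_of_left fun q => ?_)
      obtain ⟨y, rfl⟩ := hπ.surjective q
      rw [← hb, hx, LinearMap.zero_apply, map_zero]
    have h2 : ∀ n, ∀ x, b x = 0 → ∃ y, x = ℓ ^ n • y := fun n => by
      induction n with
      | zero => intro x _; exact ⟨x, by simp⟩
      | succ n ih =>
        intro x hx
        obtain ⟨y, rfl⟩ := h1 x hx
        rw [map_nsmul] at hx
        obtain ⟨z, rfl⟩ := ih y (nsmul_eq_zero O hx)
        exact ⟨z, by rw [smul_smul, pow_succ']⟩
    exact eq_zero_of_forall_exists_nsmul O x fun n => h2 n x hx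
  · rw [← LinearMap.range_eq_top]
    refine eq_top_of_forall_exists_add_nsmul _ fun φ => ?_
    obtain ⟨φ', hφ'⟩ := hπ.exists_map (Q' := ResidueField O) (Algebra.linearMap O (ResidueField O) ∘ₗ φ)
    obtain ⟨q, hq⟩ := hβ.exists_eq φ'
    obtain ⟨x, rfl⟩ := hπ.surjective q
    obtain ⟨ψ, hψ⟩ := exists_linearMap_eq_nsmul (ℓ := ℓ) (φ - b x) fun y => by
      refine exists_of_residue_eq_zero ?_
      rw [LinearMap.sub_apply, map_sub, hb, hq, hφ', sub_eq_zero]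
      rfl
    exact ⟨b x, ⟨x, rfl⟩, ψ, by rw [← hψ]; abel⟩

/-- Lifting of invariant symplectic forms. -/
theorem exists_lift_form {H : Type*} [Group H] [Finite H] (hH : ¬ ℓ ∣ Nat.card H)
    {α : Representation O H M} {σ : Representation (ResidueField O) H Q} (hπ : IsReduction ℓ π)
    (hπα : ∀ h x, π (α h x) = σ h (π x))
    {β : Q →ₗ[ResidueField O] Q →ₗ[ResidueField O] ResidueField O} (hβ : IsSymplecticRep σ β) :
    ∃ b, IsSymplecticRep α b ∧ ∀ x y, residue O (b x y) = β (π x) (π y) := by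
  obtain ⟨g, hg⟩ : ∃ g : M →ₗ[O] (M →ₗ[O] ResidueField O), ∀ x y, g x y = β (π x) (π y) :=
    ⟨LinearMap.mk₂ O (fun x y => β (π x) (π y)) (fun x y z => by simp) (fun a x y => by
      rw [map_smul, ← residue_smul, map_smul, LinearMap.smul_apply, residue_smul])
      (fun x y z => by simp) (fun a x y => by
      rw [map_smul, ← residue_smul, map_smul, residue_smul]), fun x y => rfl⟩
  let P : (M →ₗ[O] O) →ₗ[O] (M →ₗ[O] ResidueField O) :=
    (Algebra.linearMap O (ResidueField O)).compRight O
  have hP : ∀ f x, P f x = residue O (f x) := fun f x => rfl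
  have hPsurj : Function.Surjective P := fun f => by
    obtain ⟨f', hf'⟩ := Module.projective_lifting_property
      (Algebra.linearMap O (ResidueField O)) f residue_surjective
    exact ⟨f', hf'⟩
  -- An invariant form is an equivariant map from M to its dual, so the averaging argument lifts it.
  obtain ⟨f, hf, hfP⟩ := exists_equivariant_lift hH α α.dual
    (fun h φ => φ ∘ₗ α h⁻¹) P hPsurj (fun h φ => rfl) g fun h x => LinearMap.ext fun y => by
      rw [LinearMap.comp_apply, hg, hg]
      nth_rewrite 1 [← α.apply_inv_apply h y]
      rw [hπα, hπα, hβ.invariant]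
  -- The lift need not be alternating; antisymmetrizing with the factor 1/2 repairs this without
  -- changing the reduction.
  obtain ⟨c, hc⟩ := exists_half O
  have hfα : ∀ h x y, f (α h x) (α h y) = f x y := fun h x y => by
    rw [hf]
    change f x (α h⁻¹ (α h y)) = _
    rw [α.inv_apply_apply]
  have hfr : ∀ x y, residue O (f x y) = β (π x) (π y) := fun x y => by rw [← hP, hfP, hg]
  have hb : ∀ x y, (c • (f - f.flip)) x y = c * (f x y - f y x) := fun x y => rfl
  have hc' : residue O c * 2 = 1 := by
    rw [← map_ofNat (residue O) 2, ← map_mul, mul_comm, hc, map_one]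
  have hres : ∀ x y, residue O ((c • (f - f.flip)) x y) = β (π x) (π y) := fun x y => by
    rw [hb, map_mul, map_sub, hfr, hfr, ← hβ.form.neg (π x) (π y)]
    linear_combination (β (π x) (π y)) * hc'
  refine ⟨c • (f - f.flip), ⟨isSymplecticForm_of_isReduction hπ hβ.form (fun x => ?_) hres,
    fun h x y => ?_⟩, hres⟩
  · rw [hb, sub_self, mul_zero]
  · rw [hb, hb, hfα, hfα]

end Form

section Lift

variable {G : Type*} [Group G] [Finite G] {k : ℕ} {H : Subgroup G} {t : G}
  (hG : IsCyclicExtension ℓ k H t)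
  {Q : Type*} [AddCommGroup Q] [Module O Q] [Module (ResidueField O) Q]
  [IsScalarTower O (ResidueField O) Q] {σ : Representation (ResidueField O) G Q}

include hG

/-- Simple symplectic modular representations lift to characteristic zero. -/
theorem exists_symplectic_lift_of_isSimple [Module.Finite (ResidueField O) Q] (hσ : σ.IsSimple)
    {β : Q →ₗ[ResidueField O] Q →ₗ[ResidueField O] ResidueField O} (hβ : IsSymplecticRep σ β) :
    ∃ (n : ℕ) (ρ : Representation O G (Fin n → O)) (b : (Fin n → O) →ₗ[O] (Fin n → O) →ₗ[O] O)
      (π : (Fin n → O) →ₗ[O] Q), IsReduction ℓ π ∧ (∀ g x, π (ρ g x) = σ g (π x)) ∧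
        IsSymplecticRep ρ b := by
  have := hG.normal
  obtain ⟨n, α, π, hπ, hπα⟩ := exists_lift_coprime hG.not_dvd (σ.comp H.subtype)
  obtain ⟨b, hb, hbβ⟩ := exists_lift_form hG.not_dvd (σ := σ.comp H.subtype) hπ hπα
    ⟨hβ.form, fun h => hβ.invariant h⟩
  have hnt : Nontrivial (Fin n → O) := by
    have := hσ.nontrivial
    obtain ⟨x, y, hxy⟩ := exists_pair_ne Q
    obtain ⟨x, rfl⟩ := hπ.surjective x
    obtain ⟨y, rfl⟩ := hπ.surjective y
    exact ⟨x, y, fun h => hxy (by rw [h])⟩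
  obtain ⟨u₀, huπ, hu₀⟩ := exists_isNormalizingLift hG hσ hπ hπα
  obtain ⟨u, ⟨w, hw⟩, huα, hpow, hub⟩ := hu₀.exists_symplectic hG.not_dvd hb.form hb.invariant
    fun v w => by
      obtain ⟨a, ha⟩ := exists_of_residue_eq_zero (ℓ := ℓ)
        (a := b ((u₀ : End O (Fin n → O)) v) ((u₀ : End O (Fin n → O)) w) - b v w) (by
        rw [map_sub, hbβ, hbβ, huπ, huπ, hβ.invariant, sub_self])
      exact ⟨a, by rw [← ha]; ring⟩
  obtain ⟨ρ, hρH, hρt⟩ := hG.exists_hom α u hpow huα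
  have ht : ∀ x, π (ρ t x) = σ t (π x) := fun x => by
    rw [hρt, hw, LinearMap.add_apply, map_add, huπ, LinearMap.smul_apply, map_nsmul,
      nsmul_residue_eq_zero O, add_zero]
  refine ⟨n, ρ, b, π, hπ, fun g x => ?_, hb.form, fun g x y => ?_⟩
  · obtain ⟨h, m, rfl⟩ := hG.exists_eq_mul g
    have hpow : ∀ (m : ℕ) x, π (ρ (t ^ m) x) = σ (t ^ m) (π x) := fun m => by
      induction m with
      | zero => intro x; simp
      | succ m ih => intro x; rw [pow_succ, map_mul, Module.End.mul_apply, ih, ht, map_mul]; rfl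
    rw [map_mul, Module.End.mul_apply, hρH, hπα, hpow, map_mul]
    rfl
  · obtain ⟨h, m, rfl⟩ := hG.exists_eq_mul g
    have hpow : ∀ (m : ℕ) x y, b (ρ (t ^ m) x) (ρ (t ^ m) y) = b x y := fun m => by
      induction m with
      | zero => intro x y; simp
      | succ m ih =>
        intro x y
        rw [pow_succ, map_mul, Module.End.mul_apply, Module.End.mul_apply, ih, hρt, hub]
    rw [map_mul, Module.End.mul_apply, Module.End.mul_apply, hρH, hb.invariant, hpow]

end Lift

/-! ### Symplectic lattices of bounded rank, orthogonal sums, hyperbolic lattices. -/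

section Lattice

variable (O)

/-- There is a symplectic lattice of rank at most `n` on which `G` acts with kernel in `N`. -/
def HasSymplecticLattice {G : Type*} [Group G] (n : ℕ) (N : Set G) : Prop :=
  ∃ r ≤ n, ∃ (ρ : Representation O G (Fin r → O)) (b : (Fin r → O) →ₗ[O] (Fin r → O) →ₗ[O] O),
    IsSymplecticRep ρ b ∧ ∀ g, ρ g = 1 → g ∈ N

variable {O} {G : Type*} [Group G] {n n' : ℕ} {N N' : Set G}

omit [IsDomain O] [IsDiscreteValuationRing O]

theorem HasSymplecticLattice.mono (h : HasSymplecticLattice O n N) (hn : n ≤ n') (hN : N ⊆ N') :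
    HasSymplecticLattice O n' N' := by
  obtain ⟨r, hr, ρ, b, hb, hρ⟩ := h
  exact ⟨r, hr.trans hn, ρ, b, hb, fun g hg => hN (hρ g hg)⟩

theorem HasSymplecticLattice.of_isSymplecticRep [StrongRankCondition O] {M : Type*}
    [AddCommGroup M] [Module O M]
    [Module.Finite O M] [Module.Free O M] {ρ : Representation O G M} {b : M →ₗ[O] M →ₗ[O] O}
    (hb : IsSymplecticRep ρ b) (hn : finrank O M ≤ n) (hN : ∀ g, ρ g = 1 → g ∈ N) :
    HasSymplecticLattice O n N := by
  let e := (Module.finBasis O M).equivFun.symm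
  let ρ' : Representation O G (Fin (finrank O M) → O) :=
    (LinearEquiv.conjRingEquiv e.symm : End O M →* End O _).comp ρ
  have he : ∀ g x, e (ρ' g x) = ρ g (e x) := fun g x => by simp [ρ', LinearEquiv.conjRingEquiv]
  refine ⟨_, hn, ρ', (b.compl₂ (e : _ →ₗ[O] M)) ∘ₗ (e : _ →ₗ[O] M), ⟨⟨fun x => hb.form.1 _, ?_⟩,
    fun g x y => ?_⟩, fun g hg => hN g (LinearMap.ext fun x => ?_)⟩
  · have : ((b.compl₂ (e : _ →ₗ[O] M)) ∘ₗ (e : _ →ₗ[O] M) : _ → _) =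
        (e.dualMap : _ → _) ∘ b ∘ e := rfl
    rw [this]
    exact e.dualMap.bijective.comp (hb.form.bijective.comp e.bijective)
  · change b (e (ρ' g x)) (e (ρ' g y)) = _
    rw [he, he, hb.invariant]; rfl
  · obtain ⟨x, rfl⟩ := e.surjective x
    rw [← he, hg]; rfl

theorem hasSymplecticLattice_zero (h : ∀ g, g ∈ N) : HasSymplecticLattice O n N :=
  ⟨0, n.zero_le, 1, 0, ⟨⟨fun _ => rfl, ⟨fun _ _ _ => Subsingleton.elim _ _, fun f =>
    ⟨0, LinearMap.ext fun x => by rw [Subsingleton.elim x 0, map_zero, map_zero]⟩⟩⟩,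
    fun _ _ _ => rfl⟩, fun g _ => h g⟩

/-- The orthogonal sum of two symplectic representations. -/
theorem exists_isSymplecticRep_prod {M M' : Type*} [AddCommGroup M] [Module O M] [AddCommGroup M']
    [Module O M'] {ρ : Representation O G M} {ρ' : Representation O G M'} {b : M →ₗ[O] M →ₗ[O] O}
    {b' : M' →ₗ[O] M' →ₗ[O] O} (hb : IsSymplecticRep ρ b) (hb' : IsSymplecticRep ρ' b') :
    ∃ B, IsSymplecticRep (ρ.prod ρ') B := by
  let B : (M × M') →ₗ[O] (M × M') →ₗ[O] O :=
    (b.compl₂ (LinearMap.fst O _ _)) ∘ₗ LinearMap.fst O _ _ +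
      (b'.compl₂ (LinearMap.snd O _ _)) ∘ₗ LinearMap.snd O _ _
  have hB : ∀ x y, B x y = b x.1 y.1 + b' x.2 y.2 := fun x y => rfl
  refine ⟨B, ⟨fun x => ?_, ?_, fun f => ?_⟩, fun g x y => ?_⟩
  · rw [hB, hb.form.1, hb'.form.1, add_zero]
  · rw [← LinearMap.ker_eq_bot, eq_bot_iff]
    intro x hx
    refine Prod.ext (hb.form.eq_zero_of_left fun y => ?_) (hb'.form.eq_zero_of_left fun y => ?_)
    · have := LinearMap.congr_fun (LinearMap.mem_ker.1 hx) (y, 0)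
      simpa [hB] using this
    · have := LinearMap.congr_fun (LinearMap.mem_ker.1 hx) (0, y)
      simpa [hB] using this
  · obtain ⟨x, hx⟩ := hb.form.exists_eq (f ∘ₗ LinearMap.inl O _ _)
    obtain ⟨y, hy⟩ := hb'.form.exists_eq (f ∘ₗ LinearMap.inr O _ _)
    refine ⟨(x, y), LinearMap.ext fun z => ?_⟩
    rw [hB, hx, hy, LinearMap.comp_apply, LinearMap.comp_apply, ← map_add]
    simp
  · change B (ρ g x.1, ρ' g x.2) (ρ g y.1, ρ' g y.2) = _
    rw [hB, hB, hb.invariant, hb'.invariant]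

/-- The hyperbolic form of a representation. -/
theorem exists_isSymplecticRep_prod_dual {T : Type*} [AddCommGroup T] [Module O T]
    [Module.Finite O T] [Module.Free O T] (ρ : Representation O G T) :
    ∃ B, IsSymplecticRep (ρ.prod ρ.dual) B := by
  let B : (T × Module.Dual O T) →ₗ[O] (T × Module.Dual O T) →ₗ[O] O :=
    LinearMap.mk₂ O (fun x y => y.2 x.1 - x.2 y.1)
      (fun x y z => by simp; ring) (fun a x y => by simp; ring) (fun x y z => by simp; ring)
      (fun a x y => by simp; ring)
  have hB : ∀ x y, B x y = y.2 x.1 - x.2 y.1 := fun x y => rfl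
  refine ⟨B, ⟨fun x => ?_, ?_, fun f => ?_⟩, fun g x y => ?_⟩
  · rw [hB, sub_self]
  · rw [← LinearMap.ker_eq_bot, eq_bot_iff]
    intro x hx
    refine Prod.ext ((Module.forall_dual_apply_eq_zero_iff O _).1 fun y => ?_)
      (LinearMap.ext fun y => ?_)
    · have := LinearMap.congr_fun (LinearMap.mem_ker.1 hx) (0, y)
      simpa [hB] using this
    · have := LinearMap.congr_fun (LinearMap.mem_ker.1 hx) (y, 0)
      simpa [hB] using this
  · obtain ⟨x, hx⟩ := (Module.evalEquiv O T).surjective (f ∘ₗ LinearMap.inr O _ _)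
    refine ⟨(x, - (f ∘ₗ LinearMap.inl O _ _)), LinearMap.ext fun z => ?_⟩
    have h1 : z.2 x = f (0, z.2) := LinearMap.congr_fun hx z.2
    rw [hB, h1, LinearMap.neg_apply, sub_neg_eq_add, LinearMap.comp_apply, ← map_add]
    simp
  · change y.2 (ρ g⁻¹ (ρ g x.1)) - x.2 (ρ g⁻¹ (ρ g y.1)) = _
    rw [ρ.inv_apply_apply, ρ.inv_apply_apply, hB]

/-- The orthogonal sum of two symplectic lattices. -/
theorem HasSymplecticLattice.add [StrongRankCondition O] (h : HasSymplecticLattice O n N)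
    (h' : HasSymplecticLattice O n' N') :
    HasSymplecticLattice O (n + n') (N ∩ N') := by
  obtain ⟨r, hr, ρ, b, hb, hρ⟩ := h
  obtain ⟨r', hr', ρ', b', hb', hρ'⟩ := h'
  obtain ⟨B, hB⟩ := exists_isSymplecticRep_prod hb hb'
  refine .of_isSymplecticRep hB ?_ fun g hg =>
    ⟨hρ g (LinearMap.ext fun x => ?_), hρ' g (LinearMap.ext fun x => ?_)⟩
  · rw [Module.finrank_prod, Module.finrank_fin_fun, Module.finrank_fin_fun]
    exact Nat.add_le_add hr hr'
  · exact congrArg Prod.fst (LinearMap.congr_fun hg (x, 0))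
  · exact congrArg Prod.snd (LinearMap.congr_fun hg (0, x))

/-- The hyperbolic lattice of a representation. -/
theorem hasSymplecticLattice_hyperbolic [StrongRankCondition O] {T : Type*} [AddCommGroup T]
    [Module O T] [Module.Finite O T] [Module.Free O T] (ρ : Representation O G T)
    (hn : 2 * finrank O T ≤ n) (hN : ∀ g, ρ g = 1 → g ∈ N) :
    HasSymplecticLattice O n N := by
  obtain ⟨B, hB⟩ := exists_isSymplecticRep_prod_dual ρ
  refine .of_isSymplecticRep hB ?_ fun g hg => hN g (LinearMap.ext fun x => ?_)
  · rw [Module.finrank_prod, ← (Module.finBasis O T).toDualEquiv.finrank_eq, ← two_mul]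
    exact hn
  · exact congrArg Prod.fst (LinearMap.congr_fun hg (x, 0))

end Lattice

end AbsolutelyUnramified

/-! ### Orthogonal complements and simple subrepresentations over a field. -/

section Field

variable {F V : Type*} [Field F] [AddCommGroup V] [Module F V] [Module.Finite F V]

theorem isSymplecticForm_of_separating {b : V →ₗ[F] V →ₗ[F] F} (halt : ∀ x, b x x = 0)
    (hsep : ∀ x, (∀ y, b x y = 0) → x = 0) : IsSymplecticForm b := by
  have hinj : Function.Injective b := (injective_iff_map_eq_zero b).2 fun x hx =>
    hsep x fun y => by rw [hx, LinearMap.zero_apply]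
  exact ⟨halt, hinj, (LinearMap.injective_iff_surjective_of_finrank_eq_finrank
    Subspace.dual_finrank_eq.symm).1 hinj⟩

variable {b : V →ₗ[F] V →ₗ[F] F}

namespace IsSymplecticForm

omit [Module.Finite F V] in
theorem nondegenerate (hb : IsSymplecticForm b) : LinearMap.BilinForm.Nondegenerate b :=
  ⟨fun _ h => hb.eq_zero_of_left h, fun _ h => hb.eq_zero_of_right h⟩

omit [Module.Finite F V] in
theorem isRefl (hb : IsSymplecticForm b) : LinearMap.BilinForm.IsRefl b := fun x y h => by
  rw [← hb.neg, h, neg_zero]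

theorem finrank_orthogonal_add (hb : IsSymplecticForm b) (S : Submodule F V) :
    finrank F (LinearMap.BilinForm.orthogonal b S) + finrank F S = finrank F V := by
  rw [LinearMap.BilinForm.finrank_orthogonal hb.nondegenerate]
  exact Nat.sub_add_cancel S.finrank_le

theorem mem_of_forall_orthogonal (hb : IsSymplecticForm b) {S : Submodule F V} {x : V}
    (h : ∀ y, (∀ s ∈ S, b s y = 0) → b x y = 0) : x ∈ S := by
  rw [← LinearMap.BilinForm.orthogonal_orthogonal hb.nondegenerate hb.isRefl S]
  refine LinearMap.BilinForm.mem_orthogonal_iff.2 fun y hy => ?_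
  rw [← hb.neg, h y (LinearMap.BilinForm.mem_orthogonal_iff.1 hy), neg_zero]

end IsSymplecticForm

variable {G : Type*} [Group G] {ρ : Representation F G V}

theorem Representation.IsStable.exists_isSimple {S : Submodule F V} (hS : ρ.IsStable S)
    (hne : S ≠ ⊥) :
    ∃ (T : Submodule F V) (hT : ρ.IsStable T), T ≤ S ∧ (ρ.subrepresentation T hT).IsSimple := by
  obtain ⟨T, ⟨hTs, hTS, hT0⟩, hmin⟩ := (wellFounded_lt (α := Submodule F V)).has_min
    {T | ρ.IsStable T ∧ T ≤ S ∧ T ≠ ⊥} ⟨S, hS, le_rfl, hne⟩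
  refine ⟨T, hTs, hTS, (Submodule.nontrivial_iff_ne_bot).2 hT0, fun N hN => ?_⟩
  by_contra! hcon
  refine hmin (N.map T.subtype) ⟨fun g x hx => ?_, (Submodule.map_subtype_le T N).trans hTS, ?_⟩ ?_
  · obtain ⟨y, hy, rfl⟩ := hx
    exact ⟨_, hN g hy, rfl⟩
  · exact fun h => hcon.1 (Submodule.map_injective_of_injective T.injective_subtype
      (h.trans (Submodule.map_bot _).symm))
  · refine lt_of_le_of_ne (Submodule.map_subtype_le T N) fun h => hcon.2 ?_
    rw [eq_top_iff]
    intro x _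
    have hx : (x : V) ∈ N.map T.subtype := h.symm ▸ x.2
    obtain ⟨y, hy, hyx⟩ := hx
    rwa [← Subtype.ext hyx]

omit [Module.Finite F V] in
theorem IsSymplecticRep.isStable_orthogonal (hb : IsSymplecticRep ρ b) {S : Submodule F V}
    (hS : ρ.IsStable S) : ρ.IsStable (LinearMap.BilinForm.orthogonal b S) := fun g x hx => by
  refine LinearMap.BilinForm.mem_orthogonal_iff.2 fun s hs => ?_
  change b s (ρ g x) = 0
  rw [← ρ.apply_inv_apply g s, hb.invariant]
  exact LinearMap.BilinForm.mem_orthogonal_iff.1 hx _ (hS g⁻¹ hs)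

omit [Module.Finite F V] in
theorem Representation.IsSimple.le_or_inf_eq_bot {S T : Submodule F V} {hS : ρ.IsStable S}
    (h : (ρ.subrepresentation S hS).IsSimple) (hT : ρ.IsStable T) : S ≤ T ∨ S ⊓ T = ⊥ := by
  rcases h.eq_bot_or_eq_top (T.comap S.subtype) fun g x hx => hT g hx with h0 | h0
  · right
    rw [eq_bot_iff]
    rintro x ⟨hx, hx'⟩
    have : (⟨x, hx⟩ : S) ∈ T.comap S.subtype := hx'
    rw [h0] at this
    exact congrArg Subtype.val ((Submodule.mem_bot F).1 this)
  · left
    intro x hx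
    have : (⟨x, hx⟩ : S) ∈ T.comap S.subtype := h0 ▸ Submodule.mem_top
    exact this

variable (b) in
/-- The restriction of a bilinear form. -/
def restrictForm (S : Submodule F V) : S →ₗ[F] S →ₗ[F] F :=
  (b.compl₂ S.subtype) ∘ₗ S.subtype

/-- An invariant alternating form induces a symplectic form on the quotient by its radical. -/
theorem exists_quotient_form (halt : ∀ x, b x x = 0) (hinv : ∀ g x y, b (ρ g x) (ρ g y) = b x y) :
    ∃ (hst : ρ.IsStable (LinearMap.ker b))
      (β : (V ⧸ LinearMap.ker b) →ₗ[F] (V ⧸ LinearMap.ker b) →ₗ[F] F),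
      IsSymplecticRep (ρ.quotient _ hst) β ∧
        ∀ x y, β (Submodule.Quotient.mk x) (Submodule.Quotient.mk y) = b x y := by
  have hneg : ∀ x y, - b x y = b y x := LinearMap.IsAlt.neg halt
  have hst : ρ.IsStable (LinearMap.ker b) := fun g x hx => by
    refine LinearMap.ext fun y => ?_
    rw [← ρ.apply_inv_apply g y, hinv, LinearMap.mem_ker.1 hx, LinearMap.zero_apply,
      LinearMap.zero_apply]
  have hker : ∀ x, LinearMap.ker b ≤ LinearMap.ker (b x) := fun x y hy => by
    rw [LinearMap.mem_ker, ← hneg, LinearMap.mem_ker.1 hy, LinearMap.zero_apply, neg_zero]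
  let f : V →ₗ[F] (V ⧸ LinearMap.ker b) →ₗ[F] F :=
    { toFun := fun x => (LinearMap.ker b).liftQ (b x) (hker x)
      map_add' := fun x y => Submodule.linearMap_qext _ (LinearMap.ext fun z => by simp)
      map_smul' := fun a x => Submodule.linearMap_qext _ (LinearMap.ext fun z => by simp) }
  let β := (LinearMap.ker b).liftQ f fun x hx =>
    Submodule.linearMap_qext _ (LinearMap.ext fun z => LinearMap.congr_fun (LinearMap.mem_ker.1 hx) z)
  have hβ : ∀ x y, β (Submodule.Quotient.mk x) (Submodule.Quotient.mk y) = b x y := fun x y => rfl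
  refine ⟨hst, β, ⟨isSymplecticForm_of_separating (fun x => ?_) fun x hx => ?_, fun g x y => ?_⟩,
    hβ⟩
  · obtain ⟨x, rfl⟩ := Submodule.Quotient.mk_surjective _ x
    exact halt x
  · obtain ⟨x, rfl⟩ := Submodule.Quotient.mk_surjective _ x
    rw [Submodule.Quotient.mk_eq_zero]
    exact LinearMap.ext fun y => hx (Submodule.Quotient.mk y)
  · obtain ⟨x, rfl⟩ := Submodule.Quotient.mk_surjective _ x
    obtain ⟨y, rfl⟩ := Submodule.Quotient.mk_surjective _ y
    exact hinv g x y

end Field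

/-- In characteristic `ℓ`, a unipotent element of order prime to `ℓ` is trivial. -/
theorem eq_one_of_sub_one_pow {A : Type*} [Ring A] (ℓ : ℕ) [Fact ℓ.Prime] [CharP A ℓ] {x : A}
    (hx : (x - 1) ^ ℓ = 0) {m : ℕ} (hm : ¬ ℓ ∣ m) (h : x ^ m = 1) : x = 1 := by
  rw [sub_pow_char_of_commute ℓ (Commute.one_right x), one_pow, sub_eq_zero] at hx
  have h1 := pow_gcd_eq_one.2 ⟨hx, h⟩
  rwa [Nat.Coprime.gcd_eq_one ((Nat.Prime.coprime_iff_not_dvd Fact.out).2 hm), pow_one] at h1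

/-! ### From residual symplectic representations to symplectic lattices. -/

namespace AbsolutelyUnramified

variable {ℓ : ℕ} {O : Type*} [CommRing O] [IsDomain O] [IsDiscreteValuationRing O]
  [hO : AbsolutelyUnramified ℓ O] {G : Type*} [Group G] [Finite G] {k : ℕ} {H : Subgroup G} {t : G}
  (hG : IsCyclicExtension ℓ k H t)

include hG

section Simple

variable {Q : Type*} [AddCommGroup Q] [Module (ResidueField O) Q] [Module.Finite (ResidueField O) Q]
  {σ : Representation (ResidueField O) G Q}

theorem hasSymplecticLattice_of_isSimple (hσ : σ.IsSimple) :
    HasSymplecticLattice O (2 * finrank (ResidueField O) Q) {g | σ g = 1} := by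
  let := Module.compHom Q (residue O)
  have : IsScalarTower O (ResidueField O) Q := ⟨fun a c x => by
    change (residue O a * c) • x = residue O a • c • x
    rw [mul_smul]⟩
  have := hG.normal
  obtain ⟨n, ρ, π, hπ, hρ⟩ := exists_lift_of_isSimple hG hσ
  refine hasSymplecticLattice_hyperbolic ρ (by rw [hπ.finrank_eq]) fun g hg =>
    LinearMap.ext fun q => ?_
  obtain ⟨x, rfl⟩ := hπ.surjective q
  rw [← hρ, hg]; rfl

theorem hasSymplecticLattice_of_isSimple_of_isSymplecticRep (hσ : σ.IsSimple)
    {β : Q →ₗ[ResidueField O] Q →ₗ[ResidueField O] ResidueField O} (hβ : IsSymplecticRep σ β) :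
    HasSymplecticLattice O (finrank (ResidueField O) Q) {g | σ g = 1} := by
  let := Module.compHom Q (residue O)
  have : IsScalarTower O (ResidueField O) Q := ⟨fun a c x => by
    change (residue O a * c) • x = residue O a • c • x
    rw [mul_smul]⟩
  obtain ⟨n, ρ, b, π, hπ, hρ, hb⟩ := exists_symplectic_lift_of_isSimple hG hσ hβ
  refine HasSymplecticLattice.of_isSymplecticRep hb (by rw [hπ.finrank_eq]) fun g hg =>
    LinearMap.ext fun q => ?_
  obtain ⟨x, rfl⟩ := hπ.surjective q
  rw [← hρ, hg]; rfl

end Simple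

/-- Induction on the rank of the form. A simple S is split off and the induction hypothesis is
applied to S^⊥; degenerate forms are allowed so that S^⊥ need not be divided by its radical. Only
elements of H are controlled: on the graded pieces an element may become trivial by being unipotent,
and this is harmless for order prime to ℓ. -/
theorem hasSymplecticLattice_of_residue (n : ℕ) : ∀ (Q : Type u) [AddCommGroup Q]
    [Module (ResidueField O) Q] [Module.Finite (ResidueField O) Q]
    (σ : Representation (ResidueField O) G Q)
    (β : Q →ₗ[ResidueField O] Q →ₗ[ResidueField O] ResidueField O), (∀ x, β x x = 0) →
    (∀ g x y, β (σ g x) (σ g y) = β x y) → finrank (ResidueField O) (LinearMap.range β) = n →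
    HasSymplecticLattice O n {g | g ∈ H → ∀ x, β (σ g x) = β x} := by
  induction n using Nat.strong_induction_on with
  | _ n ih =>
  -- reduction to the case of a symplectic form
  suffices hmain : ∀ (Q : Type u) [AddCommGroup Q] [Module (ResidueField O) Q]
      [Module.Finite (ResidueField O) Q] (σ : Representation (ResidueField O) G Q)
      (β : Q →ₗ[ResidueField O] Q →ₗ[ResidueField O] ResidueField O), IsSymplecticRep σ β →
      finrank (ResidueField O) Q = n → HasSymplecticLattice O n {g | g ∈ H → σ g = 1} by
    intro Q _ _ _ σ β halt hinv hn
    obtain ⟨hst, β', hβ', h⟩ := exists_quotient_form halt hinv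
    refine (hmain _ _ β' hβ' (by
      rw [← hn, ← (LinearMap.quotKerEquivRange β).finrank_eq])).mono le_rfl fun g hg hgH x => ?_
    have h1 := LinearMap.congr_fun (hg hgH) (Submodule.Quotient.mk x)
    refine LinearMap.ext fun y => ?_
    rw [← h, ← h]
    exact LinearMap.congr_fun (congrArg β' h1) _
  intro Q _ _ _ σ β hβ hn
  have : Fact ℓ.Prime := ⟨hO.prime⟩
  rcases subsingleton_or_nontrivial Q with hQ | hQ
  · exact hasSymplecticLattice_zero fun g _ => LinearMap.ext fun x => Subsingleton.elim _ _
  have htop : σ.IsStable ⊤ := fun g x _ => Submodule.mem_top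
  obtain ⟨S, hS, -, hsimple⟩ := htop.exists_isSimple top_ne_bot
  let W := LinearMap.BilinForm.orthogonal β S
  have hW : σ.IsStable W := hβ.isStable_orthogonal hS
  have hmemW : ∀ y, y ∈ W ↔ ∀ x ∈ S, β x y = 0 := fun y => LinearMap.BilinForm.mem_orthogonal_iff
  have hdim := hβ.form.finrank_orthogonal_add S
  have hSpos : 0 < finrank (ResidueField O) S := by
    have := hsimple.nontrivial
    exact Module.finrank_pos
  let r := finrank (ResidueField O) (LinearMap.range (restrictForm β W))
  have hr : r ≤ finrank (ResidueField O) W := LinearMap.finrank_range_le _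
  have hrec : HasSymplecticLattice O r
      {g | g ∈ H → ∀ x : W, restrictForm β W (σ.subrepresentation W hW g x) = restrictForm β W x} := by
    refine ih r ?_ W (σ.subrepresentation W hW) (restrictForm β W) (fun x => hβ.form.1 _)
      (fun g x y => hβ.invariant _ _ _) rfl
    change finrank _ W + _ = _ at hdim
    omega
  have hfix : ∀ g, σ.subrepresentation S hS g = 1 → ∀ x ∈ S, σ g x = x := fun g hg x hx =>
    congrArg Subtype.val (LinearMap.congr_fun hg ⟨x, hx⟩)
  rcases hsimple.le_or_inf_eq_bot hW with hSW | hSW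
  -- S lies in the radical of the form on S^⊥, so the rank drops by 2 dim S, exactly the rank of the
  -- hyperbolic lattice on a lift of S.
  · have hr' : r + 2 * finrank (ResidueField O) S ≤ n := by
      have h1 := LinearMap.finrank_range_add_finrank_ker (restrictForm β W)
      have h2 : finrank (ResidueField O) S ≤
          finrank (ResidueField O) (LinearMap.ker (restrictForm β W)) := by
        have : ∀ s : S, Submodule.inclusion hSW s ∈ LinearMap.ker (restrictForm β W) := fun s =>
          LinearMap.ext fun y => (hmemW y).1 y.2 s s.2
        exact LinearMap.finrank_le_finrank_of_injective
          (f := (Submodule.inclusion hSW).codRestrict _ this) fun a b hab =>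
          Submodule.inclusion_injective hSW (congrArg Subtype.val hab)
      change finrank _ W + _ = _ at hdim
      omega
    refine (hrec.add (hasSymplecticLattice_of_isSimple hG hsimple)).mono hr' ?_
    rintro g ⟨hg1, hg2⟩ hgH
    have hS1 : ∀ x ∈ S, (σ g - 1) x = 0 := fun x hx => by
      rw [LinearMap.sub_apply, hfix g hg2 x hx]; simp
    have hW1 : ∀ x ∈ W, (σ g - 1) x ∈ S := fun x hx => by
      refine hβ.form.mem_of_forall_orthogonal fun y hy => ?_
      have h1 := LinearMap.congr_fun (hg1 hgH ⟨x, hx⟩) ⟨y, (hmemW y).2 hy⟩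
      change β (σ g x) y = β x y at h1
      rw [LinearMap.sub_apply, map_sub, LinearMap.sub_apply, h1]; simp
    have hQ1 : ∀ x, (σ g - 1) x ∈ W := fun x => (hmemW _).2 fun s hs => by
      have h1 := hβ.invariant g s x
      rw [hfix g hg2 s hs] at h1
      rw [LinearMap.sub_apply, map_sub, h1]; simp
    -- The element g acts trivially on S, on S^⊥/S and on Q/S^⊥.
    have hcube : (σ g - 1) ^ 3 = 0 := LinearMap.ext fun x => by
      simp only [pow_succ, pow_zero, one_mul, Module.End.mul_apply]
      exact hS1 _ (hW1 _ (hQ1 x))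
    have := charP_residueField O
    have hchar : CharP (Module.End (ResidueField O) Q) ℓ :=
      charP_of_injective_algebraMap (R := ResidueField O)
        (FaithfulSMul.algebraMap_injective _ _) ℓ
    refine eq_one_of_sub_one_pow ℓ (pow_eq_zero_of_le (by have := hO.five_le; omega) hcube)
      hG.not_dvd ?_
    have h1 : (⟨g, hgH⟩ : H) ^ Nat.card H = 1 := pow_card_eq_one'
    have h2 : g ^ Nat.card H = 1 := congrArg Subtype.val h1
    rw [← map_pow, h2, map_one]
  · have hsymp : IsSymplecticRep (σ.subrepresentation S hS) (restrictForm β S) := by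
      refine ⟨isSymplecticForm_of_separating (fun x => hβ.form.1 _) fun x hx => ?_,
        fun g x y => hβ.invariant _ _ _⟩
      have h1 : (x : Q) ∈ S ⊓ W := ⟨x.2, (hmemW _).2 fun y hy => by
        rw [← hβ.form.neg, neg_eq_zero]; exact hx ⟨y, hy⟩⟩
      rw [hSW] at h1
      exact Subtype.ext ((Submodule.mem_bot _).1 h1)
    refine (hrec.add (hasSymplecticLattice_of_isSimple_of_isSymplecticRep hG hsimple hsymp)).mono
      (by change finrank _ W + _ = _ at hdim; omega) ?_
    rintro g ⟨hg1, hg2⟩ hgH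
    have hsup : S ⊔ W = ⊤ := by
      refine Submodule.eq_top_of_disjoint S W ?_ (disjoint_iff.2 hSW)
      rw [add_comm]; exact hdim.ge
    refine LinearMap.ext fun x => ?_
    obtain ⟨s, hs, w, hw, rfl⟩ := Submodule.mem_sup.1 (hsup ▸ Submodule.mem_top : x ∈ S ⊔ W)
    have hw1 : σ g w - w ∈ S ⊓ W := by
      have hmem : σ g w - w ∈ W := W.sub_mem (hW g hw) hw
      refine ⟨hβ.form.mem_of_forall_orthogonal fun y hy => ?_, hmem⟩
      have h1 := LinearMap.congr_fun (hg1 hgH ⟨w, hw⟩) ⟨y, (hmemW y).2 hy⟩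
      change β (σ g w) y = β w y at h1
      rw [map_sub, LinearMap.sub_apply, h1, sub_self]
    rw [hSW, Submodule.mem_bot, sub_eq_zero] at hw1
    rw [map_add, hfix g hg2 s hs, hw1]; rfl

end AbsolutelyUnramified

/-! ### Lattices whose dual is killed by ℓ. -/

namespace AbsolutelyUnramified

variable {ℓ : ℕ} {O : Type*} [CommRing O] [IsDomain O] [IsDiscreteValuationRing O]
  [hO : AbsolutelyUnramified ℓ O]

section Reduction

variable (O) in
theorem exists_isReduction (M : Type*) [AddCommGroup M] [Module O M] [Module.Finite O M]
    [Module.Free O M] :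
    ∃ π : M →ₗ[O] (Fin (finrank O M) → ResidueField O), IsReduction ℓ π := by
  let b := Module.finBasis O M
  refine ⟨((Algebra.linearMap O (ResidueField O)).compLeft _) ∘ₗ (b.equivFun : M →ₗ[O] _),
    fun q => ?_, fun x hx => ?_⟩
  · choose a ha using fun i => residue_surjective (R := O) (q i)
    refine ⟨b.equivFun.symm a, funext fun i => ?_⟩
    simp only [LinearMap.comp_apply, LinearEquiv.coe_coe, LinearEquiv.apply_symm_apply]
    exact ha i
  · choose y hy using fun i => exists_of_residue_eq_zero (ℓ := ℓ) (a := b.equivFun x i)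
      (congrFun hx i)
    refine ⟨b.equivFun.symm y, b.equivFun.injective ?_⟩
    rw [map_nsmul, LinearEquiv.apply_symm_apply]
    exact funext hy

variable {M Q : Type*} [AddCommGroup M] [Module O M]
  [AddCommGroup Q] [Module O Q] [Module (ResidueField O) Q] [IsScalarTower O (ResidueField O) Q]
  {π : M →ₗ[O] Q}

omit [IsDomain O] [IsDiscreteValuationRing O] hO [Module (ResidueField O) Q]
  [IsScalarTower O (ResidueField O) Q] in
theorem IsReduction.ext (hπ : IsReduction ℓ π) {P : Type*} {f g : Q → P}
    (h : ∀ x, f (π x) = g (π x)) : f = g := funext fun q => by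
  obtain ⟨x, rfl⟩ := hπ.surjective q
  exact h x

theorem IsReduction.exists_representation (hπ : IsReduction ℓ π) {G : Type*} [Group G]
    (ρ : Representation O G M) :
    ∃ σ : Representation (ResidueField O) G Q, ∀ g x, σ g (π x) = π (ρ g x) := by
  choose σ hσ using fun g => hπ.exists_map (π ∘ₗ ρ g)
  exact ⟨⟨⟨σ, DFunLike.coe_injective (hπ.ext fun x => by simp [hσ])⟩,
    fun g h => DFunLike.coe_injective (hπ.ext fun x => by simp [hσ])⟩, hσ⟩

theorem IsReduction.exists_bilin (hπ : IsReduction ℓ π) (c : M →ₗ[O] M →ₗ[O] O) :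
    ∃ β : Q →ₗ[ResidueField O] Q →ₗ[ResidueField O] ResidueField O,
      ∀ x y, β (π x) (π y) = residue O (c x y) := by
  choose f hf using fun x => hπ.exists_map (Algebra.linearMap O (ResidueField O) ∘ₗ c x)
  have hf' : ∀ x y, f x (π y) = residue O (c x y) := hf
  let F : M →ₗ[O] (Q →ₗ[ResidueField O] ResidueField O) :=
    { toFun := f
      map_add' := fun x y => DFunLike.coe_injective (hπ.ext fun z => by simp [hf'])
      map_smul' := fun a x => DFunLike.coe_injective (hπ.ext fun z => by
        simp only [hf', map_smul, LinearMap.smul_apply, RingHom.id_apply, smul_eq_mul, map_mul]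
        rw [← residue_smul, smul_eq_mul]) }
  obtain ⟨β, hβ⟩ := hπ.exists_map F
  exact ⟨β, fun x y => by rw [hβ]; exact hf' x y⟩

theorem exists_nsmul_of_forall_dual [Module.Finite O M] [Module.Free O M] {x : M}
    (h : ∀ φ : Module.Dual O M, residue O (φ x) = 0) : ∃ y, x = ℓ • y := by
  let b := Module.finBasis O M
  choose y hy using fun i => exists_of_residue_eq_zero (ℓ := ℓ) (h (b.coord i))
  refine ⟨∑ i, y i • b i, b.ext_elem fun i => ?_⟩
  rw [map_nsmul, Finsupp.smul_apply, b.repr_sum_self]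
  exact hy i

end Reduction

variable (O) in
include hO in
theorem nsmul_cancel {N : Type*} [AddCommGroup N] [Module O N] [Module.Free O N] {x y : N}
    (h : ℓ • x = ℓ • y) : x = y := by
  rw [← sub_eq_zero] at h ⊢
  exact nsmul_eq_zero O (by rw [smul_sub, h])

/-- An operator of order prime to `ℓ` that is unipotent modulo `ℓ` is trivial. -/
theorem eq_one_of_unipotent_mod {A : Type*} [Ring A] [Algebra O A] [Module.Finite O A]
    [Module.Free O A] {x w : A} {r : ℕ} (hr : r ≤ ℓ) (hx : (x - 1) ^ r = ℓ • w) {m : ℕ} (hm : ¬ ℓ ∣ m)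
    (h : x ^ m = 1) : x = 1 := by
  -- Modulo ℓ, x^ℓ = (x - 1)^ℓ + 1 = 1. Hence x^ℓ, of finite order, is 1, and the order of x is
  -- prime to ℓ.
  obtain ⟨r', hr'⟩ := (Commute.one_right (x - 1)).exists_add_pow_prime_eq hO.prime
  have hsp : (x - 1) ^ ℓ = (x - 1) ^ (ℓ - r) * (ℓ • w) := by
    rw [← hx, ← pow_add, Nat.sub_add_cancel hr]
  rw [sub_add_cancel, one_pow, hsp] at hr'
  have h1 : x ^ ℓ = 1 + ℓ • ((x - 1) ^ (ℓ - r) * w + (x - 1) * 1 * r') := by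
    rw [hr', smul_add, mul_smul_comm, nsmul_eq_mul (n := ℓ) (_ * r')]
    simp only [mul_assoc]
    abel
  have h0 : m ≠ 0 := fun h0 => hm (h0 ▸ dvd_zero ℓ)
  have h2 : x ^ ℓ = 1 := eq_one_of_pow_eq_one O h1 h0 (by rw [← pow_mul, mul_comm, pow_mul, h, one_pow])
  have h3 := pow_gcd_eq_one.2 ⟨h2, h⟩
  rwa [Nat.Coprime.gcd_eq_one ((Nat.Prime.coprime_iff_not_dvd hO.prime).2 hm), pow_one] at h3

variable {G : Type*} [Group G] [Finite G] {k : ℕ} {H : Subgroup G} {t : G}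
  (hG : IsCyclicExtension ℓ k H t) {T : Type*} [AddCommGroup T] [Module O T] [Module.Finite O T]
  [Module.Free O T] {ρ : Representation O G T} {b : T →ₗ[O] T →ₗ[O] O}

include hG in
/-- A lattice with an alternating form whose dual is killed by `ℓ` can be replaced by a symplectic
lattice. -/
theorem hasSymplecticLattice_of_dual (halt : ∀ x, b x x = 0)
    (hinv : ∀ g x y, b (ρ g x) (ρ g y) = b x y) (hinj : Function.Injective b)
    (hdual : ∀ φ : Module.Dual O T, ∃ x, b x = ℓ • φ) :
    HasSymplecticLattice O (finrank O T) {g | g ∈ H → ρ g = 1} := by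
  have hneg : ∀ x y, - b x y = b y x := LinearMap.IsAlt.neg halt
  choose s' hs' using hdual
  -- `s` is ℓ b⁻¹, from the dual module to T.
  obtain ⟨s, hs⟩ : ∃ s : Module.Dual O T →ₗ[O] T, ∀ φ, b (s φ) = ℓ • φ :=
    ⟨{ toFun := s'
       map_add' := fun φ ψ => hinj (by rw [map_add, hs', hs', hs', smul_add])
       map_smul' := fun a φ => hinj (by
        rw [map_smul, hs', hs', RingHom.id_apply, smul_comm]) }, hs'⟩
  have hsb : ∀ x, s (b x) = ℓ • x := fun x => hinj (by rw [hs, map_nsmul])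
  have hsρ : ∀ g φ, s (ρ.dual g φ) = ρ g (s φ) := fun g φ => hinj (LinearMap.ext fun y => by
    rw [hs]
    conv_rhs => rw [← ρ.apply_inv_apply g y]
    rw [hinv, hs]; rfl)
  -- The form ℓ b⁻¹ on the dual module. The residual forms of b and c carry the two symplectic
  -- graded pieces.
  obtain ⟨c, hc⟩ : ∃ c : Module.Dual O T →ₗ[O] Module.Dual O T →ₗ[O] O,
      ∀ φ ψ, c φ ψ = ψ (s φ) := ⟨LinearMap.flip LinearMap.id ∘ₗ s, fun φ ψ => rfl⟩
  have hc' : ∀ φ ψ, ℓ • c φ ψ = - b (s φ) (s ψ) := fun φ ψ => by rw [hc, hneg, hs]; rfl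
  obtain ⟨π₁, hπ₁⟩ := exists_isReduction O T
  obtain ⟨π₂, hπ₂⟩ := exists_isReduction O (Module.Dual O T)
  obtain ⟨σ₁, hσ₁⟩ := hπ₁.exists_representation ρ
  obtain ⟨σ₂, hσ₂⟩ := hπ₂.exists_representation ρ.dual
  obtain ⟨β₁, hβ₁⟩ := hπ₁.exists_bilin b
  obtain ⟨β₂, hβ₂⟩ := hπ₂.exists_bilin c
  have hker₁ : ∀ x, β₁ (π₁ x) = 0 ↔ ∃ φ, b x = ℓ • φ := fun x => by
    constructor
    · intro h
      refine exists_linearMap_eq_nsmul (b x) fun y => exists_of_residue_eq_zero ?_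
      rw [← hβ₁, h]; rfl
    · rintro ⟨φ, hφ⟩
      refine DFunLike.coe_injective (hπ₁.ext fun y => ?_)
      rw [hβ₁, hφ, LinearMap.smul_apply, map_nsmul, nsmul_eq_mul, ← map_natCast (residue O),
        residue_natCast, zero_mul]; rfl
  have hker₂ : ∀ φ, β₂ (π₂ φ) = 0 ↔ ∃ x, φ = b x := fun φ => by
    constructor
    · intro h
      obtain ⟨x, hx⟩ := exists_nsmul_of_forall_dual (ℓ := ℓ) (x := s φ) fun ψ => by
        rw [← hc, ← hβ₂, h]; rfl
      refine ⟨x, nsmul_cancel O ?_⟩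
      rw [← hs, hx, map_nsmul]
    · rintro ⟨x, rfl⟩
      refine DFunLike.coe_injective (hπ₂.ext fun ψ => ?_)
      rw [hβ₂, hc, hsb, map_nsmul, map_nsmul, nsmul_eq_mul, ← map_natCast (residue O),
        residue_natCast, zero_mul]; rfl
  have h₁ := hasSymplecticLattice_of_residue hG _ _ σ₁ β₁
    (fun q => by
      obtain ⟨x, rfl⟩ := hπ₁.surjective q
      rw [hβ₁, halt, map_zero])
    (fun g p q => by
      obtain ⟨x, rfl⟩ := hπ₁.surjective p
      obtain ⟨y, rfl⟩ := hπ₁.surjective q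
      rw [hσ₁, hσ₁, hβ₁, hβ₁, hinv]) rfl
  have h₂ := hasSymplecticLattice_of_residue hG _ _ σ₂ β₂
    (fun q => by
      obtain ⟨φ, rfl⟩ := hπ₂.surjective q
      have : c φ φ = 0 := nsmul_eq_zero (ℓ := ℓ) O (by rw [hc', halt, neg_zero])
      rw [hβ₂, this, map_zero])
    (fun g p q => by
      obtain ⟨φ, rfl⟩ := hπ₂.surjective p
      obtain ⟨ψ, rfl⟩ := hπ₂.surjective q
      have : c (ρ.dual g φ) (ρ.dual g ψ) = c φ ψ :=
        nsmul_cancel O (by rw [hc', hc', hsρ, hsρ, hinv])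
      rw [hσ₂, hσ₂, hβ₂, hβ₂, this]) rfl
  refine (h₁.add h₂).mono ?_ ?_
  -- The reduction `j` of b has the radical of β₁ as kernel and the radical of β₂ as image, so the
  -- ranks of β₁ and β₂ add up to the rank of T.
  · obtain ⟨j, hj⟩ := hπ₁.exists_map (π₂ ∘ₗ b)
    have hj' : ∀ x, j (π₁ x) = π₂ (b x) := hj
    have hkj : LinearMap.ker j = LinearMap.ker β₁ := by
      ext q
      obtain ⟨x, rfl⟩ := hπ₁.surjective q
      rw [LinearMap.mem_ker, LinearMap.mem_ker, hj', hker₁, hπ₂.map_eq_zero_iff]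
    have hrj : LinearMap.range j = LinearMap.ker β₂ := by
      ext q
      obtain ⟨φ, rfl⟩ := hπ₂.surjective q
      rw [LinearMap.mem_ker, hker₂, LinearMap.mem_range]
      constructor
      · rintro ⟨p, hp⟩
        obtain ⟨x, rfl⟩ := hπ₁.surjective p
        rw [hj', ← sub_eq_zero, ← map_sub, hπ₂.map_eq_zero_iff] at hp
        obtain ⟨ψ, hψ⟩ := hp
        refine ⟨x - s ψ, ?_⟩
        rw [map_sub, hs, ← hψ]; abel
      · rintro ⟨x, rfl⟩
        exact ⟨π₁ x, hj' x⟩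
    have e1 := LinearMap.finrank_range_add_finrank_ker j
    have e2 := LinearMap.finrank_range_add_finrank_ker β₁
    have e3 := LinearMap.finrank_range_add_finrank_ker β₂
    have e4 := (Module.finBasis O T).toDualEquiv.finrank_eq
    rw [Module.finrank_fin_fun] at e1 e2 e3
    rw [hkj, hrj] at e1
    omega
  · rintro g ⟨hg1, hg2⟩ hgH
    have h1 : ∀ x, ∃ φ, b ((ρ g - 1) x) = ℓ • φ := fun x => by
      rw [← hker₁, LinearMap.sub_apply, map_sub, map_sub, ← hσ₁, hg1 hgH]
      simp
    have h2 : ∀ φ, ∃ x, (ρ g - 1) (s φ) = ℓ • x := fun φ => by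
      have := (hker₂ (ρ.dual g φ - φ)).1 (by
        rw [map_sub, map_sub, ← hσ₂, hg2 hgH, sub_self])
      obtain ⟨x, hx⟩ := this
      refine ⟨x, ?_⟩
      rw [← hsb, ← hx, map_sub, hsρ]; rfl
    -- Triviality on the first piece puts the image of g - 1 in the image of `s`; triviality on the
    -- second sends that image into ℓT.
    obtain ⟨w, hw⟩ := exists_linearMap_eq_nsmul (ℓ := ℓ) ((ρ g - 1) ^ 3 : End O T) fun x => by
      obtain ⟨φ, hφ⟩ := h1 x
      obtain ⟨y, hy⟩ := h2 φ
      have hxs : (ρ g - 1) x = s φ := hinj (by rw [hφ, hs])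
      exact ⟨(ρ g - 1) y, by
        rw [pow_succ', pow_succ', pow_one, Module.End.mul_apply, Module.End.mul_apply, hxs, hy,
          map_nsmul]⟩
    refine eq_one_of_unipotent_mod (O := O) (r := 3) (by have := hO.five_le; omega) hw hG.not_dvd ?_
    have h3 : (⟨g, hgH⟩ : H) ^ Nat.card H = 1 := pow_card_eq_one'
    have h4 : g ^ Nat.card H = 1 := congrArg Subtype.val h3
    rw [← map_pow, h4, map_one]

end AbsolutelyUnramified

/-! ### Stable lattices in a representation over the fraction field. -/

namespace AbsolutelyUnramified

variable {ℓ : ℕ} {O : Type*} [CommRing O] [IsDomain O] [IsDiscreteValuationRing O]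
  [hO : AbsolutelyUnramified ℓ O] {K : Type*} [Field K] [Algebra O K] [IsFractionRing O K]
  {V : Type*} [AddCommGroup V] [Module K V] [Module O V] [IsScalarTower O K V]
  [Module.Finite K V]

variable (O) in
omit [Module.Finite K V] in
include hO in
theorem exists_pow_nsmul_eq_algebraMap (c : K) : ∃ (m : ℕ) (a : O), algebraMap O K a = ℓ ^ m • c := by
  have hirr : Irreducible (ℓ : O) :=
    (IsDiscreteValuationRing.irreducible_iff_uniformizer _).2 hO.maximalIdeal_eq
  obtain ⟨⟨p, q⟩, hpq⟩ := IsLocalization.surj (nonZeroDivisors O) c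
  obtain ⟨m, u, hu⟩ := IsDiscreteValuationRing.eq_unit_mul_pow_irreducible
    (nonZeroDivisors.ne_zero q.2) hirr
  refine ⟨m, (u⁻¹ : Oˣ) * p, ?_⟩
  simp only [hu] at hpq
  rw [map_mul, ← hpq, map_mul, map_pow, map_natCast, nsmul_eq_mul, Nat.cast_pow, mul_left_comm,
    ← mul_assoc (algebraMap O K _), ← map_mul, Units.inv_mul, map_one, one_mul, mul_comm]

variable {G : Type*} [Group G]

section Stable

/-- A lattice stable under the group. -/
structure IsStableLattice (ρ : Representation K G V) (T : Submodule O V) : Prop where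
  isLattice : T.IsLattice K
  stable : ∀ g, ∀ x ∈ T, ρ g x ∈ T

-- The set s is the orbit of a basis. The scaling a is left free, to be used later to clear the
-- denominators of the form.
variable (O) in
omit [IsDomain O] [IsDiscreteValuationRing O] hO [IsFractionRing O K] in
theorem exists_isStableLattice_span [Finite G] (ρ : Representation K G V) :
    ∃ s : Set V, s.Finite ∧ ∀ a : O, algebraMap O K a ≠ 0 →
      IsStableLattice ρ (Submodule.span O ((fun x => a • x) '' s)) := by
  let e := Module.finBasis K V
  refine ⟨Set.range fun p : G × Fin (finrank K V) => ρ p.1 (e p.2), Set.finite_range _,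
    fun a ha => ⟨⟨Submodule.fg_span ((Set.finite_range _).image _), ?_⟩, fun g => ?_⟩⟩
  · rw [eq_top_iff, ← e.span_eq, Submodule.span_le]
    rintro _ ⟨i, rfl⟩
    have h1 : a • e i ∈ Submodule.span K (Submodule.span O ((fun x => a • x) ''
        Set.range fun p : G × Fin (finrank K V) => ρ p.1 (e p.2)) : Set V) :=
      Submodule.subset_span (Submodule.subset_span ⟨_, ⟨(1, i), rfl⟩, by simp⟩)
    have h2 := Submodule.smul_mem _ (algebraMap O K a)⁻¹ h1
    rwa [← algebraMap_smul K a, smul_smul, inv_mul_cancel₀ ha, one_smul] at h2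
  · change Submodule.span O _ ≤ (Submodule.span O _).comap ((ρ g).restrictScalars O)
    rw [Submodule.span_le]
    rintro _ ⟨_, ⟨⟨h, i⟩, rfl⟩, rfl⟩
    refine Submodule.subset_span ⟨_, ⟨(g * h, i), rfl⟩, ?_⟩
    simp only [map_mul, Module.End.mul_apply, LinearMap.restrictScalars_apply]
    rw [← algebraMap_smul K a, ← algebraMap_smul K a, map_smul]

variable {ρ : Representation K G V} {T : Submodule O V}

omit [Module.Finite K V] [IsDomain O] [IsDiscreteValuationRing O] hO [IsFractionRing O K] in
theorem IsStableLattice.finite (hT : IsStableLattice ρ T) : Module.Finite O T :=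
  have := hT.isLattice
  Submodule.IsLattice.finite K T

variable (O K) in
omit [Module.Finite K V] [IsDiscreteValuationRing O] hO in
include K in
theorem isTorsionFree_of_isFractionRing : Module.IsTorsionFree O V := by
  refine Module.isTorsionFree_iff_smul_eq_zero.2 fun r m h => ?_
  rw [← algebraMap_smul K, smul_eq_zero] at h
  exact h.imp_left ((map_eq_zero_iff _ (IsFractionRing.injective O K)).1)

omit [Module.Finite K V] hO in
theorem IsStableLattice.free (hT : IsStableLattice ρ T) : Module.Free O T := by
  have := hT.finite
  have : Module.IsTorsionFree O V := isTorsionFree_of_isFractionRing O K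
  infer_instance

omit [Module.Finite K V] hO in
theorem IsStableLattice.finrank_eq (hT : IsStableLattice ρ T) : finrank O T = finrank K V := by
  have := hT.isLattice
  have := hT.finite
  have := hT.free
  have b := (Module.finBasis O T).extendOfIsLattice K
  rw [finrank_eq_card_basis b, Fintype.card_fin]

omit [Module.Finite K V] [IsDomain O] [IsDiscreteValuationRing O] hO [IsFractionRing O K] in
theorem IsStableLattice.exists_representation (hT : IsStableLattice ρ T) :
    ∃ α : Representation O G T, ∀ g x, (α g x : V) = ρ g x :=
  ⟨{ toFun := fun g => ((ρ g).restrictScalars O).restrict (hT.stable g)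
     map_one' := by ext; simp
     map_mul' := fun g h => LinearMap.ext fun x => Subtype.ext
      (LinearMap.congr_fun (map_mul ρ g h) (x : V)) }, fun g x => rfl⟩

omit [Module.Finite K V] [IsDomain O] [IsDiscreteValuationRing O] hO [IsFractionRing O K] in
theorem IsStableLattice.ext_on (hT : IsStableLattice ρ T) {W : Type*} [AddCommGroup W] [Module K W]
    {f g : V →ₗ[K] W} (h : ∀ x ∈ T, f x = g x) : f = g := by
  refine LinearMap.ext fun x => ?_
  have hx : x ∈ Submodule.span K (T : Set V) := hT.isLattice.span_eq_top ▸ Submodule.mem_top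
  induction hx using Submodule.span_induction with
  | mem x hx => exact h x hx
  | zero => simp
  | add x y _ _ hx hy => rw [map_add, map_add, hx, hy]
  | smul a x _ hx => rw [map_smul, map_smul, hx]

omit [Module.Finite K V] in
include ℓ in
theorem exists_pow_nsmul_mem_of_mem_span {x : V} (hx : x ∈ Submodule.span K (T : Set V)) :
    ∃ m, ℓ ^ m • x ∈ T := by
  induction hx using Submodule.span_induction with
  | mem x hx => exact ⟨0, by simpa using hx⟩
  | zero => exact ⟨0, by simp⟩
  | add x y _ _ hx hy =>
    obtain ⟨m, hm⟩ := hx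
    obtain ⟨n, hn⟩ := hy
    refine ⟨m + n, ?_⟩
    rw [smul_add, pow_add]
    nth_rewrite 1 [mul_comm]
    rw [mul_smul, mul_smul]
    exact T.add_mem (T.nsmul_mem hm _) (T.nsmul_mem hn _)
  | smul c x _ hx =>
    obtain ⟨m, hm⟩ := hx
    obtain ⟨n, a, ha⟩ := exists_pow_nsmul_eq_algebraMap O c
    refine ⟨n + m, ?_⟩
    have : ℓ ^ (n + m) • c • x = a • ℓ ^ m • x := by
      rw [← algebraMap_smul K a, ha, pow_add, mul_smul, smul_comm _ c x, smul_assoc]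
    rw [this]
    exact T.smul_mem a hm

omit [Module.Finite K V] in
include ℓ in
theorem IsStableLattice.exists_pow_nsmul_mem (hT : IsStableLattice ρ T) (x : V) :
    ∃ m, ℓ ^ m • x ∈ T :=
  exists_pow_nsmul_mem_of_mem_span (K := K) (by rw [hT.isLattice.span_eq_top]; trivial)

variable (O) in
omit [IsDomain O] [IsDiscreteValuationRing O] hO [IsFractionRing O K] in
theorem exists_isStableLattice [Finite G] (ρ : Representation K G V) :
    ∃ T : Submodule O V, IsStableLattice ρ T := by
  obtain ⟨s, -, hs⟩ := exists_isStableLattice_span O ρ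
  exact ⟨_, hs 1 (by simp)⟩

end Stable

/-! ### Maximal integral lattices and their duals. -/

section Integral

/-- A stable lattice on which the form has integral values. -/
structure IsIntegralLattice (ρ : Representation K G V) (b : V →ₗ[K] V →ₗ[K] K)
    (T : Submodule O V) : Prop extends IsStableLattice ρ T where
  integral : ∀ x ∈ T, ∀ y ∈ T, b x y ∈ LinearMap.range (Algebra.linearMap O K)

variable {ρ : Representation K G V} {b : V →ₗ[K] V →ₗ[K] K} {T : Submodule O V}

variable (O b) in
/-- The dual of a lattice. -/
def dualLattice (T : Submodule O V) : Submodule O V :=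
  ⨅ y ∈ T, (LinearMap.range (Algebra.linearMap O K)).comap ((b.flip y).restrictScalars O)

omit [IsDomain O] [IsDiscreteValuationRing O] hO [IsFractionRing O K] [Module.Finite K V] in
theorem mem_dualLattice {x : V} :
    x ∈ dualLattice O b T ↔ ∀ y ∈ T, b x y ∈ LinearMap.range (Algebra.linearMap O K) := by
  simp only [dualLattice, Submodule.mem_iInf]
  rfl

omit [IsDomain O] [IsDiscreteValuationRing O] hO in
theorem exists_isIntegralLattice [Finite G] (ρ : Representation K G V) (b : V →ₗ[K] V →ₗ[K] K)
    [Nontrivial O] :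
    ∃ T : Submodule O V, IsIntegralLattice ρ b T := by
  obtain ⟨s, hfin, hs⟩ := exists_isStableLattice_span O ρ
  have := (hfin.prod hfin).to_subtype
  obtain ⟨⟨a, ha⟩, hab⟩ := IsLocalization.exist_integer_multiples_of_finite (nonZeroDivisors O)
    (fun p : (s ×ˢ s : Set (V × V)) => b p.1.1 p.1.2)
  have ha0 : algebraMap O K a ≠ 0 := by
    rw [Ne, map_eq_zero_iff _ (IsFractionRing.injective O K)]
    exact nonZeroDivisors.ne_zero ha
  refine ⟨_, hs a ha0, fun x hx => ?_⟩
  change _ ≤ (LinearMap.range (Algebra.linearMap O K)).comap ((b x).restrictScalars O)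
  rw [Submodule.span_le]
  rintro _ ⟨y, hy, rfl⟩
  refine (?_ : _ ≤ (LinearMap.range (Algebra.linearMap O K)).comap
    ((b.flip (a • y)).restrictScalars O)) hx
  rw [Submodule.span_le]
  rintro _ ⟨x, hx, rfl⟩
  obtain ⟨c, hc⟩ := hab ⟨(x, y), hx, hy⟩
  refine ⟨a * c, ?_⟩
  simp only [LinearMap.restrictScalars_apply, LinearMap.flip_apply]
  rw [← algebraMap_smul K a x, ← algebraMap_smul K a y, map_smul, map_smul, LinearMap.smul_apply,
    smul_eq_mul, smul_eq_mul, Algebra.linearMap_apply, map_mul, hc]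
  simp [Algebra.smul_def]

omit [IsDomain O] [IsDiscreteValuationRing O] hO [Module.Finite K V] in
theorem IsIntegralLattice.exists_form (hT : IsIntegralLattice ρ b T) :
    ∃ bT : T →ₗ[O] T →ₗ[O] O, ∀ x y, algebraMap O K (bT x y) = b x y := by
  choose f hf using fun x y : T => hT.integral x x.2 y y.2
  have hf' : ∀ x y, algebraMap O K (f x y) = b x y := hf
  have hinj := IsFractionRing.injective O K
  refine ⟨LinearMap.mk₂ O f (fun x y z => hinj ?_) (fun a x y => hinj ?_) (fun x y z => hinj ?_)
    (fun a x y => hinj ?_), hf'⟩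
  · simp [hf']
  · simp only [hf', smul_eq_mul, map_mul, Submodule.coe_smul]
    rw [← algebraMap_smul K a, map_smul, LinearMap.smul_apply, smul_eq_mul]
  · simp [hf']
  · simp only [hf', smul_eq_mul, map_mul, Submodule.coe_smul]
    rw [← algebraMap_smul K a, map_smul, smul_eq_mul]

omit [Module.Finite K V] hO in
theorem IsStableLattice.exists_eq_dual (hT : IsStableLattice ρ T) (hb : IsSymplecticForm b)
    (φ : Module.Dual O T) : ∃ v, ∀ y : T, b v y = algebraMap O K (φ y) := by
  have := hT.isLattice
  have := hT.finite
  have := hT.free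
  let e := Module.finBasis O T
  let e' := e.extendOfIsLattice K
  have he' : ∀ i, e' i = (e i : V) := fun i => e.extendOfIsLattice_apply K i
  obtain ⟨v, hv⟩ := hb.exists_eq (e'.constr K fun i => algebraMap O K (φ (e i)))
  refine ⟨v, fun y => ?_⟩
  have h1 : (b v).restrictScalars O ∘ₗ T.subtype = Algebra.linearMap O K ∘ₗ φ :=
    e.ext fun i => by
      simp only [LinearMap.comp_apply, LinearMap.restrictScalars_apply, Submodule.subtype_apply,
        hv, ← he', Basis.constr_basis, Algebra.linearMap_apply]
  exact LinearMap.congr_fun h1 y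

-- The form embeds the dual lattice into the finite free module of linear functionals on T.
omit [Module.Finite K V] hO in
theorem IsStableLattice.isNoetherian_dualLattice (hT : IsStableLattice ρ T)
    (hb : IsSymplecticForm b) : IsNoetherian O (dualLattice O b T) := by
  have := hT.finite
  have := hT.free
  choose f hf using fun (x : dualLattice O b T) (y : T) => mem_dualLattice.1 x.2 y y.2
  have hf' : ∀ x y, algebraMap O K (f x y) = b x y := hf
  have hinj := IsFractionRing.injective O K
  let F : dualLattice O b T →ₗ[O] (T →ₗ[O] O) :=
    LinearMap.mk₂ O f (fun x y z => hinj (by simp [hf']))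
      (fun a x y => hinj (by
        simp only [hf', smul_eq_mul, map_mul, Submodule.coe_smul]
        rw [← algebraMap_smul K a, map_smul, LinearMap.smul_apply, smul_eq_mul]))
      (fun x y z => hinj (by simp [hf']))
      (fun a x y => hinj (by
        simp only [hf', smul_eq_mul, map_mul, Submodule.coe_smul]
        rw [← algebraMap_smul K a, map_smul, smul_eq_mul]))
  refine isNoetherian_of_injective F ((injective_iff_map_eq_zero F).2 fun x hx => ?_)
  refine Subtype.ext (hb.eq_zero_of_left fun y => ?_)
  have : b x = 0 := hT.ext_on fun y hy => by
    rw [← hf' x ⟨y, hy⟩]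
    have : f x ⟨y, hy⟩ = 0 := LinearMap.congr_fun hx ⟨y, hy⟩
    rw [this, map_zero, LinearMap.zero_apply]
  rw [this, LinearMap.zero_apply]

/-- A maximal integral lattice. -/
structure IsMaximalLattice (ρ : Representation K G V) (b : V →ₗ[K] V →ₗ[K] K)
    (T : Submodule O V) : Prop extends IsIntegralLattice ρ b T where
  maximal : ∀ T', IsIntegralLattice ρ b T' → T ≤ T' → T' = T

-- All integral lattices containing T lie in the dual of T, which is Noetherian.
omit [Module.Finite K V] hO in
theorem IsIntegralLattice.exists_isMaximalLattice (hT : IsIntegralLattice ρ b T)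
    (hb : IsSymplecticForm b) : ∃ T', T ≤ T' ∧ IsMaximalLattice ρ b T' := by
  have := hT.isNoetherian_dualLattice hb
  let D := dualLattice O b T
  have hle : ∀ T', IsIntegralLattice ρ b T' → T ≤ T' → (T'.comap D.subtype).map D.subtype = T' :=
    fun T' hT' h => by
      rw [Submodule.map_comap_subtype, inf_eq_right]
      exact fun x hx => mem_dualLattice.2 fun y hy => hT'.integral x hx y (h hy)
  obtain ⟨N, ⟨hN, hTN⟩, hmax⟩ := (wellFounded_gt (α := Submodule O D)).has_min
    {N | IsIntegralLattice ρ b (N.map D.subtype) ∧ T ≤ N.map D.subtype}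
    ⟨T.comap D.subtype, by rw [Set.mem_ofPred_eq, hle T hT le_rfl]; exact ⟨hT, le_rfl⟩⟩
  refine ⟨_, hTN, hN, fun T' hT' hNT' => ?_⟩
  have h1 := hle T' hT' (hTN.trans hNT')
  have h2 := hmax (T'.comap D.subtype) (by
    rw [Set.mem_ofPred_eq, h1]; exact ⟨hT', hTN.trans hNT'⟩)
  have h3 : N ≤ T'.comap D.subtype := Submodule.map_le_iff_le_comap.1 hNT'
  rw [← h1, eq_of_le_of_not_lt h3 h2]

omit [IsDomain O] [IsDiscreteValuationRing O] hO [IsFractionRing O K] [Module.Finite K V] in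
theorem IsStableLattice.stable_dualLattice (hT : IsStableLattice ρ T)
    (hinv : ∀ g x y, b (ρ g x) (ρ g y) = b x y) (g : G) (x : V) (hx : x ∈ dualLattice O b T) :
    ρ g x ∈ dualLattice O b T := mem_dualLattice.2 fun y hy => by
  rw [← ρ.apply_inv_apply g y, hinv]
  exact mem_dualLattice.1 hx _ (hT.stable _ _ hy)

omit [Module.Finite K V] in
include ℓ in
/-- The dual of a maximal integral lattice is killed by `ℓ`. -/
theorem IsMaximalLattice.nsmul_mem (hT : IsMaximalLattice ρ b T) (hb : IsSymplecticRep ρ b) {x : V}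
    (hx : x ∈ dualLattice O b T) : ℓ • x ∈ T := by
  classical
  have hN := hT.isNoetherian_dualLattice hb.form
  have hex : ∃ e, ∀ x ∈ dualLattice O b T, ℓ ^ e • x ∈ T := by
    obtain ⟨s, hs⟩ := (isNoetherian_submodule.1 hN) _ le_rfl
    choose m hm using hT.exists_pow_nsmul_mem
    refine ⟨s.sup m, fun x hx => ?_⟩
    rw [← hs] at hx
    induction hx using Submodule.span_induction with
    | mem x hx =>
      rw [← Nat.sub_add_cancel (Finset.le_sup hx : m x ≤ _), pow_add, mul_smul]
      exact T.nsmul_mem (hm x) _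
    | zero => simp
    | add x y _ _ hx hy => rw [smul_add]; exact T.add_mem hx hy
    | smul a x _ hx => rw [smul_comm]; exact T.smul_mem a hx
  obtain ⟨e, he, hmin⟩ : ∃ e, (∀ x ∈ dualLattice O b T, ℓ ^ e • x ∈ T) ∧
      ∀ m < e, ¬ ∀ x ∈ dualLattice O b T, ℓ ^ m • x ∈ T :=
    ⟨Nat.find hex, Nat.find_spec hex, fun m hm => Nat.find_min hex hm⟩
  rcases Nat.lt_or_ge 1 e with h1 | h1
  · exfalso
    refine hmin (e - 1) (by omega) fun x hx => ?_
    -- Let e be the least exponent with ℓ^e T* ⊆ T. If e ≥ 2 then 2(e - 1) ≥ e, so the form is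
    -- integral on T + ℓ^(e-1) T*; maximality puts ℓ^(e-1) T* into T, against the choice of e.
    let D := (dualLattice O b T).map (LinearMap.lsmul O V ((ℓ ^ (e - 1) : ℕ) : O))
    have hD : ∀ z, z ∈ D ↔ ∃ x ∈ dualLattice O b T, ℓ ^ (e - 1) • x = z := fun z => by
      simp only [D, Submodule.mem_map, LinearMap.lsmul_apply, Nat.cast_smul_eq_nsmul]
    have hDD : ∀ x ∈ D, ∀ y ∈ D, b x y ∈ LinearMap.range (Algebra.linearMap O K) := by
      intro x hx y hy
      obtain ⟨x, hxD, rfl⟩ := (hD _).1 hx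
      obtain ⟨y, hyD, rfl⟩ := (hD _).1 hy
      have h2 : b (ℓ ^ (e - 1) • x) (ℓ ^ (e - 1) • y) =
          ℓ ^ (e - 1 + (e - 1) - e) • b x (ℓ ^ e • y) := by
        simp only [map_nsmul, LinearMap.smul_apply, smul_smul, ← pow_add]
        congr 2
        omega
      rw [h2]
      exact _root_.nsmul_mem (mem_dualLattice.1 hxD _ (he y hyD)) _
    have hDT : ∀ x ∈ D, ∀ y ∈ T, b x y ∈ LinearMap.range (Algebra.linearMap O K) := by
      intro x hx y hy
      obtain ⟨x, hxD, rfl⟩ := (hD x).1 hx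
      rw [map_nsmul]
      exact _root_.nsmul_mem (mem_dualLattice.1 hxD y hy) _
    have := hT.isLattice
    have hDfg : D.FG := ((isNoetherian_submodule.1 hN) _ le_rfl).map _
    have hlat : IsIntegralLattice ρ b (T ⊔ D) := by
      refine ⟨⟨Submodule.IsLattice.of_le_of_isLattice_of_fg K le_sup_left
        (Submodule.FG.sup hT.isLattice.fg hDfg), fun g x hx => ?_⟩, fun x hx y hy => ?_⟩
      · obtain ⟨y, hy, _, hzD, rfl⟩ := Submodule.mem_sup.1 hx
        obtain ⟨z, hz, rfl⟩ := (hD _).1 hzD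
        rw [map_add]
        refine Submodule.add_mem_sup (hT.stable g y hy) ((hD _).2 ⟨ρ g z, ?_, by rw [map_nsmul]⟩)
        exact hT.stable_dualLattice hb.invariant g z hz
      · obtain ⟨x, hxT, x', hxD, rfl⟩ := Submodule.mem_sup.1 hx
        obtain ⟨y, hyT, y', hyD, rfl⟩ := Submodule.mem_sup.1 hy
        simp only [map_add, LinearMap.add_apply]
        refine Submodule.add_mem _ (Submodule.add_mem _ (hT.integral x hxT y hyT) (hDT x' hxD y hyT))
          (Submodule.add_mem _ ?_ (hDD x' hxD y' hyD))
        rw [← hb.form.neg]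
        exact Submodule.neg_mem _ (hDT y' hyD x hxT)
    have heq := hT.maximal _ hlat le_sup_left
    have : ℓ ^ (e - 1) • x ∈ T ⊔ D := Submodule.mem_sup_right ((hD _).2 ⟨x, hx, rfl⟩)
    rwa [heq] at this
  · have h2 := he x hx
    interval_cases e
    · exact T.nsmul_mem (by simpa using h2) _
    · simpa using h2

variable [Finite G] {k : ℕ} {H : Subgroup G} {t : G} (hG : IsCyclicExtension ℓ k H t)

variable (O) in
include hG in
/-- A symplectic representation of `G` over the fraction field gives a symplectic lattice of the
same rank on which the kernel in `H` does not grow. -/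
theorem hasSymplecticLattice_of_isSymplecticRep (hb : IsSymplecticRep ρ b) :
    HasSymplecticLattice O (finrank K V) {g | g ∈ H → ρ g = 1} := by
  obtain ⟨T₀, hT₀⟩ := exists_isIntegralLattice (O := O) ρ b
  obtain ⟨T, -, hT⟩ := hT₀.exists_isMaximalLattice hb.form
  have := hT.finite
  have := hT.free
  obtain ⟨α, hα⟩ := hT.exists_representation
  obtain ⟨bT, hbT⟩ := hT.exists_form
  have hinj := IsFractionRing.injective O K
  refine (hasSymplecticLattice_of_dual hG (ρ := α) (b := bT) (fun x => hinj ?_)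
    (fun g x y => hinj ?_) ?_ fun φ => ?_).mono hT.finrank_eq.le fun g hg hgH =>
      hT.ext_on fun x hx => ?_
  · rw [hbT, hb.form.1, map_zero]
  · rw [hbT, hbT, hα, hα, hb.invariant]
  · refine (injective_iff_map_eq_zero bT).2 fun x hx => Subtype.ext
      (hb.form.eq_zero_of_left fun y => ?_)
    have : b x = 0 := hT.ext_on fun y hy => by
      rw [← hbT x ⟨y, hy⟩, hx, LinearMap.zero_apply, LinearMap.zero_apply, map_zero]
    rw [this, LinearMap.zero_apply]
  · obtain ⟨v, hv⟩ := hT.exists_eq_dual hb.form φ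
    refine ⟨⟨ℓ • v, hT.nsmul_mem hb (mem_dualLattice.2 fun y hy => ⟨_, (hv ⟨y, hy⟩).symm⟩)⟩,
      LinearMap.ext fun y => hinj ?_⟩
    rw [hbT, map_nsmul, LinearMap.smul_apply, LinearMap.smul_apply, map_nsmul, hv]
  · have := congrArg Subtype.val (LinearMap.congr_fun (hg hgH) ⟨x, hx⟩)
    rw [hα] at this
    exact this

end Integral

end AbsolutelyUnramified

/-! ### Linear algebra: equal Jordan blocks, parity of dimension, unipotent elements. -/

section Field

variable {F V : Type*} [Field F] [AddCommGroup V] [Module F V] [Module.Finite F V]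

/-- An operator whose Jordan blocks all have size `m`. -/
theorem finrank_eq_mul_finrank_ker {N : End F V} {m : ℕ} (hN : N ^ m = 0)
    (h : LinearMap.ker N ≤ LinearMap.range (N ^ (m - 1))) :
    finrank F V = m * finrank F (LinearMap.ker N) := by
  -- N^i maps ker N^(i+1) onto ker N with kernel ker N^i: a vector N^(m-1) w of ker N is N^i applied
  -- to N^(m-1-i) w.
  have hstep : ∀ i ≤ m, finrank F (LinearMap.ker (N ^ i)) = i * finrank F (LinearMap.ker N) := by
    intro i
    induction i with
    | zero =>
      intro _
      have : LinearMap.ker (N ^ 0) = ⊥ := LinearMap.ker_eq_bot.2 fun x y h => h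
      rw [this, finrank_bot, zero_mul]
    | succ i ih =>
      intro hi
      have hle : LinearMap.ker (N ^ i) ≤ LinearMap.ker (N ^ (i + 1)) := fun x hx => by
        rw [LinearMap.mem_ker] at hx ⊢
        rw [pow_succ', Module.End.mul_apply, hx, map_zero]
      have h1 := LinearMap.finrank_range_add_finrank_ker
        ((N ^ i).domRestrict (LinearMap.ker (N ^ (i + 1))))
      have hr : LinearMap.range ((N ^ i).domRestrict (LinearMap.ker (N ^ (i + 1)))) =
          LinearMap.ker N := by
        apply le_antisymm
        · rintro _ ⟨⟨x, hx⟩, rfl⟩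
          rw [LinearMap.mem_ker, pow_succ', Module.End.mul_apply] at hx
          exact hx
        · intro x hx
          obtain ⟨w, rfl⟩ := h hx
          refine ⟨⟨(N ^ (m - 1 - i)) w, ?_⟩, ?_⟩
          · rw [LinearMap.mem_ker, ← Module.End.mul_apply, ← pow_add,
              show i + 1 + (m - 1 - i) = m by omega, hN, LinearMap.zero_apply]
          · rw [LinearMap.domRestrict_apply, ← Module.End.mul_apply, ← pow_add,
              show i + (m - 1 - i) = m - 1 by omega]
      have hk : finrank F (LinearMap.ker ((N ^ i).domRestrict (LinearMap.ker (N ^ (i + 1))))) =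
          finrank F (LinearMap.ker (N ^ i)) := by
        rw [LinearMap.ker_domRestrict]
        exact (Submodule.comapSubtypeEquivOfLe hle).finrank_eq
      rw [hr, hk, ih (by omega)] at h1
      rw [← h1]; ring
  rw [← hstep m le_rfl, hN, LinearMap.ker_zero, finrank_top]

/-- A skew-symmetric matrix of odd size has determinant zero when 2 is invertible. -/
theorem IsSymplecticForm.even_finrank {b : V →ₗ[F] V →ₗ[F] F} (hb : IsSymplecticForm b)
    (h2 : (2 : F) ≠ 0) : Even (finrank F V) := by
  let e := Module.finBasis F V
  let A := LinearMap.BilinForm.toMatrix e b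
  have hdet : A.det ≠ 0 := (LinearMap.BilinForm.nondegenerate_iff_det_ne_zero e).1 hb.nondegenerate
  have hskew : A.transpose = -A := by
    ext i j
    simp only [A, Matrix.transpose_apply, Matrix.neg_apply, LinearMap.BilinForm.toMatrix_apply]
    exact (hb.neg _ _).symm
  have h1 := congrArg Matrix.det hskew
  rw [Matrix.det_transpose, Matrix.det_neg, Fintype.card_fin] at h1
  by_contra hodd
  rw [Nat.not_even_iff_odd] at hodd
  rw [hodd.neg_one_pow, neg_one_mul, ← sub_eq_zero, sub_neg_eq_add, ← two_mul] at h1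
  exact (mul_ne_zero h2 hdet) h1

/-- In characteristic zero, a unipotent element of finite order is trivial. -/
theorem eq_one_of_sub_one_pow_of_charZero [CharZero F] {A : Type*} [Ring A] [Algebra F A] {x : A}
    {r m : ℕ} (hx : (x - 1) ^ r = 0) (hm : m ≠ 0) (h : x ^ m = 1) : x = 1 := by
  open Polynomial in
  have hc : IsCoprime (X - C 1 : F[X]) (∑ i ∈ Finset.range m, X ^ i) := by
    refine (irreducible_X_sub_C (1 : F)).coprime_iff_not_dvd.2 fun hd => ?_
    rw [dvd_iff_isRoot, IsRoot.def, eval_finsetSum] at hd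
    simp only [eval_pow, eval_X, one_pow, Finset.sum_const, Finset.card_range, nsmul_one] at hd
    exact hm (by exact_mod_cast hd)
  obtain ⟨p, q, hpq⟩ := hc.pow_left (m := r)
  have h1 := congrArg (Polynomial.aeval x) hpq
  simp only [map_add, map_mul, map_pow, map_sub, map_one, map_sum, Polynomial.aeval_X, hx, mul_zero,
    zero_add] at h1
  have h2 := geom_sum_mul x m
  rw [h, sub_self] at h2
  have h3 := congrArg (fun y => y * (x - 1)) h1
  simp only [mul_assoc, h2, mul_zero, one_mul] at h3
  exact sub_eq_zero.1 h3.symm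

end Field

namespace AbsolutelyUnramified

variable {ℓ : ℕ} {O : Type*} [CommRing O] [IsDomain O] [IsDiscreteValuationRing O]
  [hO : AbsolutelyUnramified ℓ O] {G : Type*} [Group G] [Finite G] {k : ℕ} {H : Subgroup G} {t : G}
  (hG : IsCyclicExtension ℓ k H t)

include hG

/-- Every modular representation of dimension `e` gives a symplectic lattice of rank `2 e`. -/
theorem hasSymplecticLattice_two_mul {X : Type*} [AddCommGroup X] [Module (ResidueField O) X]
    [Module.Finite (ResidueField O) X] (σ : Representation (ResidueField O) G X) :
    HasSymplecticLattice O (2 * finrank (ResidueField O) X) {g | g ∈ H → σ g = 1} := by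
  obtain ⟨B, hB⟩ := exists_isSymplecticRep_prod_dual σ
  refine (hasSymplecticLattice_of_residue hG _ _ (σ.prod σ.dual) B hB.form.1 hB.invariant rfl).mono
    ?_ fun g hg hgH => LinearMap.ext fun x => ?_
  · rw [LinearMap.finrank_range_of_inj hB.form.bijective.1, Module.finrank_prod,
      Subspace.dual_finrank_eq, two_mul]
  · exact congrArg Prod.fst (hB.form.bijective.1 (hg hgH (x, 0)))

end AbsolutelyUnramified

/-! ### The cyclotomic symplectic lattice. -/

namespace AbsolutelyUnramified

variable {ℓ : ℕ} {O : Type*} [CommRing O] [IsDomain O] [IsDiscreteValuationRing O]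
  [hO : AbsolutelyUnramified ℓ O] {G : Type*} [Group G] [Finite G] {k : ℕ} {H : Subgroup G} {t : G}

section Shift

variable {n s r : ℕ} [NeZero n] [NeZero s]

/-- A function on `ℤ / r s` with vanishing sums over the cosets of `s` is a difference. -/
theorem exists_sub_shift_eq {A : Type*} [AddCommGroup A] (hn : n = r * s) (a : ZMod n → A)
    (ha : ∀ j : ℕ, ∑ i ∈ Finset.range r, a (j + i * s : ℕ) = 0) :
    ∃ F : ZMod n → A, ∀ j, F j - F (j + s) = a j := by
  have hs : 0 < s := Nat.pos_of_ne_zero (NeZero.ne s)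
  -- Minus the partial sums along each coset, begun at its representative below s; the vanishing of
  -- the full sum settles the wrap-around.
  refine ⟨fun j => - ∑ i ∈ Finset.range (j.val / s), a (j.val % s + i * s : ℕ), fun j => ?_⟩
  have hj : a (j.val % s + j.val / s * s : ℕ) = a j := by
    rw [mul_comm, Nat.mod_add_div, ZMod.natCast_zmod_val]
  have hlt : j.val < r * s := hn ▸ j.val_lt
  have hdiv : j.val / s < r := (Nat.div_lt_iff_lt_mul hs).2 hlt
  have hval : (j + (s : ZMod n)).val = (j.val + s) % n := by
    rw [ZMod.val_add, ZMod.val_natCast, Nat.add_mod_mod]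
  beta_reduce
  rcases Nat.lt_or_ge (j.val + s) n with h | h
  · rw [hval, Nat.mod_eq_of_lt h, Nat.add_div_right _ hs, Nat.add_mod_right, Finset.sum_range_succ, hj]
    abel
  · have h1 : j.val / s + 1 = r := by
      refine le_antisymm hdiv ?_
      rw [← Nat.add_div_right _ hs]
      exact (Nat.le_div_iff_mul_le hs).2 (hn ▸ h)
    have h2 : (j.val + s) % n = j.val + s - n := by
      rw [Nat.mod_eq_sub_mod h, Nat.mod_eq_of_lt]
      have : s ≤ n := by rw [hn]; exact Nat.le_mul_of_pos_left s (h1 ▸ Nat.succ_pos _)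
      have := j.val_lt
      omega
    have h3 : (j.val + s - n) / s = 0 := Nat.div_eq_of_lt (by omega)
    have h4 := ha (j.val % s)
    rw [← h1, Finset.sum_range_succ, hj] at h4
    rw [hval, h2, h3, Finset.sum_range_zero, neg_zero, sub_zero]
    exact (eq_neg_of_add_eq_zero_right h4).symm

end Shift

include hO in
/-- The symplectic lattice of rank `φ(ℓ ^ k)` of a cyclic group of order `ℓ ^ k`. -/
theorem hasSymplecticLattice_cyclotomic (hG : IsCyclicExtension ℓ (k + 1) H t) :
    HasSymplecticLattice O (ℓ ^ (k + 1) - ℓ ^ k) {g : G | g ≠ t ^ ℓ ^ k} := by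
  have hp := hO.prime
  have := hG.normal
  have : NeZero (ℓ ^ k) := ⟨(pow_pos hp.pos _).ne'⟩
  have : NeZero (ℓ ^ (k + 1)) := ⟨(pow_pos hp.pos _).ne'⟩
  set s := ℓ ^ k with hs
  set n := ℓ ^ (k + 1) with hn
  have hns : n = ℓ * s := pow_succ' ℓ k
  -- A half of s exists because n is odd. It makes the difference operator `D` symmetric about each
  -- point, hence skew for the standard scalar product, with the s-periodic functions as kernel.
  obtain ⟨h, hh⟩ : ∃ h : ZMod n, h + h = (s : ZMod n) := by
    obtain ⟨m, hm⟩ := (hp.odd_of_ne_two (by have := hO.five_le; omega)).add_one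
    refine ⟨(m * s : ℕ), ?_⟩
    have : m * s + m * s = n + s := by rw [← add_mul, ← hm, hns]; ring
    rw [← Nat.cast_add, this, Nat.cast_add, ZMod.natCast_self, zero_add]
  obtain ⟨e, he⟩ : ∃ e : (ZMod n → O) →ₗ[O] (ZMod n → O) →ₗ[O] O, ∀ x y, e x y = ∑ j, x j * y j :=
    ⟨LinearMap.mk₂ O (fun x y => ∑ j, x j * y j)
      (fun x y z => by simp [add_mul, Finset.sum_add_distrib])
      (fun a x y => by simp [mul_assoc, Finset.mul_sum])
      (fun x y z => by simp [mul_add, Finset.sum_add_distrib])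
      (fun a x y => by simp [mul_left_comm, Finset.mul_sum]), fun x y => rfl⟩
  have hcomm : ∀ x y, e x y = e y x := fun x y => by
    rw [he, he]; exact Finset.sum_congr rfl fun j _ => mul_comm _ _
  have hes : ∀ x j, e x (Pi.single j 1) = x j := fun x j => by
    rw [he, Finset.sum_eq_single j (fun i _ hij => by rw [Pi.single_eq_of_ne hij, mul_zero])
      (fun hj => absurd (Finset.mem_univ j) hj), Pi.single_eq_same, mul_one]
  obtain ⟨sh, hsh⟩ : ∃ sh : ZMod n → (ZMod n → O) →ₗ[O] (ZMod n → O), ∀ a f j, sh a f j = f (j + a) :=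
    ⟨fun a => LinearMap.funLeft O O (fun j => j + a), fun a f j => rfl⟩
  have hesh : ∀ a x y, e (sh a x) y = e x (sh (-a) y) := fun a x y => by
    rw [he, he]
    refine Fintype.sum_equiv (Equiv.addRight a) _ _ fun j => ?_
    rw [hsh, hsh, Equiv.coe_addRight, add_neg_cancel_right]
  let D : (ZMod n → O) →ₗ[O] (ZMod n → O) := sh (-h) - sh h
  have hD : ∀ f j, D f j = f (j - h) - f (j + h) := fun f j => by
    change sh (-h) f j - sh h f j = _
    rw [hsh, hsh, ← sub_eq_add_neg]
  have hskew : ∀ f g, e (D f) g = - e f (D g) := fun f g => by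
    simp only [D, LinearMap.sub_apply, map_sub, hesh, neg_neg]
    ring
  have hDsh : ∀ a f, D (sh a f) = sh a (D f) := fun a f => funext fun j => by
    rw [hD, hsh, hsh, hsh, hD]
    congr 2 <;> ring
  -- The image of D is the full orthogonal complement of its kernel; this saturation makes the form
  -- below perfect over O.
  have hmemD : ∀ a : (ZMod n → O), (∀ g, D g = 0 → e a g = 0) → ∃ f, D f = a := fun a ha => by
    obtain ⟨F, hF⟩ := exists_sub_shift_eq hns a fun j => by
      let g : (ZMod n → O) := ∑ i ∈ Finset.range ℓ, Pi.single ((j + i * s : ℕ) : ZMod n) 1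
      have hg : e a g = ∑ i ∈ Finset.range ℓ, a (j + i * s : ℕ) := by
        simp only [g, map_sum, hes]
      rw [← hg]
      refine ha g (funext fun m => ?_)
      have hgs : ∀ m : ZMod n, g (m + s) = g m := fun m => by
        have h1 : ∀ (i : ℕ), (Pi.single ((j + (i + 1) * s : ℕ) : ZMod n) (1 : O) : (ZMod n → O)) (m + s) =
            (Pi.single ((j + i * s : ℕ) : ZMod n) (1 : O) : (ZMod n → O)) m := fun i => by
          simp only [Pi.single_apply]
          congr 1
          rw [add_mul, one_mul, ← add_assoc, Nat.cast_add _ s, add_left_inj]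
        have h2 := Finset.sum_range_succ
          (fun i : ℕ => (Pi.single ((j + i * s : ℕ) : ZMod n) (1 : O) : (ZMod n → O)) (m + s)) ℓ
        rw [Finset.sum_range_succ'] at h2
        have h3 : ((j + ℓ * s : ℕ) : ZMod n) = ((j + 0 * s : ℕ) : ZMod n) := by
          rw [← hns, Nat.cast_add, ZMod.natCast_self, zero_mul, add_zero, add_zero]
        rw [h3, add_left_inj] at h2
        simp only [g, Finset.sum_apply]
        rw [← h2]
        exact Finset.sum_congr rfl fun i _ => h1 i
      rw [hD, Pi.zero_apply, ← hgs (m - h), ← hh]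
      have : m - h + (h + h) = m + h := by ring
      rw [this, sub_self]
    refine ⟨fun j => F (j + h), funext fun j => ?_⟩
    rw [hD, ← hF, ← hh]
    congr 2 <;> ring
  -- the lattice
  let M := LinearMap.range D
  obtain ⟨sec, hsec⟩ := Module.projective_lifting_property D.rangeRestrict (LinearMap.id (M := M))
    D.surjective_rangeRestrict
  have hDsec : ∀ x : M, D (sec x) = x := fun x => congrArg Subtype.val (LinearMap.congr_fun hsec x)
  -- The form on the image of D is b(Df, Dg) = e(Df, g), alternating because D is skew.
  obtain ⟨b, hb⟩ : ∃ b : M →ₗ[O] M →ₗ[O] O, ∀ x y : M, b x y = e x (sec y) :=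
    ⟨(e.compl₂ sec) ∘ₗ M.subtype, fun x y => rfl⟩
  have hbD : ∀ (x : M) f, D f = x → ∀ y : M, b x y = - e f y := fun x f hf y => by
    rw [hb, ← hf, hskew, hDsec]
  have hbD' : ∀ (x : M) f, b x ⟨D f, f, rfl⟩ = e x f := fun x f => by
    rw [hbD x (sec x) (hDsec x), ← hskew, hDsec]
  have hform : IsSymplecticForm b := by
    refine ⟨fun x => ?_, (injective_iff_map_eq_zero b).2 fun x hx => ?_, fun φ => ?_⟩
    · have h1 : e x (sec x) = - e x (sec x) := by
        nth_rewrite 1 [← hDsec x]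
        rw [hskew, hDsec, hcomm]
      rw [hb]
      exact self_eq_neg.1 h1
    · refine Subtype.ext (funext fun j => ?_)
      have := hbD' x (Pi.single j 1)
      rw [hes, hx] at this
      exact this.symm
    · let a : (ZMod n → O) := fun j => φ (D.rangeRestrict (Pi.single j 1))
      have ha : ∀ f, e a f = φ (D.rangeRestrict f) := fun f => by
        have : e a = φ ∘ₗ D.rangeRestrict := LinearMap.pi_ext' fun j => LinearMap.ext_ring (by
          simp only [LinearMap.comp_apply, LinearMap.single_apply]
          rw [hes])
        rw [this]; rfl
      obtain ⟨f, hf⟩ := hmemD a fun g hg => by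
        have : D.rangeRestrict g = 0 := Subtype.ext hg
        rw [ha, this, map_zero]
      refine ⟨⟨a, f, hf⟩, LinearMap.ext fun y => ?_⟩
      obtain ⟨_, g, rfl⟩ := y
      rw [hbD', ha]; rfl
  let P : End O M := (sh (-1)).restrict (p := M) (q := M) (by
    rintro _ ⟨f, rfl⟩
    exact ⟨sh (-1) f, hDsh _ _⟩)
  have hP : ∀ (m : ℕ) (x : M) j, ((P ^ m) x : (ZMod n → O)) j = (x : (ZMod n → O)) (j - m) := fun m => by
    induction m with
    | zero => intro x j; simp
    | succ m ih =>
      intro x j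
      rw [pow_succ, Module.End.mul_apply, ih]
      change sh (-1) x (j - m) = _
      rw [hsh, show j - m + -1 = j - ((m + 1 : ℕ) : ZMod n) by push_cast; ring]
  have hPn : P ^ n = 1 := LinearMap.ext fun x => Subtype.ext (funext fun j => by
    rw [hP, ZMod.natCast_self, sub_zero]; rfl)
  have hbP : ∀ x y, b (P x) (P y) = b x y := fun x y => by
    have h1 : D (sh (-1) (sec x)) = P x := by rw [hDsh, hDsec]; rfl
    rw [hbD _ _ h1, hbD _ _ (hDsec x), hesh]
    congr 2
    refine funext fun j => ?_
    rw [hsh]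
    change sh (-1) y (j + - -1) = _
    rw [hsh, neg_neg, add_neg_cancel_right]
  obtain ⟨ρ, hρH, hρt⟩ := hG.exists_hom (1 : H →* End O M) (Units.ofPowEqOne P n hPn (NeZero.ne n))
    (Units.ext (by rw [Units.val_pow_eq_pow_val, Units.val_ofPowEqOne, hPn]; rfl))
    (fun h => by simp)
  have hρtm : ∀ m : ℕ, ρ (t ^ m) = P ^ m := fun m => by
    rw [map_pow, hρt, Units.val_ofPowEqOne]
  refine HasSymplecticLattice.of_isSymplecticRep (ρ := ρ) (b := b) ⟨hform, fun g x y => ?_⟩ ?_ ?_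
  · obtain ⟨x', m, rfl⟩ := hG.exists_eq_mul g
    rw [map_mul, hρH, hρtm, MonoidHom.one_apply, one_mul]
    induction m with
    | zero => simp
    | succ m ih => rw [pow_succ', Module.End.mul_apply, Module.End.mul_apply, hbP, ih]
  · have h1 := LinearMap.rank_range_add_rank_ker D
    have h2 : finrank O M + finrank O (LinearMap.ker D) = n := by
      have h3 := congrArg Cardinal.toNat h1
      rw [Cardinal.toNat_add (Module.rank_lt_aleph0 _ _) (Module.rank_lt_aleph0 _ _)] at h3
      have h4 : finrank O (ZMod n → O) = n := by rw [Module.finrank_pi, ZMod.card]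
      exact h3.trans h4
    have h3 : s ≤ finrank O (LinearMap.ker D) := by
      let per : (Fin s → O) →ₗ[O] (ZMod n → O) := LinearMap.funLeft O O
        fun j : ZMod n => ⟨j.val % s, Nat.mod_lt _ (NeZero.pos s)⟩
      have hper : ∀ f, per f ∈ LinearMap.ker D := fun f => by
        refine LinearMap.mem_ker.2 (funext fun j => ?_)
        have h5 : j + h = j - h + s := by rw [← hh]; ring
        have h6 : (j + h).val % s = (j - h).val % s := by
          rw [h5, ZMod.val_add, ZMod.val_natCast, Nat.add_mod_mod,
            Nat.mod_mod_of_dvd _ (hns ▸ Dvd.intro_left ℓ rfl), Nat.add_mod_right]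
        rw [hD]
        simp only [per, LinearMap.funLeft_apply, h6, sub_self, Pi.zero_apply]
      have hinj : Function.Injective (per.codRestrict _ hper) := fun f g hfg => funext fun i => by
        have := congrFun (congrArg Subtype.val hfg) ((i : ℕ) : ZMod n)
        have hi : (i : ℕ) % n % s = i := by
          rw [Nat.mod_mod_of_dvd _ (hns ▸ Dvd.intro_left ℓ rfl),
            Nat.mod_eq_of_lt i.2]
        simpa [per, LinearMap.funLeft_apply, hi] using this
      have := LinearMap.finrank_le_finrank_of_injective hinj
      rwa [Module.finrank_fin_fun] at this
    omega
  -- If t^(ℓ^k) acted trivially, D would kill the difference of the delta functions at s and 0; but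
  -- its value at h is -2.
  · rintro g hg rfl
    rw [hρtm] at hg
    let x : M := ⟨D (Pi.single 0 1), _, rfl⟩
    have h1 : (P ^ s) x = x := by rw [hg]; rfl
    have h2 : D (sh (-s) (Pi.single 0 1) - Pi.single 0 1) = 0 := by
      rw [map_sub, sub_eq_zero]
      have h3 := congrArg Subtype.val h1
      refine Eq.trans (funext fun j => ?_) h3
      rw [hDsh, hsh, hP, sub_eq_add_neg]
    have h3 := congrFun h2 h
    have hs0 : (s : ZMod n) ≠ 0 := fun h0 => by
      rw [ZMod.natCast_eq_zero_iff] at h0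
      have := Nat.le_of_dvd (NeZero.pos s) h0
      have h5 : s < n := by
        rw [hns]; exact lt_mul_of_one_lt_left (NeZero.pos s) hp.one_lt
      omega
    rw [hD, sub_self, hh] at h3
    simp only [Pi.sub_apply, hsh, zero_add, Pi.single_apply, add_neg_cancel, neg_eq_zero, hs0,
      if_true, if_false, Pi.zero_apply] at h3
    have h4 : (2 : O) = 0 := by linear_combination -h3
    exact two_ne_zero h4

end AbsolutelyUnramified

/-! ### Dimensions of simple quotients of lattices in an irreducible representation. -/

/-- A representation on a lattice that becomes irreducible over the fraction field. -/
def Representation.IsIrreducibleLattice {R G M : Type*} [CommRing R] [Monoid G] [AddCommGroup M]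
    [Module R M] (ρ : Representation R G M) : Prop :=
  ∀ J : Submodule R M, ρ.IsStable J → (∀ (a : R) (x : M), a ≠ 0 → a • x ∈ J → x ∈ J) →
    J = ⊥ ∨ J = ⊤

/-- Schur's lemma, for dimensions. -/
theorem Representation.IsSimple.finrank_eq {F G N B : Type*} [Field F] [Monoid G] [AddCommGroup N]
    [Module F N] [AddCommGroup B] [Module F B] {σ : Representation F G N} {τ : Representation F G B}
    (hσ : σ.IsSimple) (hτ : τ.IsSimple) {f : N →ₗ[F] B} (hf : ∀ g x, f (σ g x) = τ g (f x))
    (h0 : f ≠ 0) : finrank F N = finrank F B := by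
  have hinj : LinearMap.ker f = ⊥ := by
    refine (hσ.eq_bot_or_eq_top _ fun g x hx => ?_).resolve_right fun h =>
      h0 (LinearMap.ker_eq_top.1 h)
    rw [Submodule.mem_comap, LinearMap.mem_ker, hf, LinearMap.mem_ker.1 hx, map_zero]
  have hsurj : LinearMap.range f = ⊤ := by
    refine (hτ.eq_bot_or_eq_top _ ?_).resolve_left fun h => h0 (LinearMap.range_eq_bot.1 h)
    rintro g _ ⟨x, rfl⟩
    exact ⟨σ g x, hf g x⟩
  exact (LinearEquiv.ofBijective f
    ⟨LinearMap.ker_eq_bot.1 hinj, LinearMap.range_eq_top.1 hsurj⟩).finrank_eq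

namespace AbsolutelyUnramified

variable {ℓ : ℕ} {O : Type*} [CommRing O] [IsDomain O] [IsDiscreteValuationRing O]
  [hO : AbsolutelyUnramified ℓ O] {G : Type*} [Group G] [Finite G] {k : ℕ} {H : Subgroup G} {t : G}

/-- A group of `ℓ`-power order acting in characteristic `ℓ` on a nonzero space of equivariant maps
has a nonzero fixed point. -/
theorem exists_equivariant_of_equivariant_subgroup
    (hG : IsCyclicExtension ℓ k H t) {N B : Type*}
    [AddCommGroup N] [Module (ResidueField O) N] [AddCommGroup B] [Module (ResidueField O) B]
    (σ : Representation (ResidueField O) G N) (τ : Representation (ResidueField O) G B)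
    {f : N →ₗ[ResidueField O] B} (hf : ∀ h ∈ H, ∀ x, f (σ h x) = τ h (f x)) (h0 : f ≠ 0) :
    ∃ f : N →ₗ[ResidueField O] B, f ≠ 0 ∧ ∀ g x, f (σ g x) = τ g (f x) := by
  have := hG.normal
  have hp := hO.prime
  have : Fact ℓ.Prime := ⟨hp⟩
  have := charP_residueField O (ℓ := ℓ)
  obtain ⟨Θ, hΘ⟩ : ∃ Θ : End (ResidueField O) (N →ₗ[ResidueField O] B),
      ∀ f x, Θ f x = τ t (f (σ t⁻¹ x)) :=
    ⟨{ toFun := fun f => τ t ∘ₗ f ∘ₗ σ t⁻¹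
       map_add' := fun f g => by ext; simp
       map_smul' := fun a f => by ext; simp }, fun f x => rfl⟩
  have hpow : ∀ n f x, (Θ ^ n) f x = τ (t ^ n) (f (σ (t ^ n)⁻¹ x)) := fun n => by
    induction n with
    | zero => intro f x; simp
    | succ n ih =>
      intro f x
      rw [pow_succ', Module.End.mul_apply, hΘ, ih, ← Module.End.mul_apply, ← map_mul,
        ← Module.End.mul_apply (σ _), ← map_mul, ← pow_succ', ← mul_inv_rev, ← pow_succ']
  have hΘ1 : Θ ^ ℓ ^ k = 1 := LinearMap.ext fun f => LinearMap.ext fun x => by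
    rw [hpow, ← hG.orderOf_eq, pow_orderOf_eq_one]; simp
  have hnt : Nontrivial (N →ₗ[ResidueField O] B) := ⟨f, 0, h0⟩
  have hchar : CharP (End (ResidueField O) (N →ₗ[ResidueField O] B)) ℓ :=
    charP_of_injective_algebraMap (algebraMap (ResidueField O) _).injective ℓ
  have hnil : (Θ - 1) ^ ℓ ^ k = 0 := by
    rw [sub_pow_char_pow_of_commute _ _ (Commute.one_right Θ), hΘ1, one_pow, sub_self]
  have hH : ∀ f : N →ₗ[ResidueField O] B, (∀ h ∈ H, ∀ x, f (σ h x) = τ h (f x)) →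
      ∀ h ∈ H, ∀ x, (Θ - 1) f (σ h x) = τ h ((Θ - 1) f x) := fun f hf h hh x => by
    have h1 : σ t⁻¹ (σ h x) = σ (t⁻¹ * h * t⁻¹⁻¹) (σ t⁻¹ x) := by
      rw [← Module.End.mul_apply, ← map_mul, ← Module.End.mul_apply, ← map_mul,
        inv_mul_cancel_right]
    have h2 : ∀ y, τ t (τ (t⁻¹ * h * t⁻¹⁻¹) y) = τ h (τ t y) := fun y => by
      rw [← Module.End.mul_apply, ← map_mul, ← Module.End.mul_apply, ← map_mul]
      congr 2; group
    rw [LinearMap.sub_apply, LinearMap.sub_apply, hΘ, Module.End.one_apply, h1,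
      hf _ (hG.normal.conj_mem h hh t⁻¹), h2, hf h hh, LinearMap.sub_apply, hΘ, map_sub]
  obtain ⟨D, hDΘ⟩ : ∃ D, D = Θ - 1 := ⟨_, rfl⟩
  rw [← hDΘ] at hnil hH
  have hHpow : ∀ n, ∀ h ∈ H, ∀ x, (D ^ n) f (σ h x) =
      τ h ((D ^ n) f x) := fun n => by
    induction n with
    | zero => exact hf
    | succ n ih => rw [pow_succ', Module.End.mul_apply]; exact hH _ ih
  classical
  -- The last nonzero iterate of f under the nilpotent operator Θ - 1 is fixed by Θ and still
  -- H-equivariant.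
  have hex : ∃ n, (D ^ n) f = 0 := ⟨_, by rw [hnil, LinearMap.zero_apply]⟩
  obtain ⟨n, hn⟩ : ∃ n, Nat.find hex = n + 1 :=
    Nat.exists_eq_succ_of_ne_zero fun h => h0 ((Nat.find_eq_zero hex).1 h)
  set f₀ := (D ^ n) f with hf₀
  have hfix : Θ f₀ = f₀ := by
    have := Nat.find_spec hex
    rwa [hn, pow_succ', Module.End.mul_apply, hDΘ, LinearMap.sub_apply, ← hDΘ, sub_eq_zero] at this
  have hfixpow : ∀ n, (Θ ^ n) f₀ = f₀ := fun n => by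
    induction n with
    | zero => rfl
    | succ n ih => rw [pow_succ, Module.End.mul_apply, hfix, ih]
  refine ⟨f₀, Nat.find_min hex (by omega : n < Nat.find hex), fun g x => ?_⟩
  obtain ⟨h, m, rfl⟩ := hG.exists_eq_mul g
  rw [map_mul, map_mul, Module.End.mul_apply, Module.End.mul_apply, hHpow _ _ h.2]
  congr 1
  conv_lhs => rw [← hf₀, ← hfixpow m, hpow, σ.inv_apply_apply]

include hO in
theorem exists_eq_pow_nsmul {M : Type*} [AddCommGroup M] [Module O M] [Module.Finite O M] {x : M}
    (hx : x ≠ 0) : ∃ (m : ℕ) (y : M), x = ℓ ^ m • y ∧ ∀ z, y ≠ ℓ • z := by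
  classical
  have hex : ∃ m, ¬ ∃ z, x = ℓ ^ m • z := by
    by_contra! h
    exact hx (eq_zero_of_forall_exists_nsmul O (ℓ := ℓ) x h)
  obtain ⟨m, hm⟩ : ∃ n, Nat.find hex = n + 1 :=
    Nat.exists_eq_succ_of_ne_zero fun h => (Nat.find_eq_zero hex).1 h ⟨x, by simp⟩
  obtain ⟨y, hy⟩ := not_not.1 (Nat.find_min hex (by omega : m < Nat.find hex))
  refine ⟨m, y, hy, fun z hz => Nat.find_spec hex ⟨z, ?_⟩⟩
  rw [hm, hy, hz, pow_succ, mul_smul]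

section Subquotient

variable (hG : IsCyclicExtension ℓ k H t)
  {T : Type*} [AddCommGroup T] [Module O T] [Module.Finite O T] [Module.Free O T]
  {α : Representation O G T} (hα : α.IsIrreducibleLattice)
  {B : Type*} [AddCommGroup B] [Module O B] [Module (ResidueField O) B]
  [IsScalarTower O (ResidueField O) B] [Module.Finite (ResidueField O) B]
  {σ : Representation (ResidueField O) G B} (hσ : σ.IsSimple) {p : T →ₗ[O] B}
  (hp : Function.Surjective p) (hpσ : ∀ g x, p (α g x) = σ g (p x))

include hG hα hσ hp hpσ

omit [Module.Finite O T] in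
/-- Simple quotients of sublattices of an irreducible lattice have the same dimension. -/
theorem finrank_eq_of_isIrreducibleLattice {T₁ : Type*} [AddCommGroup T₁] [Module O T₁]
    [Module.Finite O T₁] [Module.Free O T₁] {α₁ : Representation O G T₁} {j : T₁ →ₗ[O] T}
    (hj : Function.Injective j) (hjα : ∀ g x, j (α₁ g x) = α g (j x))
    {N : Type*} [AddCommGroup N] [Module O N] [Module (ResidueField O) N]
    [IsScalarTower O (ResidueField O) N] [Module.Finite (ResidueField O) N]
    {τ : Representation (ResidueField O) G N} (hτ : τ.IsSimple) {q : T₁ →ₗ[O] N}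
    (hq : Function.Surjective q) (hqτ : ∀ g x, q (α₁ g x) = τ g (q x)) :
    finrank (ResidueField O) N = finrank (ResidueField O) B := by
  have := hG.normal
  -- B is lifted with its full G-action, N only with its H-action. The lift of N will be a direct
  -- summand of T₁ under H.
  obtain ⟨m, β, πB, hπB, hβ⟩ := exists_lift_of_isSimple hG hσ
  obtain ⟨n, ν, πN, hπN, hν⟩ := exists_lift_coprime hG.not_dvd (τ.comp H.subtype)
  obtain ⟨f₂, hf₂, hf₂π⟩ := exists_equivariant_lift hG.not_dvd (α.comp H.subtype)
    (β.comp H.subtype) (fun h => σ h) πB hπB.surjective (fun h x => hβ h x) p (fun h x => hpσ h x)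
  obtain ⟨f₁, hf₁, hf₁π⟩ := exists_equivariant_lift hG.not_dvd (α₁.comp H.subtype)
    ν (fun h => τ h) πN hπN.surjective (fun h x => hν h x) q (fun h x => hqτ h x)
  have hf₁s : Function.Surjective f₁ := by
    refine LinearMap.range_eq_top.1 (eq_top_of_forall_exists_add_nsmul (ℓ := ℓ) _ fun x => ?_)
    obtain ⟨y, hy⟩ := hq (πN x)
    obtain ⟨z, hz⟩ := hπN.exists_nsmul (x - f₁ y) (by rw [map_sub, hf₁π, hy, sub_self])
    exact ⟨f₁ y, ⟨y, rfl⟩, z, by rw [← hz, add_sub_cancel]⟩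
  obtain ⟨s, hs, hsf⟩ := exists_equivariant_lift hG.not_dvd ν (α₁.comp H.subtype) (fun h => ν h) f₁
    hf₁s hf₁ LinearMap.id (fun h x => rfl)
  -- the common kernel of the equivariant maps
  let J : Submodule O T := ⨅ f : {f : T →ₗ[O] (Fin m → O) // ∀ h ∈ H, ∀ x, f (α h x) = β h (f x)},
    LinearMap.ker f.1
  have hmem : ∀ x, x ∈ J ↔ ∀ f : T →ₗ[O] (Fin m → O), (∀ h ∈ H, ∀ x, f (α h x) = β h (f x)) →
      f x = 0 := fun x => by
    simp only [J, Submodule.mem_iInf, Subtype.forall, LinearMap.mem_ker]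
  -- J is stable under G because conjugating an H-map by g gives an H-map, and it is saturated. It
  -- is proper since `f₂` is nonzero, so irreducibility kills it; hence some H-map to the lift of B
  -- is nonzero on the image of the lift of N.
  have hJ : J = ⊥ := by
    refine (hα J (fun g x hx => (hmem _).2 fun f hf => ?_) fun a x ha hx =>
      (hmem x).2 fun f hf => ?_).resolve_right fun h => ?_
    · have h1 := (hmem x).1 hx (β g⁻¹ ∘ₗ f ∘ₗ α g) fun h hh y => by
        have h1 : α g (α h y) = α (g * h * g⁻¹) (α g y) := by
          rw [← Module.End.mul_apply, ← map_mul, ← Module.End.mul_apply, ← map_mul,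
            inv_mul_cancel_right]
        have h2 : ∀ z, β g⁻¹ (β (g * h * g⁻¹) z) = β h (β g⁻¹ z) := fun z => by
          rw [← Module.End.mul_apply, ← map_mul, ← Module.End.mul_apply, ← map_mul]
          congr 2; group
        rw [LinearMap.comp_apply, LinearMap.comp_apply, h1, hf _ (hG.normal.conj_mem h hh g), h2]
        rfl
      rw [← β.apply_inv_apply g (f (α g x))]
      exact (congrArg (β g) h1).trans (map_zero _)
    · have := (hmem _).1 hx f hf
      rw [map_smul] at this
      exact (smul_eq_zero.1 this).resolve_left ha
    · have := hσ.nontrivial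
      obtain ⟨y, hy⟩ := exists_ne (0 : B)
      obtain ⟨x, rfl⟩ := hp y
      have hx : x ∈ J := h ▸ Submodule.mem_top
      exact hy (by rw [← hf₂π, (hmem x).1 hx f₂ fun h hh x => hf₂ ⟨h, hh⟩ x, map_zero])
  have := hτ.nontrivial
  obtain ⟨y, hy⟩ := exists_ne (0 : N)
  obtain ⟨x, rfl⟩ := hπN.surjective y
  have hx : j (s x) ∉ J := fun h => hy <| by
    rw [hJ, Submodule.mem_bot, map_eq_zero_iff _ hj] at h
    have := hsf x
    rw [h, map_zero, LinearMap.id_apply] at this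
    rw [← this, map_zero]
  rw [hmem] at hx
  push Not at hx
  obtain ⟨f, hf, hfx⟩ := hx
  have hF0 : f ∘ₗ j ∘ₗ s ≠ 0 := fun h => hfx (LinearMap.congr_fun h x)
  -- Dividing by the highest power of ℓ gives an H-map that stays nonzero modulo ℓ. Its reduction is
  -- replaced by a G-map from N to B, and Schur's lemma ends the argument.
  obtain ⟨e, F, hF, hFm⟩ := exists_eq_pow_nsmul (ℓ := ℓ) (O := O) hF0
  have hFH : ∀ (h : H) x, F (ν h x) = β h (F x) := fun h x => by
    rw [← sub_eq_zero]
    refine pow_nsmul_eq_zero (ℓ := ℓ) O (n := e) ?_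
    have h1 : ∀ x, ℓ ^ e • F x = f (j (s x)) := fun x => (LinearMap.congr_fun hF x).symm
    have h2 : j (α₁ h (s x)) = α h (j (s x)) := hjα h _
    have h3 : s (ν h x) = α₁ h (s x) := hs h x
    rw [smul_sub, h1, ← map_nsmul, h1, h3, h2, hf h h.2, sub_self]
  obtain ⟨F', hF'⟩ := hπN.exists_map (πB ∘ₗ F)
  have hF'0 : F' ≠ 0 := fun h => by
    obtain ⟨F₁, hF₁⟩ := exists_linearMap_eq_nsmul F fun x => hπB.exists_nsmul (F x) (by
      rw [← LinearMap.comp_apply, ← hF', h, LinearMap.zero_apply])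
    exact hFm F₁ hF₁
  obtain ⟨f₀, hf₀, hf₀G⟩ := exists_equivariant_of_equivariant_subgroup hG τ σ (f := F')
    (fun h hh x => by
      obtain ⟨x, rfl⟩ := hπN.surjective x
      have h1 : πN (ν ⟨h, hh⟩ x) = τ h (πN x) := hν ⟨h, hh⟩ x
      rw [← h1, hF', LinearMap.comp_apply, hFH, hF', hβ]; rfl) hF'0
  exact hτ.finrank_eq hσ hf₀G hf₀

omit [Module.Finite O T] in
/-- The dimension of a simple quotient divides the dimension of any quotient. -/
theorem finrank_dvd_of_isIrreducibleLattice (n : ℕ) {T₁ : Type u} [AddCommGroup T₁] [Module O T₁]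
    [Module.Finite O T₁] [Module.Free O T₁] {α₁ : Representation O G T₁} {j : T₁ →ₗ[O] T}
    (hj : Function.Injective j) (hjα : ∀ g x, j (α₁ g x) = α g (j x))
    {X : Type v} [AddCommGroup X] [Module O X] [Module (ResidueField O) X]
    [IsScalarTower O (ResidueField O) X] [Module.Finite (ResidueField O) X]
    (τ : Representation (ResidueField O) G X) {q : T₁ →ₗ[O] X}
    (hq : Function.Surjective q) (hqτ : ∀ g x, q (α₁ g x) = τ g (q x))
    (hn : finrank (ResidueField O) X = n) :
    finrank (ResidueField O) B ∣ n := by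
  induction n using Nat.strong_induction_on generalizing X with
  | _ n ih =>
  rcases Nat.eq_zero_or_pos n with rfl | hpos
  · exact dvd_zero _
  have hnt : Nontrivial X := Module.nontrivial_of_finrank_pos (hn ▸ hpos)
  obtain ⟨N, hN, -, hNs⟩ := Representation.IsStable.exists_isSimple (ρ := τ) (S := ⊤)
    (fun _ _ _ => trivial) (top_ne_bot)
  -- The preimage of a simple submodule is a sublattice with that simple quotient, so all
  -- composition factors of X have the dimension of B.
  let T' : Submodule O T₁ := (N.restrictScalars O).comap q
  have hT' : ∀ g, ∀ x ∈ T', α₁ g x ∈ T' := fun g x hx => by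
    change q (α₁ g x) ∈ N
    rw [hqτ]
    exact hN g hx
  obtain ⟨α', hα'⟩ : ∃ α' : Representation O G T', ∀ g x, (α' g x : T₁) = α₁ g x :=
    ⟨α₁.subrepresentation T' hT', fun g x => rfl⟩
  obtain ⟨q', hq'⟩ : ∃ q' : T' →ₗ[O] N, ∀ x, (q' x : X) = q x :=
    ⟨(q ∘ₗ T'.subtype).codRestrict (N.restrictScalars O) fun x => x.2, fun x => rfl⟩
  have hN' := finrank_eq_of_isIrreducibleLattice hG hα hσ hp hpσ (α₁ := α') (j := j ∘ₗ T'.subtype)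
    (hj.comp Subtype.val_injective) (fun g x => by
      rw [LinearMap.comp_apply, Submodule.subtype_apply, hα', hjα]; rfl) hNs (q := q')
    (fun x => by
      obtain ⟨y, hy⟩ := hq x
      exact ⟨⟨y, show q y ∈ N from hy ▸ x.2⟩, Subtype.ext ((hq' _).trans hy)⟩)
    (fun g x => Subtype.ext (by rw [hq', hα', hqτ, ← hq']; rfl))
  have hd := N.finrank_quotient_add_finrank
  have hNpos : 0 < finrank (ResidueField O) N := by
    have := hNs.nontrivial
    exact Module.finrank_pos
  have h2 := ih (finrank (ResidueField O) (X ⧸ N)) (by omega) (X := X ⧸ N)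
    (τ.quotient N hN) (q := (N.mkQ.restrictScalars O) ∘ₗ q) (N.mkQ_surjective.comp hq)
    (fun g x => by
      rw [LinearMap.comp_apply, hqτ]; rfl) rfl
  rw [← hn, ← hd, hN']
  exact dvd_add h2 dvd_rfl

end Subquotient

end AbsolutelyUnramified

/-! ### Rank formulas from cyclotomic elements, and the case of an even-dimensional quotient. -/

namespace AbsolutelyUnramified

variable {ℓ : ℕ} {O : Type*} [CommRing O] [IsDomain O] [IsDiscreteValuationRing O]
  [hO : AbsolutelyUnramified ℓ O]

open Polynomial in
/-- If `u` is a root of the cyclotomic polynomial of order `ℓ ^ (j + 1)`, then a power of `u - 1`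
is `ℓ` up to a unit. -/
theorem exists_pow_eq_nsmul_of_cyclotomic {A : Type*} [Ring A] [Algebra O A] [Module.Finite O A]
    [Module.Free O A] {u : A} {j : ℕ} (hu : ∑ i ∈ Finset.range ℓ, (u ^ ℓ ^ j) ^ i = 0) :
    ∃ w : A, IsUnit w ∧ Commute (u - 1) w ∧ (u - 1) ^ (ℓ ^ j * (ℓ - 1)) = ℓ • w := by
  have hp := hO.prime
  have : Fact ℓ.Prime := ⟨hp⟩
  set m := ℓ ^ j * (ℓ - 1) with hm
  have hmpos : 0 < m := Nat.mul_pos (pow_pos hp.pos _) (Nat.sub_pos_of_lt hp.one_lt)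
  obtain ⟨P, hP⟩ : ∃ P, P = (cyclotomic (ℓ ^ (j + 1)) ℤ).comp (X + 1) := ⟨_, rfl⟩
  have heis : P.IsEisensteinAt (Ideal.span {(ℓ : ℤ)}) :=
    hP ▸ cyclotomic_prime_pow_comp_X_add_one_isEisensteinAt ℓ j
  have hdeg : P.natDegree = m := by
    rw [hP, natDegree_comp, show (X + 1 : ℤ[X]) = X + C 1 by simp, natDegree_X_add_C, mul_one,
      natDegree_cyclotomic, Nat.totient_prime_pow_succ hp]
  have hmon : P.Monic := by
    rw [hP, show (X + 1 : ℤ[X]) = X + C 1 by simp]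
    exact (cyclotomic.monic _ _).comp_X_add_C 1
  have hP0 : P.coeff 0 = ℓ := by
    rw [coeff_zero_eq_eval_zero, hP, eval_comp, eval_add, eval_X, eval_one, zero_add,
      eval_one_cyclotomic_prime_pow]
  -- P = Φ(X + 1) is Eisenstein, so P = X^m + ℓR. Since Φ(1) = ℓ, R has constant term 1.
  obtain ⟨R, hR⟩ : C (ℓ : ℤ) ∣ P - X ^ m := by
    refine (C_dvd_iff_dvd_coeff _ _).2 fun i => ?_
    rw [coeff_sub, coeff_X_pow]
    rcases lt_trichotomy i m with h | h | h
    · rw [if_neg h.ne, sub_zero]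
      exact Ideal.mem_span_singleton.1 (heis.mem (hdeg.symm ▸ h))
    · have := hmon.coeff_natDegree
      rw [hdeg] at this
      rw [if_pos h, h, this, sub_self]
      exact dvd_zero _
    · rw [if_neg h.ne', coeff_eq_zero_of_natDegree_lt (hdeg.symm ▸ h), sub_zero]
      exact dvd_zero _
  obtain ⟨S, hS⟩ : X ∣ R - 1 := by
    have h1 := congrArg (coeff · 0) hR
    simp only [coeff_sub, coeff_X_pow, hmpos.ne, if_false, sub_zero, hP0, coeff_C_mul] at h1
    rw [X_dvd_iff, coeff_sub, coeff_one_zero, sub_eq_zero]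
    exact (mul_right_injective₀ (Int.natCast_ne_zero.2 hp.ne_zero) (by simpa using h1)).symm
  set y := u - 1 with hy
  have hPy : aeval y P = 0 := by
    rw [hP, aeval_comp, map_add, aeval_X, map_one, hy, sub_add_cancel,
      cyclotomic_prime_pow_eq_geom_sum hp, map_sum, ← hu]
    simp only [map_pow, aeval_X]
  have hym : y ^ m = ℓ • - aeval y R := by
    have h1 := congrArg (aeval y) hR
    rw [map_sub, hPy, zero_sub, map_pow, aeval_X, map_mul, aeval_C] at h1
    rw [← neg_neg (y ^ m), h1, smul_neg, nsmul_eq_mul]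
    simp
  have hRy : aeval y R = 1 + y * aeval y S := by
    have h1 := congrArg (aeval y) hS
    rw [map_sub, map_one, map_mul, aeval_X, sub_eq_iff_eq_add'] at h1
    exact h1
  have hcomm : ∀ Q : ℤ[X], Commute y (aeval y Q) := fun Q => by
    have h1 := congrArg (aeval y) (mul_comm X Q)
    rwa [map_mul, map_mul, aeval_X] at h1
  refine ⟨- aeval y R, IsUnit.neg ?_, (hcomm R).neg_right, hym⟩
  -- R(y) = 1 - x where x^m is divisible by ℓ, so 1 - x divides the unit 1 - x^m.
  obtain ⟨x, hx⟩ : ∃ x, x = -(y * aeval y S) := ⟨_, rfl⟩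
  have h1 := mul_neg_geom_sum x m
  have h2 : x ^ m = ℓ • ((-1) ^ m * (- aeval y R * (aeval y S) ^ m)) := by
    rw [hx, neg_pow, (hcomm S).mul_pow, hym, smul_mul_assoc, mul_smul_comm]
  rw [h2] at h1
  have h3 := isUnit_one_add_nsmul (ℓ := ℓ) O (-((-1) ^ m * (- aeval y R * (aeval y S) ^ m)))
  rw [smul_neg, ← sub_eq_add_neg, ← h1, sub_eq_add_neg, hx, neg_neg, ← hRy] at h3
  refine ((Commute.isUnit_mul_iff ?_).1 h3).1
  rw [hRy]
  refine Commute.sum_right _ _ _ fun i _ => Commute.pow_right (Commute.neg_right ?_) _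
  exact (Commute.one_left _).add_left rfl

section Jordan

variable {T Q : Type*} [AddCommGroup T] [Module O T] [Module.Finite O T] [Module.Free O T]
  [AddCommGroup Q] [Module O Q] [Module (ResidueField O) Q] [IsScalarTower O (ResidueField O) Q]

/-- All Jordan blocks of the reduction y' have size m: if yx = ℓz, then yx = y^m w⁻¹z, and x =
y^(m-1) w⁻¹z because y is injective. -/
theorem IsReduction.finrank_eq_mul {π : T →ₗ[O] Q} (hπ : IsReduction ℓ π) {y w : End O T} {m : ℕ}
    (hm : 0 < m) (hw : IsUnit w) (hyw : Commute y w) (h : y ^ m = ℓ • w)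
    {y' : End (ResidueField O) Q} (hy' : ∀ x, y' (π x) = π (y x)) :
    finrank O T = m * finrank (ResidueField O) (Q ⧸ LinearMap.range y') := by
  have := hπ.finite
  obtain ⟨w, rfl⟩ := hw
  have hpow : ∀ i x, (y' ^ i) (π x) = π ((y ^ i) x) := fun i => by
    induction i with
    | zero => intro x; rfl
    | succ i ih => intro x; rw [pow_succ, Module.End.mul_apply, hy', ih, pow_succ]; rfl
  have hym : ∀ x, (y ^ m) x = ℓ • (w : End O T) x := fun x => by rw [h]; rfl
  have hww : ∀ x, (w : End O T) (((w⁻¹ : (End O T)ˣ) : End O T) x) = x := fun x =>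
    LinearMap.congr_fun w.mul_inv x
  have hinj : ∀ x, y x = 0 → x = 0 := fun x hx => by
    have h1 : (w : End O T) x = 0 := nsmul_eq_zero (ℓ := ℓ) O (by
      rw [← hym, ← Nat.sub_add_cancel hm, pow_succ, Module.End.mul_apply, hx, map_zero])
    have h2 := LinearMap.congr_fun w.inv_mul x
    rw [Module.End.mul_apply, h1, map_zero] at h2
    exact h2.symm
  have hker := finrank_eq_mul_finrank_ker (N := y') (m := m)
    (DFunLike.coe_injective (hπ.ext fun x => by
      rw [hpow, hym, map_nsmul, nsmul_residue_eq_zero O]; rfl)) fun q hq => by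
    obtain ⟨x, rfl⟩ := hπ.surjective q
    rw [LinearMap.mem_ker, hy', hπ.map_eq_zero_iff] at hq
    obtain ⟨z, hz⟩ := hq
    refine ⟨π (((w⁻¹ : (End O T)ˣ) : End O T) z), ?_⟩
    rw [hpow]
    congr 1
    rw [← sub_eq_zero]
    refine hinj _ ?_
    rw [map_sub, ← Module.End.mul_apply, ← pow_succ', Nat.sub_add_cancel hm, hym, hww, hz, sub_self]
  rw [← hπ.finrank_eq, hker]
  congr 1
  have h1 := LinearMap.finrank_range_add_finrank_ker y'
  have h2 := (LinearMap.range y').finrank_quotient_add_finrank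
  omega

end Jordan

variable {G : Type*} [Group G] [Finite G] {k : ℕ} {H : Subgroup G} {t : G}
  (hG : IsCyclicExtension ℓ (k + 1) H t)
  {T : Type*} [AddCommGroup T] [Module O T] [Module.Finite O T] [Module.Free O T]
  {α : Representation O G T} (hα : α.IsIrreducibleLattice)
  {B : Type*} [AddCommGroup B] [Module O B] [Module (ResidueField O) B]
  [IsScalarTower O (ResidueField O) B] [Module.Finite (ResidueField O) B]
  {σ : Representation (ResidueField O) G B} (hσ : σ.IsSimple) {p : T →ₗ[O] B}
  (hp : Function.Surjective p) (hpσ : ∀ g x, p (α g x) = σ g (p x))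

include hG hα hσ hp hpσ

/-- T is traded for two lattices: one of rank 2e made from T/(c - 1)T and its dual, where c =
t^(ℓ^k), which detects H, and the cyclotomic lattice, which detects c. The parity of e is what
leaves room for both. -/
theorem hasSymplecticLattice_of_even_quotient (heven : Even (finrank (ResidueField O) B))
    (hc : ∀ g, Commute (t ^ ℓ ^ k) g)
    (hsum : ∑ i ∈ Finset.range ℓ, (α (t ^ ℓ ^ k)) ^ i = 0) :
    HasSymplecticLattice O (finrank O T) {g | (g ∈ H → α g = 1) ∧ g ≠ t ^ ℓ ^ k} := by
  have hpr := hO.prime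
  have hl5 := hO.five_le
  obtain ⟨π, hπ⟩ := exists_isReduction (ℓ := ℓ) O T
  obtain ⟨τ, hτ⟩ := hπ.exists_representation α
  have hfin := hπ.finite
  -- the element `c - 1`
  obtain ⟨w, hw, hcw, hwe⟩ := exists_pow_eq_nsmul_of_cyclotomic (O := O) (ℓ := ℓ) (j := 0)
    (u := α (t ^ ℓ ^ k)) (by simpa only [pow_zero, pow_one] using hsum)
  rw [pow_zero, one_mul] at hwe
  set y := α (t ^ ℓ ^ k) - 1 with hy
  have hyα : ∀ g, Commute y (α g) := fun g =>
    (((hc g).map α) : Commute _ _).sub_left (Commute.one_left _)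
  have he := hπ.finrank_eq_mul (m := ℓ - 1) (by omega) hw hcw hwe (y' := τ (t ^ ℓ ^ k) - 1)
    fun x => by rw [hy, LinearMap.sub_apply, LinearMap.sub_apply, hτ, map_sub]; rfl
  obtain ⟨y', hy'⟩ : ∃ y', y' = τ (t ^ ℓ ^ k) - 1 := ⟨_, rfl⟩
  have hy'π : ∀ x, y' (π x) = π (y x) := fun x => by
    rw [hy, hy', LinearMap.sub_apply, LinearMap.sub_apply, hτ, map_sub]; rfl
  rw [← hy'] at he
  -- the element `t - 1`
  obtain ⟨w₁, hw₁, hcw₁, hwe₁⟩ := exists_pow_eq_nsmul_of_cyclotomic (O := O) (ℓ := ℓ) (j := k)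
    (u := α t) (by simpa only [map_pow] using hsum)
  -- The same rank formula for t in place of c; comparing the two gives e = ℓ^k f.
  have hf := hπ.finrank_eq_mul (Nat.mul_pos (pow_pos hpr.pos _) (by omega)) hw₁ hcw₁ hwe₁
    (y' := τ t - 1)
    fun x => by rw [LinearMap.sub_apply, LinearMap.sub_apply, hτ, map_sub]; rfl
  set e := finrank (ResidueField O) (_ ⧸ LinearMap.range y') with hedef
  set f := finrank (ResidueField O) (_ ⧸ LinearMap.range (τ t - 1)) with hfdef
  have hst : τ.IsStable (LinearMap.range y') := by
    rintro g _ ⟨q, rfl⟩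
    obtain ⟨x, rfl⟩ := hπ.surjective q
    refine ⟨π (α g x), ?_⟩
    rw [hy'π, hy'π, hτ]
    exact congrArg π (LinearMap.congr_fun (hyα g) x)
  have hdvd := finrank_dvd_of_isIrreducibleLattice hG hα hσ hp hpσ e (j := LinearMap.id) (α₁ := α)
    (fun _ _ h => h) (fun _ _ => rfl) (τ.quotient _ hst)
    (q := ((LinearMap.range y').mkQ.restrictScalars O) ∘ₗ π)
    ((LinearMap.range y').mkQ_surjective.comp hπ.surjective)
    (fun g x => by rw [LinearMap.comp_apply, ← hτ]; rfl) rfl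
  have heven' : Even e := heven.trans_dvd hdvd
  have hef : e = ℓ ^ k * f := by
    refine Nat.eq_of_mul_eq_mul_left (by omega : 0 < ℓ - 1) ?_
    rw [← he, hf]; ring
  have hpos : 0 < finrank O T := by
    have := hσ.nontrivial
    have := hp.nontrivial
    exact Module.finrank_pos
  -- e is even and ℓ^k is odd, so f is even; it is positive.
  have hf2 : 2 ≤ f := by
    have hodd : ¬ Even (ℓ ^ k) := by
      rw [Nat.not_even_iff_odd]
      exact (hpr.odd_of_ne_two (by omega)).pow
    have h1 : Even f := by
      rw [hef, Nat.even_mul] at heven'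
      exact heven'.resolve_left hodd
    obtain ⟨a, ha⟩ := h1
    rcases Nat.eq_zero_or_pos a with rfl | h
    · rw [hf, ha] at hpos; simp at hpos
    · omega
  refine ((hasSymplecticLattice_two_mul hG (τ.quotient _ hst)).add
    (hasSymplecticLattice_cyclotomic hG)).mono ?_ ?_
  · rw [← hedef, he, hef, pow_succ]
    -- The inequality is 2f + (ℓ - 1) ≤ (ℓ - 1)f, with slack ba + b + 2a for f = a + 2 and ℓ = b +
    -- 5. It would fail for ℓ = 3, f = 2.
    obtain ⟨a, ha⟩ : ∃ a, f = a + 2 := ⟨f - 2, by omega⟩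
    obtain ⟨b, hb⟩ : ∃ b, ℓ = b + 5 := ⟨ℓ - 5, by omega⟩
    have h1 : ℓ ^ k * ℓ - ℓ ^ k = ℓ ^ k * (b + 4) := by
      rw [hb]
      refine Nat.sub_eq_of_eq_add ?_
      ring
    rw [h1, show ℓ - 1 = b + 4 by omega, ha]
    have h2 : 0 ≤ ℓ ^ k * (b * a + b + 2 * a) := Nat.zero_le _
    nlinarith
  · rintro g ⟨hg, hgc⟩
    refine ⟨fun hgH => ?_, hgc⟩
    have hgq := hg hgH
    -- `g - 1` is divisible by `c - 1`
    have h1 : ∀ x, ∃ z, (α g - 1) x = y z := fun x => by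
      have h2 : (LinearMap.range y').mkQ (τ g (π x)) = (LinearMap.range y').mkQ (π x) :=
        LinearMap.congr_fun hgq ((LinearMap.range y').mkQ (π x))
      rw [← sub_eq_zero, ← map_sub, ← LinearMap.mem_ker, Submodule.ker_mkQ] at h2
      obtain ⟨q, hq⟩ := h2
      obtain ⟨z, rfl⟩ := hπ.surjective q
      rw [hy'π, hτ, ← sub_eq_zero, ← map_sub, ← map_sub, hπ.map_eq_zero_iff] at hq
      obtain ⟨a, ha⟩ := hq
      obtain ⟨w, rfl⟩ := hw
      refine ⟨z - (y ^ (ℓ - 2)) (((w⁻¹ : (End O T)ˣ) : End O T) a), ?_⟩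
      have h3 : y ((y ^ (ℓ - 2)) (((w⁻¹ : (End O T)ˣ) : End O T) a)) = ℓ • a := by
        rw [← Module.End.mul_apply, ← pow_succ', show ℓ - 2 + 1 = ℓ - 1 by omega, hwe]
        exact congrArg (ℓ • ·) (LinearMap.congr_fun w.mul_inv a)
      rw [map_sub, h3, ← ha, sub_sub_cancel]; rfl
    have hgy : Commute y (α g - 1) := (hyα g).sub_right (Commute.one_right _)
    have h2 : ∀ i x, ∃ z, ((α g - 1) ^ i) x = (y ^ i) z := fun i => by
      induction i with
      | zero => exact fun x => ⟨x, rfl⟩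
      | succ i ih =>
        intro x
        obtain ⟨z, hz⟩ := ih x
        obtain ⟨z', hz'⟩ := h1 z
        refine ⟨z', ?_⟩
        rw [pow_succ', Module.End.mul_apply, hz, ← Module.End.mul_apply, ← (hgy.pow_left i).eq,
          Module.End.mul_apply, hz', ← Module.End.mul_apply, ← pow_succ]
    -- Since (c - 1)^(ℓ-1) is ℓ times a unit, g is unipotent modulo ℓ.
    obtain ⟨v, hv⟩ := exists_linearMap_eq_nsmul (ℓ := ℓ) ((α g - 1) ^ (ℓ - 1)) fun x => by
      obtain ⟨z, hz⟩ := h2 (ℓ - 1) x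
      exact ⟨w z, by rw [hz, hwe]; rfl⟩
    refine eq_one_of_unipotent_mod (ℓ := ℓ) (O := O) (r := ℓ - 1) (by omega) hv hG.not_dvd ?_
    rw [← map_pow]
    have := congrArg Subtype.val (pow_card_eq_one' (x := (⟨g, hgH⟩ : H)))
    rw [show g ^ Nat.card H = 1 from this, map_one]

end AbsolutelyUnramified

/-! ### Simple symplectic representations with nontrivial central element of order ℓ. -/

namespace AbsolutelyUnramified

variable {ℓ : ℕ} {O : Type*} [CommRing O] [IsDomain O] [IsDiscreteValuationRing O]
  [hO : AbsolutelyUnramified ℓ O] {K : Type*} [Field K] [Algebra O K] [IsFractionRing O K]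
  {V : Type*} [AddCommGroup V] [Module K V] [Module O V] [IsScalarTower O K V]
  [Module.Finite K V] {G : Type*} [Group G] {ρ : Representation K G V} {T : Submodule O V}

omit [Module.Finite K V] in
include hO in
theorem isIrreducibleLattice_of_isSimple (hρ : ρ.IsSimple)
    {α : Representation O G T} (hα : ∀ g x, (α g x : V) = ρ g x) : α.IsIrreducibleLattice := by
  intro J hJ hsat
  let W := Submodule.span K ((J.map T.subtype : Submodule O V) : Set V)
  have hW : ρ.IsStable W := fun g => by
    refine Submodule.span_le.2 ?_
    rintro _ ⟨x, hx, rfl⟩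
    exact Submodule.subset_span ⟨α g x, hJ g hx, hα g x⟩
  rcases hρ.eq_bot_or_eq_top W hW with h | h
  · left
    rw [eq_bot_iff]
    intro x hx
    have : (x : V) ∈ W := Submodule.subset_span ⟨x, hx, rfl⟩
    rw [h, Submodule.mem_bot] at this
    exact Subtype.ext this
  · right
    rw [eq_top_iff]
    intro x _
    have hx : (x : V) ∈ W := h ▸ Submodule.mem_top
    obtain ⟨m, y, hy, hyx⟩ := exists_pow_nsmul_mem_of_mem_span (ℓ := ℓ) hx
    refine hsat ((ℓ ^ m : ℕ) : O) x
      (Nat.cast_ne_zero.2 (pow_ne_zero _ hO.prime.ne_zero)) ?_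
    rw [Nat.cast_smul_eq_nsmul, show ℓ ^ m • x = y from Subtype.ext hyx.symm]
    exact hy

variable {b : V →ₗ[K] V →ₗ[K] K} [Finite G] {k : ℕ} {H : Subgroup G} {t : G}

omit [IsDomain O] [IsDiscreteValuationRing O] hO [Algebra O K] [IsFractionRing O K] [Module O V]
  [IsScalarTower O K V] [Module.Finite K V] [Finite G] in
theorem sum_pow_eq_zero_of_isSimple (hρ : ρ.IsSimple) {c : G} (hc : ∀ g, Commute c g)
    (hρc : ρ c ≠ 1) (hcl : c ^ ℓ = 1) : ∑ i ∈ Finset.range ℓ, ρ c ^ i = 0 := by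
  have hker : LinearMap.ker (ρ c - 1) = ⊥ := by
    refine (hρ.eq_bot_or_eq_top _ fun g x hx => ?_).resolve_right fun h =>
      hρc (sub_eq_zero.1 (LinearMap.ker_eq_top.1 h))
    rw [LinearMap.mem_ker, LinearMap.sub_apply, Module.End.one_apply, sub_eq_zero] at hx
    rw [Submodule.mem_comap, LinearMap.mem_ker, LinearMap.sub_apply, Module.End.one_apply,
      ← Module.End.mul_apply, ((hc g).map ρ : Commute _ _).eq, Module.End.mul_apply, hx, sub_self]
  have h1 := mul_geom_sum (ρ c) ℓ
  rw [← map_pow, hcl, map_one, sub_self] at h1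
  refine LinearMap.ext fun x => LinearMap.ker_eq_bot.1 hker ?_
  rw [LinearMap.zero_apply, map_zero]
  exact LinearMap.congr_fun h1 x

omit [Finite G] [Module.Finite K V] in
theorem IsMaximalLattice.hasSymplecticLattice_of_dualLattice (hT : IsMaximalLattice ρ b T)
    (hb : IsSymplecticRep ρ b) (hD : dualLattice O b T = T) :
    HasSymplecticLattice O (finrank K V) {g | ρ g = 1} := by
  have := hT.finite
  have := hT.free
  obtain ⟨α, hα⟩ := hT.exists_representation
  obtain ⟨bT, hbT⟩ := hT.exists_form
  have hinj := IsFractionRing.injective O K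
  refine HasSymplecticLattice.of_isSymplecticRep (ρ := α) (b := bT)
    ⟨⟨fun x => hinj ?_, ?_, fun φ => ?_⟩, fun g x y => hinj ?_⟩ hT.finrank_eq.le
    fun g hg => hT.ext_on fun x hx => ?_
  · rw [hbT, hb.form.1, map_zero]
  · refine (injective_iff_map_eq_zero bT).2 fun x hx => Subtype.ext
      (hb.form.eq_zero_of_left fun y => ?_)
    have : b x = 0 := hT.ext_on fun y hy => by
      rw [← hbT x ⟨y, hy⟩, hx, LinearMap.zero_apply, LinearMap.zero_apply, map_zero]
    rw [this, LinearMap.zero_apply]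
  · obtain ⟨v, hv⟩ := hT.exists_eq_dual hb.form φ
    have hvT : v ∈ T := hD ▸ mem_dualLattice.2 fun y hy => ⟨_, (hv ⟨y, hy⟩).symm⟩
    exact ⟨⟨v, hvT⟩, LinearMap.ext fun y => hinj (by rw [hbT, hv])⟩
  · rw [hbT, hbT, hα, hα, hb.invariant]
  · have := congrArg Subtype.val (LinearMap.congr_fun hg ⟨x, hx⟩)
    rw [hα] at this
    exact this

omit [Finite G] [Module.Finite K V] in
include ℓ in
/-- If a maximal integral lattice is not self-dual, then some stable lattice has a simple quotient
of even dimension. -/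
theorem IsMaximalLattice.exists_even_quotient (hT : IsMaximalLattice ρ b T)
    (hb : IsSymplecticRep ρ b) (hD : dualLattice O b T ≠ T) :
    ∃ (T' : Submodule O V) (hT' : IsStableLattice ρ T') (n : ℕ) (Q : Submodule (ResidueField O)
      (Fin n → ResidueField O)) (B : Submodule (ResidueField O) (_ ⧸ Q))
      (σ : Representation (ResidueField O) G B) (p : T' →ₗ[O] B), σ.IsSimple ∧
      Function.Surjective p ∧
      (∀ g (x : T'), p ⟨ρ g x, hT'.stable g x x.2⟩ = σ g (p x)) ∧ Even (finrank (ResidueField O) B) := by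
  have hinj := IsFractionRing.injective O K
  have hl0 : (ℓ : K) ≠ 0 := by
    rw [← map_natCast (algebraMap O K), Ne, map_eq_zero_iff _ hinj]
    exact Nat.cast_ne_zero.2 hO.prime.ne_zero
  have hTD : T ≤ dualLattice O b T := fun x hx => mem_dualLattice.2 fun y hy => hT.integral x hx y hy
  set D := dualLattice O b T with hDdef
  have hN := hT.isNoetherian_dualLattice hb.form
  have := hT.isLattice
  have hlat : ∀ T', T ≤ T' → T' ≤ D → (∀ g, ∀ x ∈ T', ρ g x ∈ T') → IsStableLattice ρ T' :=
    fun T' h1 h2 h3 => ⟨Submodule.IsLattice.of_le_of_isLattice_of_fg K h1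
      ((isNoetherian_submodule.1 hN) _ h2), h3⟩
  have hDs := hlat D hTD le_rfl (hT.stable_dualLattice hb.invariant)
  have := hDs.finite
  have := hDs.free
  obtain ⟨γ, hγ⟩ := hDs.exists_representation
  -- On the dual D the form ℓb is integral, and its reduction vanishes exactly at the pairs where b
  -- itself is integral; in particular T reduces into the radical.
  have hDi : IsIntegralLattice ρ (ℓ • b) D := ⟨hDs, fun x hx y hy => by
    rw [LinearMap.smul_apply, LinearMap.smul_apply, ← map_nsmul]
    exact mem_dualLattice.1 hx _ (hT.nsmul_mem hb hy)⟩
  obtain ⟨c, hc'⟩ := hDi.exists_form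
  have hc : ∀ x y, algebraMap O K (c x y) = ℓ • b x y := hc'
  obtain ⟨π, hπ⟩ := exists_isReduction (ℓ := ℓ) O D
  have hfin := hπ.finite
  obtain ⟨σ, hσ⟩ := hπ.exists_representation γ
  obtain ⟨β, hβ⟩ := hπ.exists_bilin c
  -- integrality in terms of the residual form
  have hint : ∀ x y : D, β (π x) (π y) = 0 ↔ b x y ∈ LinearMap.range (Algebra.linearMap O K) := by
    intro x y
    rw [hβ]
    constructor
    · intro h
      obtain ⟨a, ha⟩ := exists_of_residue_eq_zero (ℓ := ℓ) h
      refine ⟨a, mul_left_cancel₀ hl0 ?_⟩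
      rw [Algebra.linearMap_apply, ← nsmul_eq_mul, ← map_nsmul, ← ha, hc, nsmul_eq_mul]
    · rintro ⟨a, ha⟩
      have : c x y = ℓ • a := hinj (by rw [hc, ← ha, map_nsmul]; rfl)
      rw [this, map_nsmul, nsmul_residue_eq_zero O]
  obtain ⟨hst, β', hβ', hββ'⟩ := exists_quotient_form (ρ := σ) (b := β)
    (fun q => by
      obtain ⟨x, rfl⟩ := hπ.surjective q
      have : c x x = 0 := hinj (by rw [hc, hb.form.1, smul_zero, map_zero])
      rw [hβ, this, map_zero])
    (fun g p q => by
      obtain ⟨x, rfl⟩ := hπ.surjective p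
      obtain ⟨y, rfl⟩ := hπ.surjective q
      have : c (γ g x) (γ g y) = c x y := hinj (by rw [hc, hc, hγ, hγ, hb.invariant])
      rw [hσ, hσ, hβ, hβ, this])
  let q : D →ₗ[O] (_ ⧸ LinearMap.ker β) := ((LinearMap.ker β).mkQ.restrictScalars O) ∘ₗ π
  have hqs : Function.Surjective q := (LinearMap.ker β).mkQ_surjective.comp hπ.surjective
  have hqint : ∀ x y : D, β' (q x) (q y) = 0 ↔ b x y ∈ LinearMap.range (Algebra.linearMap O K) :=
    fun x y => (by rw [← hint, ← hββ']; rfl)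
  have hqσ : ∀ g x, q (γ g x) = σ.quotient _ hst g (q x) := fun g x => by
    change (LinearMap.ker β).mkQ (π (γ g x)) = (LinearMap.ker β).mkQ (σ g (π x))
    rw [hσ]
  have hne : (⊤ : Submodule (ResidueField O) (_ ⧸ LinearMap.ker β)) ≠ ⊥ := fun h => by
    refine hD (hT.maximal D ⟨hDs, fun x hx y hy => ?_⟩ hTD)
    rw [← hqint ⟨x, hx⟩ ⟨y, hy⟩, (Submodule.eq_bot_iff _).1 h (q ⟨x, hx⟩) Submodule.mem_top, map_zero,
      LinearMap.zero_apply]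
  obtain ⟨B, hB, -, hBs⟩ := Representation.IsStable.exists_isSimple
    (ρ := σ.quotient _ hst) (S := ⊤) (fun _ _ _ => trivial) hne
  let T' : Submodule O V := ((B.restrictScalars O).comap q).map D.subtype
  have hmem : ∀ x, x ∈ T' ↔ ∃ hx : x ∈ D, q ⟨x, hx⟩ ∈ B := fun x => by
    constructor
    · rintro ⟨y, hy, rfl⟩
      exact ⟨y.2, hy⟩
    · rintro ⟨hx, hxB⟩
      exact ⟨⟨x, hx⟩, hxB, rfl⟩
  have hq0 : ∀ x : D, (x : V) ∈ T → q x = 0 := fun x hx => hβ'.form.eq_zero_of_left fun y => by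
    obtain ⟨y, rfl⟩ := hqs y
    rw [hqint, ← hb.form.neg]
    exact Submodule.neg_mem _ (mem_dualLattice.1 y.2 x hx)
  have hTT' : T ≤ T' := fun x hx => (hmem x).2 ⟨hTD hx, by rw [hq0 _ hx]; exact B.zero_mem⟩
  have hT'D : T' ≤ D := fun x hx => ((hmem x).1 hx).1
  have hT' : IsStableLattice ρ T' := hlat T' hTT' hT'D fun g x hx => by
    obtain ⟨hxD, hxB⟩ := (hmem x).1 hx
    refine (hmem _).2 ⟨hDs.stable g x hxD, ?_⟩
    have h1 : (⟨ρ g x, hDs.stable g x hxD⟩ : D) = γ g ⟨x, hxD⟩ := Subtype.ext (hγ g ⟨x, hxD⟩).symm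
    rw [h1, hqσ]
    exact hB g hxB
  -- Were B isotropic, its preimage T' would be an integral lattice containing T, hence equal to T,
  -- and B would vanish. So B is a symplectic space, of even dimension.
  have hBn : B ⊓ LinearMap.BilinForm.orthogonal β' B = ⊥ := by
    refine (hBs.le_or_inf_eq_bot (hβ'.isStable_orthogonal hB)).resolve_left fun h => ?_
    have h1 := hT.maximal T' ⟨hT', fun x hx y hy => by
      obtain ⟨hxD, hxB⟩ := (hmem x).1 hx
      obtain ⟨hyD, hyB⟩ := (hmem y).1 hy
      exact (hqint ⟨x, hxD⟩ ⟨y, hyD⟩).1 (LinearMap.BilinForm.mem_orthogonal_iff.1 (h hyB) _ hxB)⟩ hTT'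
    have := hBs.nontrivial
    obtain ⟨e, he⟩ := exists_ne (0 : B)
    obtain ⟨x, hx⟩ := hqs e
    refine he (Subtype.ext ?_)
    rw [← hx, hq0 x (h1 ▸ (hmem x).2 ⟨x.2, by rw [Subtype.coe_eta, hx]; exact e.2⟩)]
    rfl
  have hBform : IsSymplecticForm (restrictForm β' B) :=
    isSymplecticForm_of_separating (fun x => hβ'.form.1 x) fun x hx => by
      have : (x : _ ⧸ LinearMap.ker β) ∈ B ⊓ LinearMap.BilinForm.orthogonal β' B :=
        ⟨x.2, LinearMap.BilinForm.mem_orthogonal_iff.2 fun y hy => by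
          change β' y x = 0
          rw [← hβ'.form.neg, neg_eq_zero]
          exact hx ⟨y, hy⟩⟩
      rw [hBn, Submodule.mem_bot] at this
      exact Subtype.ext this
  let p : T' →ₗ[O] B := (q ∘ₗ Submodule.inclusion hT'D).codRestrict (B.restrictScalars O)
    fun x => ((hmem x).1 x.2).2
  have hp : ∀ x : T', (p x : _ ⧸ LinearMap.ker β) = q ⟨x, hT'D x.2⟩ := fun x => rfl
  refine ⟨T', hT', _, LinearMap.ker β, B, _, p, hBs, fun e => ?_, fun g x => Subtype.ext ?_, ?_⟩
  · obtain ⟨x, hx⟩ := hqs e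
    exact ⟨⟨x, (hmem x).2 ⟨x.2, by rw [Subtype.coe_eta, hx]; exact e.2⟩⟩, Subtype.ext hx⟩
  · change q _ = σ.quotient _ hst g (q ⟨x, hT'D x.2⟩)
    rw [← hqσ]
    exact congrArg q (Subtype.ext (hγ g ⟨x, hT'D x.2⟩).symm)
  · refine hBform.even_finrank fun h => ?_
    have := charP_residueField O (ℓ := ℓ)
    have h2 : ((2 : ℕ) : ResidueField O) = 0 := by exact_mod_cast h
    have := Nat.le_of_dvd two_pos ((CharP.cast_eq_zero_iff _ ℓ 2).1 h2)
    have := hO.five_le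
    omega

variable (hG : IsCyclicExtension ℓ (k + 1) H t) (hc : ∀ g, Commute (t ^ ℓ ^ k) g)

-- Either the maximal lattice is self-dual and serves directly, or `exists_even_quotient` provides
-- the even-dimensional quotient needed for the trade.
variable (O) in
include hG hc in
theorem hasSymplecticLattice_of_isSimple_of_central (hb : IsSymplecticRep ρ b) (hρ : ρ.IsSimple)
    (hρc : ρ (t ^ ℓ ^ k) ≠ 1) :
    HasSymplecticLattice O (finrank K V) {g | (g ∈ H → ρ g = 1) ∧ g ≠ t ^ ℓ ^ k} := by
  obtain ⟨T₀, hT₀⟩ := exists_isIntegralLattice (O := O) ρ b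
  obtain ⟨T, -, hT⟩ := hT₀.exists_isMaximalLattice hb.form
  by_cases hD : dualLattice O b T = T
  · refine (hT.hasSymplecticLattice_of_dualLattice hb hD).mono le_rfl ?_
    rintro g hg
    exact ⟨fun _ => hg, fun h => hρc (h ▸ hg)⟩
  obtain ⟨T', hT', n, Q, B, σ, p, hσ, hp, hpσ, heven⟩ := hT.exists_even_quotient hb hD
  have := hT'.finite
  have := hT'.free
  obtain ⟨α, hα⟩ := hT'.exists_representation
  have hcl : (t ^ ℓ ^ k) ^ ℓ = 1 := by
    rw [← pow_mul, ← pow_succ, ← hG.orderOf_eq, pow_orderOf_eq_one]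
  have hsum := sum_pow_eq_zero_of_isSimple hρ hc hρc hcl
  refine (hasSymplecticLattice_of_even_quotient hG (isIrreducibleLattice_of_isSimple hρ hα) hσ hp
    (fun g x => ?_) heven hc (LinearMap.ext fun x => Subtype.ext ?_)).mono hT'.finrank_eq.le ?_
  · rw [← hpσ]
    exact congrArg p (Subtype.ext (hα g x))
  · have h1 : ∀ i, ((α (t ^ ℓ ^ k) ^ i) x : V) = (ρ (t ^ ℓ ^ k) ^ i) x := fun i => by
      rw [← map_pow, hα, map_pow]
    rw [LinearMap.sum_apply, Submodule.coe_sum, Finset.sum_congr rfl fun i _ => h1 i,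
      ← LinearMap.sum_apply, hsum]
    rfl
  · rintro g ⟨hg, hgc⟩
    refine ⟨fun hgH => hT'.ext_on fun x hx => ?_, hgc⟩
    have := congrArg Subtype.val (LinearMap.congr_fun (hg hgH) ⟨x, hx⟩)
    rw [hα] at this
    exact this

end AbsolutelyUnramified

/-! ### Reduction of the central case to a simple subrepresentation. -/

namespace AbsolutelyUnramified

variable {ℓ : ℕ} {O : Type*} [CommRing O] [IsDomain O] [IsDiscreteValuationRing O]
  [hO : AbsolutelyUnramified ℓ O] {K : Type*} [Field K] [Algebra O K] [IsFractionRing O K]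
  {V : Type*} [AddCommGroup V] [Module K V] [Module O V] [IsScalarTower O K V]
  [Module.Finite K V] {G : Type*} [Group G] {ρ : Representation K G V} {b : V →ₗ[K] V →ₗ[K] K}

theorem sub_mem_orthogonal {F : Type*} [Field F] {V : Type*} [AddCommGroup V] [Module F V]
    {ρ : Representation F G V} {b : V →ₗ[F] V →ₗ[F] F} (hinv : ∀ g x y, b (ρ g x) (ρ g y) = b x y)
    {S : Submodule F V} {g : G} (hg : ∀ s ∈ S, ρ g s = s) (v : V) :
    ρ g v - v ∈ LinearMap.BilinForm.orthogonal b S := by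
  refine LinearMap.BilinForm.mem_orthogonal_iff.2 fun s hs => ?_
  change b s (ρ g v - v) = 0
  rw [map_sub, sub_eq_zero]
  nth_rewrite 1 [← hg s hs]
  exact hinv g s v

variable [Finite G] {k : ℕ} {H : Subgroup G} {t : G} (hG : IsCyclicExtension ℓ (k + 1) H t)

-- A stable lattice of S is lifted without reduction, together with its dual, so the action of
-- t^(ℓ^k) on it survives; S^⊥/S goes through the general construction. An element of H trivial on
-- both parts is unipotent of finite order in characteristic zero.
include hG in
theorem hasSymplecticLattice_of_isotropic {S : Submodule K V} (hb : IsSymplecticRep ρ b)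
    (hS : ρ.IsStable S)
    (hiso : S ≤ LinearMap.BilinForm.orthogonal b S)
    (hc : ρ.subrepresentation S hS (t ^ ℓ ^ k) ≠ 1) :
    HasSymplecticLattice O (finrank K V) {g | (g ∈ H → ρ g = 1) ∧ g ≠ t ^ ℓ ^ k} := by
  have hp := hO.prime
  obtain ⟨T, hT⟩ := exists_isStableLattice O (ρ.subrepresentation S hS)
  have := hT.finite
  have := hT.free
  obtain ⟨α, hα⟩ := hT.exists_representation
  have hSo := hb.isStable_orthogonal hS
  set P := LinearMap.BilinForm.orthogonal b S with hP
  obtain ⟨hst, β, hβ, hββ⟩ := exists_quotient_form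
    (ρ := ρ.subrepresentation P hSo)
    (b := restrictForm b P) (fun x => hb.form.1 _)
    (fun g x y => hb.invariant g x y)
  have hPmem : ∀ x, x ∈ P ↔ ∀ s ∈ S, b s x = 0 := fun x => LinearMap.BilinForm.mem_orthogonal_iff
  have hkerS : ∀ x : P, x ∈ LinearMap.ker (restrictForm b P) ↔ (x : V) ∈ S := fun x => by
    constructor
    · intro hx
      refine hb.form.mem_of_forall_orthogonal fun y hy => ?_
      exact LinearMap.congr_fun (LinearMap.mem_ker.1 hx) ⟨y, (hPmem y).2 hy⟩
    · intro hx
      exact LinearMap.mem_ker.2 (LinearMap.ext fun y => (hPmem y).1 y.2 x hx)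
  have hker : LinearMap.ker (restrictForm b P) = S.comap P.subtype := Submodule.ext hkerS
  refine ((hasSymplecticLattice_hyperbolic (N := {g | ρ.subrepresentation S hS g = 1}) α le_rfl
    fun g hg => hT.ext_on fun x hx => ?_).add
      (hasSymplecticLattice_of_isSymplecticRep O hG hβ)).mono ?_ ?_
  · have := congrArg Subtype.val (LinearMap.congr_fun hg ⟨x, hx⟩)
    rw [hα] at this
    exact this
  · have h1 := hb.form.finrank_orthogonal_add S
    have h2 := (LinearMap.ker (restrictForm b P)).finrank_quotient_add_finrank
    have h3 : finrank K (LinearMap.ker (restrictForm b P)) = finrank K S := by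
      rw [hker]
      exact (Submodule.comapSubtypeEquivOfLe hiso).finrank_eq
    rw [hT.finrank_eq]
    rw [← hP] at h1
    omega
  · rintro g ⟨hgS, hgE⟩
    have hgS' : ρ.subrepresentation S hS g = 1 := hgS
    refine ⟨fun hgH => ?_, fun h => hc (h ▸ hgS')⟩
    have hs : ∀ s ∈ S, ρ g s = s := fun s hs =>
      congrArg Subtype.val (LinearMap.congr_fun hgS' ⟨s, hs⟩)
    have hE := hgE hgH
    have h1 : ∀ x ∈ P, ρ g x - x ∈ S := fun x hx => by
      have h2 : (LinearMap.ker (restrictForm b P)).mkQ (ρ.subrepresentation P hSo g ⟨x, hx⟩) =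
          (LinearMap.ker (restrictForm b P)).mkQ ⟨x, hx⟩ :=
        LinearMap.congr_fun hE ((LinearMap.ker (restrictForm b P)).mkQ ⟨x, hx⟩)
      rw [← sub_eq_zero, ← map_sub, ← LinearMap.mem_ker, Submodule.ker_mkQ, hkerS] at h2
      exact h2
    have : CharZero K := charZero_of_injective_algebraMap (IsFractionRing.injective O K)
    refine eq_one_of_sub_one_pow_of_charZero (F := K) (r := 3) (m := Nat.card H) (LinearMap.ext fun v => ?_)
      (Nat.card_pos.ne') ?_
    · have h3 := h1 _ (sub_mem_orthogonal hb.invariant hs v)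
      have h4 := hs _ h3
      rw [← sub_eq_zero] at h4
      exact h4
    · have := congrArg Subtype.val (pow_card_eq_one' (x := (⟨g, hgH⟩ : H)))
      rw [← map_pow, show g ^ Nat.card H = 1 from this, map_one]

include hG in
/-- A symplectic representation on which the central element of order `ℓ` acts nontrivially gives a
symplectic lattice with the same property. -/
theorem hasSymplecticLattice_of_central (hc : ∀ g, Commute (t ^ ℓ ^ k) g)
    (hb : IsSymplecticRep ρ b) (hρc : ρ (t ^ ℓ ^ k) ≠ 1) :
    HasSymplecticLattice O (finrank K V) {g | (g ∈ H → ρ g = 1) ∧ g ≠ t ^ ℓ ^ k} := by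
  have hp := hO.prime
  set c := t ^ ℓ ^ k with hcdef
  have hcl : c ^ ℓ = 1 := by
    rw [hcdef, ← pow_mul, ← pow_succ, ← hG.orderOf_eq, pow_orderOf_eq_one]
  have : CharZero K := charZero_of_injective_algebraMap (IsFractionRing.injective O K)
  -- On R the element c has no nonzero fixed vector: for such an x = (c - 1)v the identity (1 + c +
  -- ... + c^(ℓ-1))(c - 1) = 0 reads ℓx = 0. So c acts nontrivially on every simple S in R.
  let R := LinearMap.range (ρ c - 1)
  have hR : ρ.IsStable R := by
    rintro g _ ⟨x, rfl⟩
    refine ⟨ρ g x, ?_⟩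
    rw [LinearMap.sub_apply, LinearMap.sub_apply, map_sub, ← Module.End.mul_apply,
      ((hc g).map ρ : Commute _ _).eq]
    rfl
  have hR0 : R ≠ ⊥ := fun h => hρc (sub_eq_zero.1 (LinearMap.range_eq_bot.1 h))
  have hRc : ∀ x ∈ R, ρ c x = x → x = 0 := by
    rintro _ ⟨v, rfl⟩ hx
    have h1 := LinearMap.congr_fun (geom_sum_mul (ρ c) ℓ) v
    rw [← map_pow, hcl, map_one, sub_self, Module.End.mul_apply, LinearMap.sum_apply] at h1
    have h2 : ∀ i, (ρ c ^ i) ((ρ c - 1) v) = (ρ c - 1) v := fun i => by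
      induction i with
      | zero => rfl
      | succ i ih => rw [pow_succ, Module.End.mul_apply, hx, ih]
    rw [Finset.sum_congr rfl fun i _ => h2 i, Finset.sum_const, Finset.card_range,
      ← Nat.cast_smul_eq_nsmul K, LinearMap.zero_apply, smul_eq_zero] at h1
    exact h1.resolve_left (Nat.cast_ne_zero.2 hp.ne_zero)
  obtain ⟨S, hS, hSR, hSs⟩ := hR.exists_isSimple hR0
  have hSc : ρ.subrepresentation S hS c ≠ 1 := fun h => by
    have := hSs.nontrivial
    obtain ⟨s, hs⟩ := exists_ne (0 : S)
    exact hs (Subtype.ext (hRc s (hSR s.2) (congrArg Subtype.val (LinearMap.congr_fun h s))))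
  rcases hSs.le_or_inf_eq_bot (hb.isStable_orthogonal hS) with hiso | hinf
  · exact hasSymplecticLattice_of_isotropic hG hb hS hiso hSc
  set P := LinearMap.BilinForm.orthogonal b S with hP
  have hPmem : ∀ x, x ∈ P ↔ ∀ s ∈ S, b s x = 0 := fun x => LinearMap.BilinForm.mem_orthogonal_iff
  have hPP : ∀ x, (∀ y ∈ P, b y x = 0) → x ∈ S := fun x hx =>
    hb.form.mem_of_forall_orthogonal fun y hy => by
      rw [← hb.form.neg, hx y ((hPmem y).2 hy), neg_zero]
  have h0 : ∀ x, x ∈ S → x ∈ P → x = 0 := fun x hxS hxP => by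
    have : x ∈ S ⊓ P := ⟨hxS, hxP⟩
    rwa [hinf, Submodule.mem_bot] at this
  have hbS : IsSymplecticRep (ρ.subrepresentation S hS) (restrictForm b S) :=
    ⟨isSymplecticForm_of_separating (fun x => hb.form.1 _) fun x hx =>
      Subtype.ext (h0 x x.2 ((hPmem x).2 fun s hs => by
        rw [← hb.form.neg, neg_eq_zero]; exact hx ⟨s, hs⟩)), fun g x y => hb.invariant g x y⟩
  have hSo := hb.isStable_orthogonal hS
  have hbP : IsSymplecticRep (ρ.subrepresentation P hSo) (restrictForm b P) :=
    ⟨isSymplecticForm_of_separating (fun x => hb.form.1 _) fun x hx =>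
      Subtype.ext (h0 x (hPP x fun y hy => by
        rw [← hb.form.neg, neg_eq_zero]; exact hx ⟨y, hy⟩) x.2), fun g x y => hb.invariant g x y⟩
  refine ((hasSymplecticLattice_of_isSimple_of_central O hG hc hbS hSs hSc).add
    (hasSymplecticLattice_of_isSymplecticRep O hG hbP)).mono ?_ ?_
  · have := hb.form.finrank_orthogonal_add S
    rw [← hP] at this
    omega
  · rintro g ⟨⟨hgS, hgc⟩, hgP⟩
    refine ⟨fun hgH => LinearMap.ext fun v => sub_eq_zero.1 (h0 _ (hPP _ fun y hy => ?_) ?_), hgc⟩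
    · exact LinearMap.BilinForm.mem_orthogonal_iff.1 (sub_mem_orthogonal hb.invariant (S := P)
        (fun s hs => congrArg Subtype.val (LinearMap.congr_fun (hgP hgH) ⟨s, hs⟩)) v) y hy
    · exact sub_mem_orthogonal hb.invariant
        (fun s hs => congrArg Subtype.val (LinearMap.congr_fun (hgS hgH) ⟨s, hs⟩)) v

end AbsolutelyUnramified

/-! ### Normal subgroups that meet H trivially. -/

section Group

variable {ℓ k : ℕ} {G : Type*} [Group G] [Finite G] {H : Subgroup G} {t : G}

/-- N commutes with H. For n = h t^m the commutator [t, n] = [t, h] lies in H and in N, so t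
commutes with n and with h. Then n^(ℓ^k) = h^(ℓ^k) lies in both as well, and h, of order prime to ℓ,
is 1. -/
theorem IsCyclicExtension.exists_pow_of_normal (hp : ℓ.Prime) (hG : IsCyclicExtension ℓ k H t)
    {N : Subgroup G} [N.Normal] (hN : H ⊓ N = ⊥) {n : G} (hn : n ∈ N) :
    (∀ g, Commute n g) ∧ ∃ m : ℕ, n = t ^ m := by
  have := hG.normal
  have hcomm : ∀ h ∈ H, ∀ n ∈ N, h * n = n * h := fun h hh n hn =>
    Subgroup.commute_of_normal_of_disjoint H N hG.normal inferInstance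
      (disjoint_iff.2 hN) h n hh hn
  have hbot : ∀ x, x ∈ H → x ∈ N → x = 1 := fun x hxH hxN => by
    have : x ∈ H ⊓ N := ⟨hxH, hxN⟩
    rwa [hN, Subgroup.mem_bot] at this
  obtain ⟨⟨h, hh⟩, m, rfl⟩ := hG.exists_eq_mul n
  have ht : t * (h * t ^ m) = h * t ^ m * t := by
    have h1 : t * (h * t ^ m) * t⁻¹ * (h * t ^ m)⁻¹ = 1 := by
      refine hbot _ ?_ (N.mul_mem (Subgroup.Normal.conj_mem ‹_› _ hn t) (N.inv_mem hn))
      have h2 : t * (h * t ^ m) * t⁻¹ * (h * t ^ m)⁻¹ = t * h * t⁻¹ * h⁻¹ := by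
        have : t ^ m * t⁻¹ = t⁻¹ * t ^ m := ((Commute.refl t).inv_left.pow_right m).eq.symm
        rw [← mul_assoc, mul_assoc _ _ t⁻¹, this, mul_inv_rev]
        group
      rw [h2]
      exact H.mul_mem (hG.normal.conj_mem h hh t) (H.inv_mem hh)
    rwa [mul_inv_eq_one, mul_inv_eq_iff_eq_mul] at h1
  have hth : t * h = h * t := by
    rw [← mul_assoc, mul_assoc h, ← pow_succ, pow_succ', ← mul_assoc, mul_left_inj] at ht
    exact ht
  have hcht : Commute h (t ^ m) := (Commute.pow_right (show Commute h t from hth.symm) m)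
  have hpow : h ^ ℓ ^ k = 1 := by
    refine hbot _ (H.pow_mem hh _) ?_
    have h1 := N.pow_mem hn (ℓ ^ k)
    rwa [hcht.mul_pow, ← pow_mul t, mul_comm m, pow_mul t, ← hG.orderOf_eq, pow_orderOf_eq_one,
      one_pow, mul_one, hG.orderOf_eq] at h1
  have hcard : h ^ Nat.card H = 1 := congrArg Subtype.val (pow_card_eq_one' (x := (⟨h, hh⟩ : H)))
  have h1 : h = 1 := by
    have h3 := pow_gcd_eq_one.2 ⟨hpow, hcard⟩
    rwa [Nat.Coprime.gcd_eq_one (Nat.Coprime.pow_left k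
      ((Nat.Prime.coprime_iff_not_dvd hp).2 hG.not_dvd)), pow_one] at h3
  subst h1
  refine ⟨fun g => ?_, m, one_mul _⟩
  obtain ⟨h', m', rfl⟩ := hG.exists_eq_mul g
  rw [one_mul] at hn ⊢
  exact Commute.mul_right (hcomm _ h'.2 _ hn).symm (Commute.pow_pow_self t m m')

/-- A nontrivial normal subgroup meeting `H` trivially contains the elements of order `ℓ` of the
cyclic complement. -/
theorem IsCyclicExtension.pow_mem_of_normal (hp : ℓ.Prime) (hG : IsCyclicExtension ℓ (k + 1) H t)
    {N : Subgroup G} [N.Normal] (hN : H ⊓ N = ⊥) {n : G} (hn : n ∈ N) (hn1 : n ≠ 1) :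
    t ^ ℓ ^ k ∈ N := by
  obtain ⟨-, m, rfl⟩ := hG.exists_pow_of_normal hp hN hn
  obtain ⟨i, hi, hgcd⟩ := (Nat.dvd_prime_pow hp).1 (Nat.gcd_dvd_left (ℓ ^ (k + 1)) m)
  have hik : i ≤ k := by
    by_contra! h
    obtain rfl : i = k + 1 := by omega
    refine hn1 (orderOf_dvd_iff_pow_eq_one.1 ?_)
    rw [hG.orderOf_eq, ← hgcd]
    exact Nat.gcd_dvd_right _ _
  have h1 : t ^ ℓ ^ i ∈ N := by
    have h2 := Nat.gcd_eq_gcd_ab (ℓ ^ (k + 1)) m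
    rw [hgcd] at h2
    rw [← zpow_natCast, h2, zpow_add, zpow_mul, zpow_mul, zpow_natCast, zpow_natCast,
      ← hG.orderOf_eq, pow_orderOf_eq_one, one_zpow, one_mul]
    exact N.zpow_mem hn _
  obtain ⟨j, rfl⟩ := Nat.exists_eq_add_of_le hik
  rw [pow_add, pow_mul]
  exact N.pow_mem h1 _

end Group

/-! ### Faithful symplectic lattices. -/

namespace AbsolutelyUnramified

variable {ℓ : ℕ} (O : Type*) [CommRing O] [IsDomain O] [IsDiscreteValuationRing O]
  [hO : AbsolutelyUnramified ℓ O] {K : Type*} [Field K] [Algebra O K] [IsFractionRing O K]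
  {V : Type*} [AddCommGroup V] [Module K V] [Module O V] [IsScalarTower O K V]
  [Module.Finite K V] {G : Type*} [Group G] {ρ : Representation K G V} {b : V →ₗ[K] V →ₗ[K] K}
  [Finite G] {k : ℕ} {H : Subgroup G} {t : G} (hG : IsCyclicExtension ℓ k H t)

include hG in
/-- A faithful symplectic representation over the fraction field gives a faithful symplectic
lattice. -/
theorem hasSymplecticLattice_of_injective (hb : IsSymplecticRep ρ b) (hρ : Function.Injective ρ) :
    HasSymplecticLattice O (finrank K V) ({1} : Set G) := by
  have hp := hO.prime
  have hρ1 : ∀ g, ρ g = 1 → g = 1 := fun g h => hρ (h.trans (map_one ρ).symm)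
  -- Applied to the kernels of the constructed lattices: they meet H trivially.
  have key : ∀ (N : Subgroup G) [N.Normal], (∀ g ∈ N, g ∈ H → ρ g = 1) → H ⊓ N = ⊥ := fun N _ hN => by
    rw [eq_bot_iff]
    exact fun g hg => Subgroup.mem_bot.2 (hρ1 g (hN g hg.2 hg.1))
  cases k with
  | zero =>
    obtain ⟨r, hr, α, β, hβ, hα⟩ := hasSymplecticLattice_of_isSymplecticRep O hG hb
    refine ⟨r, hr, α, β, hβ, fun g hg => ?_⟩
    obtain ⟨-, m, rfl⟩ := hG.exists_pow_of_normal hp (key α.ker fun g hg => hα g hg) (n := g) hg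
    have ht : t = 1 := orderOf_eq_one_iff.1 (by rw [hG.orderOf_eq, pow_zero])
    rw [ht, one_pow]; rfl
  | succ k =>
    by_cases hc : ∀ g, Commute (t ^ ℓ ^ k) g
    · have hc1 : ρ (t ^ ℓ ^ k) ≠ 1 := fun h => by
        have h1 := orderOf_dvd_of_pow_eq_one (hρ1 _ h)
        rw [hG.orderOf_eq, Nat.pow_dvd_pow_iff_le_right hp.one_lt] at h1
        omega
      obtain ⟨r, hr, α, β, hβ, hα⟩ := hasSymplecticLattice_of_central (O := O) hG hc hb hc1
      refine ⟨r, hr, α, β, hβ, fun g hg => ?_⟩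
      by_contra hg1
      exact (hα _ (hG.pow_mem_of_normal hp (N := α.ker) (key α.ker fun g hg => (hα g hg).1) hg
        hg1)).2 rfl
    · obtain ⟨r, hr, α, β, hβ, hα⟩ := hasSymplecticLattice_of_isSymplecticRep O hG hb
      refine ⟨r, hr, α, β, hβ, fun g hg => ?_⟩
      by_contra hg1
      have hN := key α.ker fun g hg => hα g hg
      -- A nontrivial kernel would contain t^(ℓ^k) and be central, which is excluded in this case.
      exact hc (hG.exists_pow_of_normal hp hN (hG.pow_mem_of_normal hp hN hg hg1)).1

end AbsolutelyUnramified

/-! ### Symplectic bases and passage to matrices. -/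

section Hyperbolic

open Matrix

/-- The Gram matrix of the family is the standard symplectic matrix. -/
def IsHyperbolicFamily {R M ι : Type*} [CommRing R] [AddCommGroup M] [Module R M] [DecidableEq ι]
    (b : M →ₗ[R] M →ₗ[R] R) (e : ι ⊕ ι → M) : Prop :=
  ∀ i j, b (e i) (e j) = J ι R i j

namespace IsHyperbolicFamily

variable {R M : Type*} [CommRing R] [AddCommGroup M] [Module R M] {b : M →ₗ[R] M →ₗ[R] R}

theorem cons {s : ℕ} {e : Fin s ⊕ Fin s → M} (hb : IsSymplecticForm b)
    (he : IsHyperbolicFamily b e) {y w : M} (hy : ∀ i, b (e i) y = 0) (hw : ∀ i, b (e i) w = 0)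
    (hyw : b y w = -1) :
    IsHyperbolicFamily b (Sum.elim (Fin.cons y (e ∘ Sum.inl)) (Fin.cons w (e ∘ Sum.inr)) :
      Fin (s + 1) ⊕ Fin (s + 1) → M) := by
  have hy' : ∀ i, b y (e i) = 0 := fun i => by rw [← hb.neg, hy, neg_zero]
  have hw' : ∀ i, b w (e i) = 0 := fun i => by rw [← hb.neg, hw, neg_zero]
  have hwy : b w y = 1 := by rw [← hb.neg, hyw, neg_neg]
  rintro (i | i) (j | j) <;> refine Fin.cases ?_ (fun i => ?_) i <;>
    refine Fin.cases ?_ (fun j => ?_) j <;>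
    simp [J, hy, hw, hy', hw', hwy, hyw, hb.self_eq_zero, he _ _, Matrix.one_apply,
      Fin.succ_ne_zero, (Fin.succ_ne_zero _).symm]

variable {ι : Type*} [DecidableEq ι] [Fintype ι] {e : ι ⊕ ι → M} (he : IsHyperbolicFamily b e)

include he

theorem apply_sum (i : ι ⊕ ι) (a : ι ⊕ ι → R) : b (e i) (∑ j, a j • e j) = (J ι R *ᵥ a) i := by
  rw [map_sum, mulVec, dotProduct]
  exact Finset.sum_congr rfl fun j _ => by rw [map_smul, he, smul_eq_mul, mul_comm]

theorem linearIndependent : LinearIndependent R e := by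
  rw [Fintype.linearIndependent_iff]
  intro a ha
  have h1 : J ι R *ᵥ a = 0 := funext fun i => by
    rw [← he.apply_sum, ha, map_zero, Pi.zero_apply]
  have h2 := congrArg (J ι R *ᵥ ·) h1
  simp only [mulVec_mulVec, J_squared, neg_mulVec, one_mulVec, mulVec_zero, neg_eq_zero] at h2
  exact congrFun h2

/-- The component of a vector orthogonal to the family. -/
theorem exists_sub_mem_span (x : M) : ∃ y, (∀ i, b (e i) y = 0) ∧
    x - y ∈ Submodule.span R (Set.range e) := by
  let β : ι ⊕ ι → R := fun i => b (e i) x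
  refine ⟨x + ∑ j, (J ι R *ᵥ β) j • e j, fun i => ?_, ?_⟩
  · rw [map_add, he.apply_sum, mulVec_mulVec, J_squared, neg_mulVec, one_mulVec, Pi.neg_apply,
      add_neg_cancel]
  · rw [sub_add_cancel_left]
    exact Submodule.neg_mem _ (Submodule.sum_mem _ fun j _ =>
      Submodule.smul_mem _ _ (Submodule.subset_span ⟨j, rfl⟩))

end IsHyperbolicFamily

namespace AbsolutelyUnramified

variable {ℓ : ℕ} {O : Type*} [CommRing O] [IsDomain O] [IsDiscreteValuationRing O]
  [hO : AbsolutelyUnramified ℓ O] {M : Type*} [AddCommGroup M] [Module O M] [Module.Finite O M]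
  [Module.Free O M] {b : M →ₗ[O] M →ₗ[O] O}

include hO

/-- A vector orthogonal to the family can be made primitive. Perfectness of the form then gives a
partner on which the pairing is a unit, and its component orthogonal to the family completes the new
hyperbolic pair. -/
theorem exists_hyperbolicFamily_succ (hb : IsSymplecticForm b) {s : ℕ} {e : Fin s ⊕ Fin s → M}
    (he : IsHyperbolicFamily b e) (hspan : Submodule.span O (Set.range e) ≠ ⊤) :
    ∃ e : Fin (s + 1) ⊕ Fin (s + 1) → M, IsHyperbolicFamily b e := by
  obtain ⟨x, hx⟩ : ∃ x, x ∉ Submodule.span O (Set.range e) := by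
    by_contra! h
    exact hspan (eq_top_iff.2 fun x _ => h x)
  obtain ⟨y₀, hy₀, hxy⟩ := he.exists_sub_mem_span x
  have hne : y₀ ≠ 0 := fun h => hx (by rwa [h, sub_zero] at hxy)
  obtain ⟨m, y, rfl, hy⟩ := exists_eq_pow_nsmul (ℓ := ℓ) (O := O) hne
  have hy0 : ∀ i, b (e i) y = 0 := fun i =>
    pow_nsmul_eq_zero (ℓ := ℓ) O (n := m) (by rw [← map_nsmul, hy₀])
  obtain ⟨φ, hφ⟩ : ∃ φ : Module.Dual O M, residue O (φ y) ≠ 0 := by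
    by_contra! h
    obtain ⟨z, hz⟩ := exists_nsmul_of_forall_dual (ℓ := ℓ) h
    exact hy z hz
  obtain ⟨u, hu⟩ : IsUnit (φ y) := by
    rwa [Ne, residue_eq_zero_iff, mem_maximalIdeal, mem_nonunits_iff, not_not] at hφ
  obtain ⟨w₀, hw₀⟩ := hb.exists_eq φ
  obtain ⟨w, hw, hww⟩ := he.exists_sub_mem_span ((u⁻¹ : Oˣ) • w₀)
  have horth : ∀ z ∈ Submodule.span O (Set.range e), b y z = 0 := fun z hz => by
    induction hz using Submodule.span_induction with
    | mem z hz =>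
      obtain ⟨i, rfl⟩ := hz
      rw [← hb.neg, hy0, neg_zero]
    | zero => rw [map_zero]
    | add z z' _ _ h h' => rw [map_add, h, h', add_zero]
    | smul a z _ h => rw [map_smul, h, smul_zero]
  refine ⟨_, he.cons hb hy0 hw ?_⟩
  have h1 := horth _ hww
  rw [map_sub, sub_eq_zero] at h1
  rw [← h1, ← hb.neg, Units.smul_def, map_smul, LinearMap.smul_apply, hw₀, ← hu, smul_eq_mul,
    Units.inv_mul]

/-- A symplectic lattice has a symplectic basis. -/
theorem exists_symplectic_basis (hb : IsSymplecticForm b) :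
    ∃ (s : ℕ) (e : Basis (Fin s ⊕ Fin s) O M), IsHyperbolicFamily b e := by
  -- A hyperbolic family is independent and can be enlarged unless it spans, so without a basis
  -- there would be families longer than the rank.
  by_contra! hcon
  have hall : ∀ s, ∃ e : Fin s ⊕ Fin s → M, IsHyperbolicFamily b e := fun s => by
    induction s with
    | zero => exact ⟨Sum.elim Fin.elim0 Fin.elim0, by rintro (i | i) <;> exact i.elim0⟩
    | succ s ih =>
      obtain ⟨e, he⟩ := ih
      refine exists_hyperbolicFamily_succ hb he fun h => ?_
      refine hcon s (Basis.mk he.linearIndependent h.ge) ?_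
      rw [Basis.coe_mk]
      exact he
  obtain ⟨e, he⟩ := hall (finrank O M + 1)
  have := he.linearIndependent.fintype_card_le_finrank
  rw [Fintype.card_sum, Fintype.card_fin] at this
  omega

omit [IsDomain O] [IsDiscreteValuationRing O] hO [Module.Finite O M] [Module.Free O M] in
theorem exists_symplecticGroup_hom {G : Type*} [Group G] {ρ : Representation O G M}
    (hb : IsSymplecticRep ρ b) (hρ : ∀ g, ρ g = 1 → g = 1) {ι : Type*} [DecidableEq ι] [Fintype ι]
    (e : Basis (ι ⊕ ι) O M) (he : IsHyperbolicFamily b e) :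
    ∃ f : G →* symplecticGroup ι O, Function.Injective f := by
  have hJ : LinearMap.BilinForm.toMatrix e b = J ι O := Matrix.ext fun i j => by
    rw [LinearMap.BilinForm.toMatrix_apply, he]
  have hmem : ∀ g, LinearMap.toMatrix e e (ρ g) ∈ symplecticGroup ι O := fun g => by
    rw [SymplecticGroup.mem_iff', ← hJ, ← LinearMap.BilinForm.toMatrix_comp]
    congr 1
    exact LinearMap.ext fun x => LinearMap.ext fun y => hb.invariant g x y
  refine ⟨{ toFun := fun g => ⟨LinearMap.toMatrix e e (ρ g), hmem g⟩
            map_one' := Subtype.ext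
              ((congrArg (LinearMap.toMatrix e e) (map_one ρ)).trans (LinearMap.toMatrix_one e))
            map_mul' := fun g h => Subtype.ext
              ((congrArg (LinearMap.toMatrix e e) (map_mul ρ g h)).trans
                (LinearMap.toMatrix_mul e _ _)) },
    (injective_iff_map_eq_one _).2 fun g hg => hρ g ((LinearMap.toMatrix e e).injective ?_)⟩
  exact (congrArg Subtype.val hg).trans (LinearMap.toMatrix_one e).symm

/-- A symplectic lattice embeds its group into the symplectic group of the given size. -/
theorem HasSymplecticLattice.exists_symplecticGroup_hom {G : Type*} [Group G] {d : ℕ}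
    (h : HasSymplecticLattice O (d + d) ({1} : Set G)) :
    ∃ f : G →* symplecticGroup (Fin d) O, Function.Injective f := by
  obtain ⟨r, hr, ρ, b, hb, hρ⟩ := h
  obtain ⟨s, e, he⟩ := exists_symplectic_basis hb.form
  have hs : r = s + s := by
    rw [← Module.finrank_fin_fun (n := r) O, finrank_eq_card_basis e, Fintype.card_sum,
      Fintype.card_fin]
  -- The rank is padded up to 2d with a hyperbolic lattice carrying the trivial action.
  obtain ⟨B₀, hB₀⟩ := exists_isSymplecticRep_prod_dual
    (Representation.trivial O G (Fin (d - s) → O))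
  obtain ⟨B, hB⟩ := exists_isSymplecticRep_prod hb hB₀
  obtain ⟨s', e', he'⟩ := exists_symplectic_basis hB.form
  have hs' : s' = d := by
    have h1 := finrank_eq_card_basis e'
    rw [Module.finrank_prod, Module.finrank_prod, Module.finrank_fin_fun, Module.finrank_fin_fun,
      ← (Module.finBasis O (Fin (d - s) → O)).toDualEquiv.finrank_eq, Module.finrank_fin_fun,
      Fintype.card_sum, Fintype.card_fin] at h1
    omega
  subst hs'
  exact AbsolutelyUnramified.exists_symplecticGroup_hom hB (fun g hg => hρ g (LinearMap.ext fun x =>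
    congrArg Prod.fst (LinearMap.congr_fun hg (x, 0)))) e' he'

omit hO in
variable (O) in
/-- The main construction: a faithful symplectic representation over the fraction field of a group
with normal subgroup of order prime to `ℓ` and cyclic complement of `ℓ`-power order is isomorphic to
a group of integral symplectic matrices. -/
theorem exists_symplecticGroup_hom_of_isFractionRing [hO : AbsolutelyUnramified ℓ O] {K : Type*}
    [Field K] [Algebra O K] [IsFractionRing O K] {G : Type*} [Group G] [Finite G] {k : ℕ}
    {H : Subgroup G} {t : G} (hG : IsCyclicExtension ℓ k H t) {d : ℕ}
    (f : G →* symplecticGroup (Fin d) K) (hf : Function.Injective f) :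
    ∃ f : G →* symplecticGroup (Fin d) O, Function.Injective f := by
  have : CharZero K := charZero_of_injective_algebraMap (IsFractionRing.injective O K)
  let ρ : Representation K G (Fin d ⊕ Fin d → K) :=
    (Matrix.toLinAlgEquiv' : _ ≃ₐ[K] _).toAlgHom.toRingHom.toMonoidHom.comp
      ((symplecticGroup (Fin d) K).subtype.comp f)
  have hρ : ∀ g x, ρ g x = (f g : Matrix _ _ K) *ᵥ x := fun g x => Matrix.toLinAlgEquiv'_apply _ _
  obtain ⟨b, hb⟩ : ∃ b : (Fin d ⊕ Fin d → K) →ₗ[K] (Fin d ⊕ Fin d → K) →ₗ[K] K,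
      ∀ x y, b x y = x ⬝ᵥ (J (Fin d) K *ᵥ y) :=
    ⟨Matrix.toLinearMap₂' K (J (Fin d) K), fun x y => Matrix.toLinearMap₂'_apply' _ _ _⟩
  have hneg : ∀ x y, b x y = - b y x := fun x y => by
    rw [hb, hb, dotProduct_mulVec, ← mulVec_transpose, J_transpose, neg_mulVec, neg_dotProduct,
      dotProduct_comm]
  have hrep : IsSymplecticRep ρ b := by
    refine ⟨isSymplecticForm_of_separating (fun x => self_eq_neg.1 (hneg x x)) fun x hx => ?_,
      fun g x y => ?_⟩
    · have h1 : x ᵥ* J (Fin d) K = 0 := dotProduct_eq_zero _ fun y => by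
        rw [← dotProduct_mulVec, ← hb, hx]
      have h2 := congrArg (· ᵥ* J (Fin d) K) h1
      simpa only [vecMul_vecMul, J_squared, vecMul_neg, vecMul_one, zero_vecMul, neg_eq_zero] using h2
    · rw [hb, hb, hρ, hρ, ← vecMul_transpose (f g).1 x, ← dotProduct_mulVec, mulVec_mulVec,
        mulVec_mulVec, SymplecticGroup.mem_iff'.1 (f g).2]
  refine HasSymplecticLattice.exists_symplecticGroup_hom ((hasSymplecticLattice_of_injective O hG
    hrep fun g h hgh => hf (Subtype.ext ?_)).mono ?_ le_rfl)
  · exact (Matrix.toLinAlgEquiv' : _ ≃ₐ[K] _).injective hgh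
  · rw [Module.finrank_pi, Fintype.card_sum, Fintype.card_fin]

end AbsolutelyUnramified

end Hyperbolic

/-! ### Rings of integers of unramified extensions. -/

namespace AbsolutelyUnramified

theorem padicInt {ℓ : ℕ} [hp : Fact ℓ.Prime] (h5 : 5 ≤ ℓ) : AbsolutelyUnramified ℓ ℤ_[ℓ] where
  prime := hp.out
  five_le := h5
  maximalIdeal_eq := PadicInt.maximalIdeal_eq_span_p
  complete := inferInstance
  finite := Finite.of_equiv _ PadicInt.residueField.symm.toEquiv
  charZero := inferInstance

variable {ℓ : ℕ} (O : Type*) [CommRing O] [IsDomain O] [IsDiscreteValuationRing O]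
  [hO : AbsolutelyUnramified ℓ O] (S : Type*) [CommRing S] [IsDomain S] [Algebra O S]
  [Module.Finite O S] [Module.Free O S]

-- S/ℓ is finite and, by unramifiedness, reduced. Two powers of x agree modulo ℓ, so some positive
-- power of x is idempotent modulo ℓ and lifts to an idempotent of the domain S. If this is 0, then
-- ℓ divides x by reducedness; if it is 1, then x is a unit.
include hO in
theorem isUnit_of_not_dvd_of_formallyUnramified [Algebra.FormallyUnramified O S] {x : S}
    (hx : ¬ (ℓ : S) ∣ x) : IsUnit x := by
  have hmap : (maximalIdeal O).map (algebraMap O S) = Ideal.span {(ℓ : S)} := by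
    rw [hO.maximalIdeal_eq, Ideal.map_span, Set.image_singleton, map_natCast]
  have hrad : (Ideal.span {(ℓ : S)}).IsRadical :=
    hmap ▸ Algebra.FormallyUnramified.isRadical_map_isMaximal O S (maximalIdeal O)
  have hdvd : ∀ (y : S) n, (ℓ : S) ∣ y ^ n → (ℓ : S) ∣ y := fun y n h =>
    Ideal.mem_span_singleton.1 (hrad ⟨n, Ideal.mem_span_singleton.2 h⟩)
  obtain ⟨π, hπ⟩ := exists_isReduction (ℓ := ℓ) O S
  obtain ⟨a, b, hab, hpow⟩ : ∃ a b : ℕ, a < b ∧ π (x ^ a) = π (x ^ b) := by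
    obtain ⟨a, b, hne, h⟩ := Finite.exists_ne_map_eq_of_infinite fun n : ℕ => π (x ^ n)
    rcases hne.lt_or_gt with h' | h'
    · exact ⟨a, b, h', h⟩
    · exact ⟨b, a, h', h.symm⟩
  obtain ⟨c, rfl⟩ : ∃ c, b = a + (c + 1) := ⟨b - a - 1, by omega⟩
  have h1 : (ℓ : S) ∣ x * (1 - x ^ (c + 1)) := by
    refine hdvd _ (a + 1) ?_
    obtain ⟨z, hz⟩ := hπ.exists_nsmul (x ^ a - x ^ (a + (c + 1))) (by rw [map_sub, hpow, sub_self])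
    rw [nsmul_eq_mul] at hz
    refine ⟨x * (1 - x ^ (c + 1)) ^ a * z, ?_⟩
    rw [mul_pow]
    linear_combination (x * (1 - x ^ (c + 1)) ^ a) * hz
  obtain ⟨z, hz⟩ := h1
  obtain ⟨y, hy⟩ := exists_isIdempotentElem O (ℓ := ℓ) (R := S) (a := x ^ (c + 1))
    (c := - (x ^ c * z)) (by rw [nsmul_eq_mul]; linear_combination (- x ^ c) * hz)
  have h2 := hy.eq
  rcases mul_eq_zero.1 (show (x ^ (c + 1) + ℓ • y) * (x ^ (c + 1) + ℓ • y - 1) = 0 by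
    rw [mul_sub, h2, mul_one, sub_self]) with h3 | h3
  · exact absurd (hdvd x (c + 1) ⟨-y, by rw [nsmul_eq_mul] at h3; linear_combination h3⟩) hx
  · have h4 := isUnit_one_add_nsmul (ℓ := ℓ) O (-y)
    rw [show 1 + ℓ • -y = x ^ (c + 1) by rw [smul_neg]; linear_combination -h3] at h4
    exact (isUnit_pow_iff c.succ_ne_zero).1 h4

include hO in
/-- A finite free formally unramified domain over an absolutely unramified complete discrete
valuation ring is again such a ring. -/
theorem of_formallyUnramified [Algebra.FormallyUnramified O S] :
    ∃ _ : IsDiscreteValuationRing S, AbsolutelyUnramified ℓ S := by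
  have hp := hO.prime
  have hS : CharZero S := charZero_of_injective_algebraMap (FaithfulSMul.algebraMap_injective O S)
  have hl0 : (ℓ : S) ≠ 0 := Nat.cast_ne_zero.2 hp.ne_zero
  have hlu : ¬ IsUnit (ℓ : S) := fun ⟨u, hu⟩ => one_ne_zero (α := S)
    (eq_zero_of_forall_exists_nsmul O (ℓ := ℓ) (1 : S) fun n => ⟨((u⁻¹ : Sˣ) : S) ^ n, by
      rw [nsmul_eq_mul, Nat.cast_pow, ← mul_pow, ← hu, Units.mul_inv, one_pow]⟩)
  have hunit : ∀ x : S, ¬ (ℓ : S) ∣ x → IsUnit x := fun x => isUnit_of_not_dvd_of_formallyUnramified O S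
  have hirr : Irreducible (ℓ : S) := by
    refine ⟨hlu, fun a b hab => ?_⟩
    by_contra! hcon
    obtain ⟨a', rfl⟩ := not_not.1 fun h => hcon.1 (hunit a h)
    refine hcon.2 (IsUnit.of_mul_eq_one a' ?_)
    exact mul_left_cancel₀ hl0 (by linear_combination -hab)
  have hdvr : IsDiscreteValuationRing S :=
    IsDiscreteValuationRing.ofHasUnitMulPowIrreducibleFactorization ⟨ℓ, hirr, fun {x} hx => by
      obtain ⟨m, y, rfl, hy⟩ := exists_eq_pow_nsmul (ℓ := ℓ) (O := O) hx
      obtain ⟨u, rfl⟩ := hunit y fun ⟨z, hz⟩ => hy z (by rw [hz, nsmul_eq_mul])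
      exact ⟨m, u, by rw [nsmul_eq_mul, Nat.cast_pow]⟩⟩
  have hmax : maximalIdeal S = Ideal.span {(ℓ : S)} :=
    (IsDiscreteValuationRing.irreducible_iff_uniformizer _).1 hirr
  have hmem : ∀ (n : ℕ) (x : S), x ∈ (maximalIdeal S ^ n • ⊤ : Submodule S S) ↔
      ∃ z, x = ℓ ^ n • z := fun n x => by
    rw [hmax, Ideal.span_singleton_pow, Submodule.ideal_span_singleton_smul,
      Submodule.mem_smul_pointwise_iff_exists]
    simp only [Submodule.mem_top, true_and, ← Nat.cast_pow, Nat.cast_smul_eq_nsmul, eq_comm]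
  refine ⟨hdvr, hp, hO.five_le, hmax, { haus' := fun x hx => ?_, prec' := fun f hf => ?_ }, ?_, hS⟩
  · refine eq_zero_of_forall_exists_nsmul O (ℓ := ℓ) x fun n => ?_
    have := hx n
    rwa [SModEq.zero, hmem] at this
  · obtain ⟨x, hx⟩ := exists_limit O (ℓ := ℓ) (s := f) fun m n hmn => by
      have := (hf hmn).symm
      rwa [SModEq.sub_mem, hmem] at this
    exact ⟨x, fun n => by rw [SModEq.sub_mem, hmem]; exact hx n⟩
  · obtain ⟨π, hπ⟩ := exists_isReduction (ℓ := ℓ) O S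
    choose s hs using hπ.surjective
    refine Finite.of_surjective (fun q => residue S (s q)) fun y => ?_
    obtain ⟨x, rfl⟩ := residue_surjective y
    refine ⟨π x, ?_⟩
    obtain ⟨z, hz⟩ := hπ.exists_nsmul (s (π x) - x) (by rw [map_sub, hs, sub_self])
    rw [← sub_eq_zero, ← map_sub, residue_eq_zero_iff, hmax, hz, nsmul_eq_mul]
    exact Ideal.mem_span_singleton.2 (dvd_mul_right _ _)

end AbsolutelyUnramified

/-! ### Inertia groups as cyclic extensions, and the theorem. -/

section Group

variable {ℓ : ℕ} {G : Type*} [Group G] [Finite G]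

theorem exists_isCyclicExtension (hp : ℓ.Prime) {H L : Subgroup G} (hH : H.Normal)
    (hHL : H.IsComplement' L) (hcop : (Nat.card H).Coprime ℓ) (hL : IsPGroup ℓ L)
    (hc : IsCyclic L) : ∃ (k : ℕ) (t : G), IsCyclicExtension ℓ k H t := by
  have : Fact ℓ.Prime := ⟨hp⟩
  obtain ⟨⟨t, ht⟩, hgen⟩ := hc.exists_generator
  obtain ⟨k, hk⟩ := IsPGroup.iff_card.1 hL
  have hz : Subgroup.zpowers t = L := by
    refine le_antisymm ((Subgroup.zpowers_le).2 ht) fun x hx => ?_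
    obtain ⟨n, hn⟩ := hgen ⟨x, hx⟩
    exact ⟨n, congrArg Subtype.val hn⟩
  refine ⟨k, t, hH, (Nat.Prime.coprime_iff_not_dvd hp).1 hcop.symm, hz ▸ hHL, ?_⟩
  rw [← Nat.card_zpowers, hz, hk]

/-- An inertia group is an extension of a cyclic `ℓ`-group by a group of order prime to `ℓ`. -/
theorem IsInertiaGroup.exists_isCyclicExtension {p : ℕ} (hp : p.Prime) (hl : ℓ.Prime) (hpl : p ≠ ℓ)
    (hG : IsInertiaGroup p G) : ∃ (H : Subgroup G) (k : ℕ) (t : G), IsCyclicExtension ℓ k H t := by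
  obtain ⟨-, P, C, hPn, hPC, hP, hC, -⟩ := hG
  obtain ⟨⟨c, hc⟩, hgen⟩ := hC.exists_generator
  have hcP : ∀ g : G, ∃ j : ℤ, QuotientGroup.mk' P g = QuotientGroup.mk' P c ^ j := fun g => by
    obtain ⟨⟨x, y⟩, rfl⟩ := hPC.2 g
    obtain ⟨j, hj⟩ := hgen y
    refine ⟨j, ?_⟩
    have h1 : QuotientGroup.mk' P (x : G) = 1 := (QuotientGroup.eq_one_iff _).2 x.2
    rw [map_mul, h1, one_mul, ← map_zpow]
    exact congrArg _ (congrArg Subtype.val hj).symm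
  have hcyc : IsCyclic (G ⧸ P) := ⟨QuotientGroup.mk' P c, fun x => by
    obtain ⟨g, rfl⟩ := QuotientGroup.mk'_surjective P x
    obtain ⟨j, hj⟩ := hcP g
    exact ⟨j, hj.symm⟩⟩
  let : CommGroup (G ⧸ P) := IsCyclic.commGroup
  obtain ⟨k, m, hm, hn⟩ := Nat.exists_eq_pow_mul_and_not_dvd (orderOf_pos c).ne' ℓ hl.ne_one
  have hm0 : m ≠ 0 := fun h => hm (h ▸ dvd_zero ℓ)
  -- With the order of c equal to ℓ^k m, the m-th power map on the cyclic quotient G/P isolates the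
  -- ℓ-part; H is its kernel and t = c^m.
  let χ : G →* G ⧸ P := (powMonoidHom m).comp (QuotientGroup.mk' P)
  have hχ : ∀ g, χ g = QuotientGroup.mk' P g ^ m := fun g => rfl
  have ht : orderOf (c ^ m) = ℓ ^ k := by
    rw [orderOf_pow_of_dvd hm0 ⟨ℓ ^ k, by rw [hn, mul_comm]⟩, hn,
      Nat.mul_div_cancel _ (Nat.pos_of_ne_zero hm0)]
  -- An element of order ℓ in the kernel would have image of order dividing both ℓ and m, so it
  -- would lie in the p-group P.
  have hcard : ¬ ℓ ∣ Nat.card χ.ker := fun h => by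
    have : Fact ℓ.Prime := ⟨hl⟩
    obtain ⟨⟨x, hx⟩, hxl⟩ := exists_prime_orderOf_dvd_card' ℓ h
    rw [Subgroup.orderOf_mk] at hxl
    have h1 : QuotientGroup.mk' P x ^ m = 1 := hx
    have h2 : QuotientGroup.mk' P x ^ ℓ = 1 := by
      rw [← map_pow, ← hxl, pow_orderOf_eq_one, map_one]
    have h3 := pow_gcd_eq_one.2 ⟨h2, h1⟩
    rw [Nat.Coprime.gcd_eq_one ((Nat.Prime.coprime_iff_not_dvd hl).2 hm), pow_one] at h3
    have h4 : x ∈ P := (QuotientGroup.eq_one_iff x).1 h3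
    obtain ⟨j, hj⟩ := hP ⟨x, h4⟩
    have h5 := orderOf_dvd_of_pow_eq_one (congrArg Subtype.val hj : x ^ p ^ j = 1)
    rw [hxl] at h5
    exact hpl ((Nat.prime_dvd_prime_iff_eq hl hp).1 (hl.dvd_of_dvd_pow h5)).symm
  refine ⟨χ.ker, k, c ^ m, inferInstance, hcard, ?_, ht⟩
  refine Subgroup.isComplement'_of_disjoint_and_mul_eq_univ ?_ ?_
  · refine Subgroup.disjoint_of_coprime_natCard ?_
    rw [Nat.card_zpowers, ht]
    exact Nat.Coprime.pow_right k ((Nat.Prime.coprime_iff_not_dvd hl).2 hcard).symm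
  · refine Set.eq_univ_of_forall fun g => ?_
    obtain ⟨j, hj⟩ := hcP g
    obtain ⟨u, v, huv⟩ := Nat.isCoprime_iff_coprime.2
      (Nat.Coprime.pow_left k ((Nat.Prime.coprime_iff_not_dvd hl).2 hm))
    -- As uℓ^k + vm = 1, the power t^(jv) has the same image under χ as g.
    refine Set.mem_mul.2 ⟨g * ((c ^ m) ^ (j * v))⁻¹, ?_, (c ^ m) ^ (j * v), ⟨j * v, rfl⟩,
      inv_mul_cancel_right _ _⟩
    change χ _ = 1
    rw [map_mul, map_inv, mul_inv_eq_one, hχ, hχ, hj, map_zpow, map_pow, ← zpow_natCast,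
      ← zpow_natCast, ← zpow_natCast, ← zpow_mul, ← zpow_mul, ← zpow_mul]
    have h1 : QuotientGroup.mk' P c ^ ((ℓ ^ k * m : ℕ) : ℤ) = 1 := by
      rw [← hn, zpow_natCast, ← map_pow, pow_orderOf_eq_one, map_one]
    have h2 : j * m = m * (j * v) * m + ((ℓ ^ k * m : ℕ) : ℤ) * (u * j) := by
      push_cast at huv ⊢
      linear_combination (- j * m) * huv
    rw [h2, zpow_add, zpow_mul _ ((ℓ ^ k * m : ℕ) : ℤ), h1, one_zpow, mul_one, mul_assoc]

end Group

theorem mainTheorem1 (ℓ : ℕ) [Fact ℓ.Prime] (hℓ : 5 ≤ ℓ) :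
    (∀ (K : Type u) [Field K] [Algebra ℚ_[ℓ] K] [FiniteDimensional ℚ_[ℓ] K]
        [Algebra ℤ_[ℓ] K] [IsScalarTower ℤ_[ℓ] ℚ_[ℓ] K]
        [Algebra.FormallyUnramified ℤ_[ℓ] (integralClosure ℤ_[ℓ] K)]
        (G : Type v) [Group G] [Finite G] (H L : Subgroup G),
        H.Normal → H.IsComplement' L → (Nat.card H).Coprime ℓ → IsPGroup ℓ L → IsCyclic L →
        GroupAlgebraDecomposable K H →
        ∀ d : ℕ, 0 < d →
          (∃ f : G →* Matrix.symplecticGroup (Fin d) K, Function.Injective f) →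
          ∃ f : G →* Matrix.symplecticGroup (Fin d) (integralClosure ℤ_[ℓ] K),
            Function.Injective f) ∧
    (∀ g : ℕ, 0 < g → ∀ p : ℕ, p.Prime → p ≠ ℓ →
        ∀ I : Subgroup (Matrix.symplecticGroup (Fin g) ℚ_[ℓ]), IsInertiaGroup p I →
          ∃ J : Subgroup (Matrix.symplecticGroup (Fin g) ℤ_[ℓ]), Nonempty (I ≃* J)) := by
  have hp : ℓ.Prime := Fact.out
  have hZ := AbsolutelyUnramified.padicInt hℓ
  refine ⟨?_, ?_⟩
  · intro K _ _ _ _ _ _ G _ _ H L hH hHL hcop hL hLc _ d _ ⟨f, hf⟩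
    have hchar : CharZero K := charZero_of_injective_algebraMap (algebraMap ℚ_[ℓ] K).injective
    have hfin : Module.Finite ℤ_[ℓ] (integralClosure ℤ_[ℓ] K) :=
      IsIntegralClosure.finite ℤ_[ℓ] ℚ_[ℓ] K _
    have htf : Module.IsTorsionFree ℤ_[ℓ] K :=
      AbsolutelyUnramified.isTorsionFree_of_isFractionRing ℤ_[ℓ] ℚ_[ℓ]
    have hfree : Module.Free ℤ_[ℓ] (integralClosure ℤ_[ℓ] K) :=
      IsIntegralClosure.module_free ℤ_[ℓ] ℚ_[ℓ] K _
    have hfrac : IsFractionRing (integralClosure ℤ_[ℓ] K) K :=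
      integralClosure.isFractionRing_of_finite_extension ℚ_[ℓ] K
    obtain ⟨hdvr, hO⟩ := AbsolutelyUnramified.of_formallyUnramified ℤ_[ℓ] (integralClosure ℤ_[ℓ] K)
    obtain ⟨k, t, hG⟩ := exists_isCyclicExtension hp hH hHL hcop hL hLc
    exact AbsolutelyUnramified.exists_symplecticGroup_hom_of_isFractionRing _ hG f hf
  · intro g _ p hpp hpl I hI
    have := hI.1
    obtain ⟨H, k, t, hG⟩ := hI.exists_isCyclicExtension hpp hp hpl
    obtain ⟨f, hf⟩ := AbsolutelyUnramified.exists_symplecticGroup_hom_of_isFractionRing ℤ_[ℓ] hG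
      I.subtype I.subtype_injective
    exact ⟨f.range, ⟨MonoidHom.ofInjective hf⟩⟩
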